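/- Let $k$ be a perfect field of characteristic $p>0$, and let $X=\operatorname{Spec}R$ be a normal affine variety over $k$ (so $R$ is a normal domain, finitely generated over $k$) of dimension $d$. Let $\iota\colon U\hookrightarrow X$ be the smooth locus, $\operatorname{Sing}X=X\setminus U$ (its codimension being $\infty$ if it is empty), and $F$ the absolute Frobenius. On $U$ let $C\colon Z\Omega^i_U=\ker(F_*d)\to\Omega^i_U$ be the Cartier operator, whose kernel is $B\Omega^i_U=\operatorname{im}(F_*d)$ and which satisfies $C(a^p\,b_1^{p-1}db_1\wedge\dots\wedge b_i^{p-1}db_i)=a\,db_1\wedge\dots\wedge db_i$. For $n\ge 1$ let $Z_n\Omega^i_U\subseteq F^n_*\Omega^i_U$ be the domain of definition of the $n$-fold iterate $C_n$ of $C$, and let $B_n\Omega^i_U$ be the kernel of $C_n\colon Z_n\Omega^i_U\to\Omega^i_U$. Put $\Omega^{[i]}_X=\iota_*\Omega^i_U$, $Z_n\Omega^{[i]}_X=\iota_*Z_n\Omega^i_U$, $B_n\Omega^{[i]}_X=\iota_*B_n\Omega^i_U$, and $\Omega_X^{[i]}(D)=\Omega_X^{[i]}\otimes\mathcal O_X(D)$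 for a Cartier divisor $D$. If $C=C_1\colon Z_1\Omega^{[i]}_X\to\Omega^{[i]}_X$ is surjective, then so is every $C_n\colon Z_n\Omega^{[i]}_X\to\Omega^{[i]}_X$, and $C_n^{-1}$ denotes the composition $\Omega^{[i]}_X\cong Z_n\Omega^{[i]}_X/B_n\Omega^{[i]}_X\hookrightarrow F^n_*\Omega^{[i]}_X/B_n\Omega^{[i]}_X$. For an integer $m\ge 0$, $X$ is called pre-$m$-$F$-rational if 1. $C\colon Z_1\Omega^{[i]}_X\to\Omega^{[i]}_X$ is surjective for all $0\le i\le m$, and 2. for every closed point $\mathfrak m\in X$ and every Cartier divisor $D\ge 0$ on $X$ there is an integer $n_0>0$ such that the composition $$H^j_{\mathfrak m}\bigl(\Omega^{[i]}_X\bigr)\xrightarrow{\;C_n^{-1}\;}H^j_{\mathfrak m}\Bigl(\frac{F^n_*\Omega^{[i]}_X}{B_n\Omega^{[i]}_X}\Bigr)\longrightarrow H^j_{\mathfrak m}\Bigl(\frac{F^n_*\Omega^{[i]}_X(D)}{B_n\Omega^{[i]}_X}\Bigr)$$ is injective for all $i,j\ge 0$ and $n\ge n_0$ with $i\le m$ and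 $i+j\le d$. **Theorem.** Let $m\ge 0$ be an integer with $m\le \operatorname{codim}_X\operatorname{Sing}X-2$, and suppose that $X$ is pre-$m$-$F$-rational. Then $$H^j_{\mathfrak m}\bigl(\Omega^{[i]}_X\bigr)=0$$ for every closed point $\mathfrak m\in X$ and all integers $i,j\ge 0$ with $i\le m$ and $i+j<d$. -/

import Mathlib

set_option linter.unusedSectionVars false

noncomputable section

namespace HigherF

section DeRham

variable (k A : Type*) [CommRing k] [CommRing A] [Algebra k A]

/-- The algebra `⨁ᵢ Ωⁱ` of differential forms of the `k`-algebra `A`; its part of degree `i` is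
`⋀[A]^i Ω[A⁄k]`. -/
abbrev Forms : Type _ := ExteriorAlgebra A (Ω[A⁄k])

variable {A}

/-- The exact one-form `da`. -/
def dFun (a : A) : Forms k A := ExteriorAlgebra.ι A (KaehlerDifferential.D k A a)

variable {k}

/-- The grading involution, `(-1)ⁱ` on forms of degree `i`. -/
def sgn : Forms k A →ₐ[A] Forms k A := ExteriorAlgebra.map (-LinearMap.id)

@[simp] theorem sgn_ι (m : Ω[A⁄k]) :
    sgn (ExteriorAlgebra.ι A m) = -ExteriorAlgebra.ι A m := by
  simp [sgn]

@[simp] theorem sgn_sgn (x : Forms k A) : sgn (sgn x) = x := by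
  rw [sgn, ← AlgHom.comp_apply, ExteriorAlgebra.map_comp_map]
  simp

theorem ι_mul (m : Ω[A⁄k]) (x : Forms k A) :
    ExteriorAlgebra.ι A m * x = sgn x * ExteriorAlgebra.ι A m := by
  induction x using ExteriorAlgebra.induction with
  | algebraMap r => rw [AlgHom.commutes, Algebra.commutes]
  | ι y =>
    rw [sgn_ι, neg_mul]
    exact eq_neg_of_add_eq_zero_left (ExteriorAlgebra.ι_add_mul_swap m y)
  | mul a b ha hb => rw [← mul_assoc, ha, mul_assoc, hb, map_mul, mul_assoc]
  | add a b ha hb => rw [mul_add, map_add, add_mul, ha, hb]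

theorem span_induction_forms {C : Ω[A⁄k] → Prop}
    (hadd : ∀ x y, C x → C y → C (x + y)) (h0 : C 0)
    (hD : ∀ a b : A, C (a • KaehlerDifferential.D k A b)) (m : Ω[A⁄k]) : C m := by
  have hm : m ∈ Submodule.span A (Set.range (KaehlerDifferential.D k A)) := by
    rw [KaehlerDifferential.span_range_derivation]; trivial
  induction hm using Submodule.closure_induction with
  | zero => exact h0
  | add x y _ _ hx hy => exact hadd x y hx hy
  | smul_mem r x hx => obtain ⟨b, rfl⟩ := hx; exact hD r b

variable (k A)

/-- The ring of matrices `[[sgn x, y], [0, x]]` over the algebra of forms. A ring homomorphism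
`x ↦ [[sgn x, dx], [0, x]]` is the same thing as an odd derivation `d`. -/
def jetSubring : Subring (Matrix (Fin 2) (Fin 2) (Forms k A)) where
  carrier := {M | M 1 0 = 0 ∧ M 0 0 = sgn (M 1 1)}
  mul_mem' {M N} hM hN := by
    obtain ⟨h1, h2⟩ := hM
    obtain ⟨h3, h4⟩ := hN
    constructor <;> simp [Matrix.mul_apply, Fin.sum_univ_two, h1, h2, h3, h4]
  one_mem' := by simp
  add_mem' {M N} hM hN := by
    obtain ⟨h1, h2⟩ := hM
    obtain ⟨h3, h4⟩ := hN
    constructor <;> simp [h1, h2, h3, h4]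
  zero_mem' := by simp
  neg_mem' {M} hM := by
    obtain ⟨h1, h2⟩ := hM
    constructor <;> simp [h1, h2]

/-- The ring `jetSubring` as a type of its own. -/
def Jet : Type _ := jetSubring k A

instance : Ring (Jet k A) := inferInstanceAs (Ring (jetSubring k A))

variable {k A}

/-- The element `[[sgn x, y], [0, x]]`. -/
def Jet.mk (x y : Forms k A) : Jet k A := ⟨!![sgn x, y; 0, x], by constructor <;> simp⟩

/-- The entry `x` of `[[sgn x, y], [0, x]]`. -/
def Jet.base (M : Jet k A) : Forms k A := M.1 1 1

/-- The entry `y` of `[[sgn x, y], [0, x]]`. -/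
def Jet.dot (M : Jet k A) : Forms k A := M.1 0 1

@[simp] theorem Jet.base_mk (x y : Forms k A) : (Jet.mk x y).base = x := rfl
@[simp] theorem Jet.dot_mk (x y : Forms k A) : (Jet.mk x y).dot = y := rfl

theorem Jet.ext {M N : Jet k A} (h1 : M.base = N.base) (h2 : M.dot = N.dot) : M = N := by
  apply Subtype.ext
  ext i j
  fin_cases i <;> fin_cases j
  · exact M.2.2.trans ((congrArg sgn h1).trans N.2.2.symm)
  · exact h2
  · exact M.2.1.trans N.2.1.symm
  · exact h1

@[simp] theorem Jet.base_mul (M N : Jet k A) : (M * N).base = M.base * N.base := by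
  change (M.1 * N.1) 1 1 = _
  simp [Matrix.mul_apply, Fin.sum_univ_two, M.2.1, Jet.base]

@[simp] theorem Jet.dot_mul (M N : Jet k A) :
    (M * N).dot = M.dot * N.base + sgn M.base * N.dot := by
  change (M.1 * N.1) 0 1 = _
  have := M.2.2
  simp [Matrix.mul_apply, Fin.sum_univ_two, this, Jet.base, Jet.dot, add_comm]

@[simp] theorem Jet.base_add (M N : Jet k A) : (M + N).base = M.base + N.base := rfl
@[simp] theorem Jet.dot_add (M N : Jet k A) : (M + N).dot = M.dot + N.dot := rfl
@[simp] theorem Jet.base_zero : (0 : Jet k A).base = 0 := rfl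
@[simp] theorem Jet.dot_zero : (0 : Jet k A).dot = 0 := rfl
@[simp] theorem Jet.base_one : (1 : Jet k A).base = 1 := rfl
@[simp] theorem Jet.dot_one : (1 : Jet k A).dot = 0 := rfl

@[simp] theorem dFun_add (a b : A) : dFun k (a + b) = dFun k a + dFun k b := by simp [dFun]

theorem dFun_mul (a b : A) : dFun k (a * b) = a • dFun k b + b • dFun k a := by
  simp [dFun]

@[simp] theorem dFun_algebraMap (c : k) : dFun k (algebraMap k A c) = 0 := by simp [dFun]

@[simp] theorem dFun_one : dFun k (1 : A) = 0 := by simp [dFun]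
@[simp] theorem dFun_zero : dFun k (0 : A) = 0 := by simp [dFun]

/-- The ring homomorphism `a ↦ [[a, da], [0, a]]`. -/
def Jet.ofFun : A →+* Jet k A where
  toFun a := Jet.mk (algebraMap A _ a) (dFun k a)
  map_one' := Jet.ext (by simp) (by simp)
  map_mul' a b := Jet.ext (by simp) (by
    simp only [Jet.dot_mk, Jet.dot_mul, Jet.base_mk, dFun_mul, AlgHom.commutes]
    rw [← Algebra.commutes b, ← Algebra.smul_def, ← Algebra.smul_def, add_comm])
  map_zero' := Jet.ext (by simp) (by simp)
  map_add' a b := Jet.ext (by simp) (by simp)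

theorem Jet.ofFun_commutes (a : A) (M : Jet k A) : Jet.ofFun a * M = M * Jet.ofFun a := by
  refine Jet.ext ?_ ?_
  · simp [Jet.ofFun, Algebra.commutes]
  · simp only [Jet.ofFun, RingHom.coe_mk, MonoidHom.coe_mk, OneHom.coe_mk, Jet.dot_mul,
      Jet.dot_mk, Jet.base_mk, AlgHom.commutes, dFun, ι_mul, Algebra.commutes a]
    rw [add_comm]

instance : Algebra A (Jet k A) := Jet.ofFun.toAlgebra' Jet.ofFun_commutes

instance : Algebra k (Jet k A) :=
  (Jet.ofFun.comp (algebraMap k A)).toAlgebra' fun c => Jet.ofFun_commutes (algebraMap k A c)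

instance : IsScalarTower k A (Jet k A) := IsScalarTower.of_algebraMap_eq fun _ => rfl

@[simp] theorem Jet.base_smul (a : A) (M : Jet k A) : (a • M).base = a • M.base := by
  rw [Algebra.smul_def, Jet.base_mul, Algebra.smul_def]; rfl

@[simp] theorem Jet.dot_smul (a : A) (M : Jet k A) :
    (a • M).dot = dFun k a * M.base + a • M.dot := by
  rw [Algebra.smul_def, Jet.dot_mul, Algebra.smul_def]
  change _ + sgn (algebraMap A _ a) * _ = _
  rw [AlgHom.commutes]; rfl

theorem dFun_mul_comm (a b : A) : dFun k a * dFun k b = -(dFun k b * dFun k a) :=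
  eq_neg_of_add_eq_zero_left (ExteriorAlgebra.ι_add_mul_swap _ _)

variable (k A)

/-- The derivation `a ↦ [[-da, 0], [0, da]]`. -/
def Jet.der : Derivation k A (Jet k A) :=
  Derivation.mk'
    { toFun := fun a => Jet.mk (dFun k a) 0
      map_add' := fun a b => Jet.ext (by simp) (by simp)
      map_smul' := fun c a => by
        rw [RingHom.id_apply, ← algebraMap_smul A c a, ← algebraMap_smul A c (Jet.mk _ _)]
        refine Jet.ext ?_ ?_
        · simp only [smul_eq_mul, Jet.base_mk, dFun_mul, dFun_algebraMap, smul_zero, add_zero,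
            Jet.base_smul]
        · simp only [Jet.dot_mk, Jet.dot_smul, dFun_algebraMap, zero_mul, smul_zero,
            add_zero] }
    fun a b => Jet.ext (by simp [dFun_mul]) (by simp [dFun_mul_comm a b])

/-- The `A`-linear map `ω ↦ [[-ω, dω], [0, ω]]` on one-forms. -/
def Jet.ofOneForm : Ω[A⁄k] →ₗ[A] Jet k A := (Jet.der k A).liftKaehlerDifferential

variable {k A}

@[simp] theorem Jet.ofOneForm_D (a : A) :
    Jet.ofOneForm k A (KaehlerDifferential.D k A a) = Jet.mk (dFun k a) 0 :=
  (Jet.der k A).liftKaehlerDifferential_comp_D a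

@[simp] theorem Jet.base_ofOneForm (m : Ω[A⁄k]) :
    (Jet.ofOneForm k A m).base = ExteriorAlgebra.ι A m := by
  induction m using span_induction_forms with
  | hadd x y hx hy => simp [hx, hy]
  | h0 => simp
  | hD a b => simp [dFun]

theorem Jet.dot_ofOneForm_commutes (m : Ω[A⁄k]) (x : Forms k A) :
    (Jet.ofOneForm k A m).dot * x = x * (Jet.ofOneForm k A m).dot := by
  induction m using span_induction_forms with
  | hadd y z hy hz => simp [hy, hz, mul_add, add_mul]
  | h0 => simp
  | hD a b =>
    simp only [map_smul, ofOneForm_D, dot_smul, base_mk, dot_mk, smul_zero, add_zero]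
    rw [mul_assoc]
    simp only [dFun]
    rw [ι_mul _ x, ← mul_assoc, ι_mul _ (sgn x), sgn_sgn, mul_assoc]

theorem Jet.ofOneForm_sq (m : Ω[A⁄k]) : Jet.ofOneForm k A m * Jet.ofOneForm k A m = 0 := by
  refine Jet.ext ?_ ?_
  · simp
  · simp [Jet.dot_ofOneForm_commutes]

variable (k A)

/-- The ring homomorphism `ω ↦ [[sgn ω, dω], [0, ω]]`. -/
def Jet.ofForm : Forms k A →ₐ[A] Jet k A :=
  ExteriorAlgebra.lift A ⟨Jet.ofOneForm k A, Jet.ofOneForm_sq⟩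

/-- The exterior derivative `d` on differential forms. -/
def extD : Forms k A →+ Forms k A where
  toFun ω := (Jet.ofForm k A ω).dot
  map_zero' := by simp
  map_add' := by simp

variable {k A}

@[simp] theorem Jet.base_ofForm (ω : Forms k A) : (Jet.ofForm k A ω).base = ω := by
  induction ω using ExteriorAlgebra.induction with
  | algebraMap r => rw [AlgHom.commutes]; rfl
  | ι y => simp [Jet.ofForm]
  | mul a b ha hb => simp [ha, hb]
  | add a b ha hb => simp [ha, hb]

/-- `d` extends the universal derivation. -/
@[simp] theorem extD_algebraMap (a : A) : extD k A (algebraMap A _ a) = dFun k a := by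
  change (Jet.ofForm k A _).dot = _
  rw [AlgHom.commutes]; rfl

@[simp] theorem extD_dFun (a : A) : extD k A (dFun k a) = 0 := by
  change (Jet.ofForm k A _).dot = _
  simp [dFun, Jet.ofForm]

/-- The graded Leibniz rule. -/
theorem extD_mul (x y : Forms k A) :
    extD k A (x * y) = extD k A x * y + sgn x * extD k A y := by
  change (Jet.ofForm k A _).dot = _
  simp [extD]

theorem extD_smul (a : A) (y : Forms k A) :
    extD k A (a • y) = dFun k a * y + a • extD k A y := by
  rw [Algebra.smul_def, extD_mul, extD_algebraMap, AlgHom.commutes, ← Algebra.smul_def]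

/-- Induction over the generators `a` and `da` of the algebra of forms. -/
theorem forms_induction {C : Forms k A → Prop} (hA : ∀ a : A, C (algebraMap A _ a))
    (hd : ∀ a : A, C (dFun k a)) (hmul : ∀ x y, C x → C y → C (x * y))
    (hadd : ∀ x y, C x → C y → C (x + y)) (x : Forms k A) : C x := by
  induction x using ExteriorAlgebra.induction with
  | algebraMap r => exact hA r
  | ι m =>
    induction m using span_induction_forms with
    | hadd x y hx hy => rw [map_add]; exact hadd _ _ hx hy
    | h0 => simpa using hA 0
    | hD a b => rw [map_smul, Algebra.smul_def]; exact hmul _ _ (hA a) (hd b)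
  | mul a b ha hb => exact hmul a b ha hb
  | add a b ha hb => exact hadd a b ha hb

@[simp] theorem sgn_dFun (a : A) : sgn (dFun k a) = -dFun k a := sgn_ι _

theorem extD_sgn (x : Forms k A) : extD k A (sgn x) = -sgn (extD k A x) := by
  induction x using forms_induction with
  | hA a => rw [AlgHom.commutes, extD_algebraMap, sgn_dFun, neg_neg]
  | hd a => simp
  | hmul x y hx hy =>
    rw [map_mul, extD_mul, extD_mul, hx, hy, map_add, map_mul, map_mul]
    simp only [neg_mul, mul_neg, sgn_sgn, neg_add]
  | hadd x y hx hy => rw [map_add, map_add, map_add, map_add, hx, hy, neg_add]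

theorem extD_extD (x : Forms k A) : extD k A (extD k A x) = 0 := by
  induction x using forms_induction with
  | hA a => simp
  | hd a => simp
  | hmul x y hx hy =>
    rw [extD_mul, map_add, extD_mul, extD_mul, hx, hy, extD_sgn, sgn_sgn]
    simp
  | hadd x y hx hy => rw [map_add, map_add, hx, hy, add_zero]

end DeRham

section Cartier

variable (k A : Type*) [CommRing k] [CommRing A] [Algebra k A]

/-- The ring of closed forms. -/
def closedForms : Subring (Forms k A) where
  carrier := {ω | extD k A ω = 0}
  mul_mem' {x y} hx hy := by
    rw [Set.mem_ofPred_eq] at *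
    rw [extD_mul, hx, hy, zero_mul, mul_zero, add_zero]
  one_mem' := by
    have := extD_algebraMap (k := k) (1 : A)
    rwa [map_one, dFun_one] at this
  add_mem' {x y} hx hy := by
    rw [Set.mem_ofPred_eq] at *
    rw [map_add, hx, hy, add_zero]
  zero_mem' := map_zero _
  neg_mem' {x} hx := by
    rw [Set.mem_ofPred_eq] at *
    rw [map_neg, hx, neg_zero]

variable {k A} in
theorem mem_closedForms {ω : Forms k A} : ω ∈ closedForms k A ↔ extD k A ω = 0 := Iff.rfl

/-- The exact forms, a two-sided ideal of the ring of closed forms. -/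
def exactForms : Ideal (closedForms k A) where
  carrier := {ω | ∃ τ : Forms k A, extD k A τ = ω}
  add_mem' := by
    rintro _ _ ⟨x, hx⟩ ⟨y, hy⟩
    exact ⟨x + y, by rw [map_add, hx, hy]; rfl⟩
  zero_mem' := ⟨0, map_zero _⟩
  smul_mem' := by
    rintro z _ ⟨x, hx⟩
    refine ⟨sgn z.1 * x, ?_⟩
    rw [extD_mul, extD_sgn, mem_closedForms.mp z.2, sgn_sgn, hx]
    simp

instance : (exactForms k A).IsTwoSided where
  mul_mem_of_left := by
    rintro _ z ⟨x, hx⟩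
    refine ⟨x * z.1, ?_⟩
    rw [extD_mul, mem_closedForms.mp z.2, hx]
    simp

variable {k A}

theorem dFun_pow (a : A) (n : ℕ) : dFun k (a ^ n) = (n * a ^ (n - 1)) • dFun k a := by
  simp only [dFun, Derivation.leibniz_pow, map_nsmul, map_smul, mul_smul, Nat.cast_smul_eq_nsmul]

theorem pow_smul_dFun_mem (a : A) (n : ℕ) : a ^ n • dFun k a ∈ closedForms k A := by
  rw [mem_closedForms, extD_smul, extD_dFun, smul_zero, add_zero, dFun_pow, smul_mul_assoc]
  simp [dFun]

/-- `(a + b)^(p-1) d(a + b) - a^(p-1) da - b^(p-1) db` is exact: it is `d` of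
`((a + b)^p - a^p - b^p) / p`, expanded with integral coefficients. -/
theorem exists_extD_eq (a b : A) (p : ℕ) (hp : p.Prime) :
    ∃ τ : Forms k A, extD k A τ =
      (a + b) ^ (p - 1) • dFun k (a + b) - a ^ (p - 1) • dFun k a - b ^ (p - 1) • dFun k b := by
  obtain ⟨q, rfl⟩ : ∃ q, p = q + 1 := ⟨p - 1, (Nat.succ_pred_eq_of_pos hp.pos).symm⟩
  have hdvd : ∀ j ∈ Finset.range q, ∃ c : ℕ, (q + 1).choose (j + 1) = (q + 1) * c := by
    intro j hj
    have := Finset.mem_range.mp hj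
    exact hp.dvd_choose_self (by omega) (by omega)
  choose! c hc using hdvd
  refine ⟨algebraMap A _ (∑ j ∈ Finset.range q, (c j : A) * (a ^ (j + 1) * b ^ (q - j))), ?_⟩
  have h1 : ∀ j ∈ Finset.range q, c j * (j + 1) = q.choose j := by
    intro j hj
    have h := Nat.add_one_mul_choose_eq q j
    rw [hc j hj, mul_assoc] at h
    exact (Nat.eq_of_mul_eq_mul_left (Nat.succ_pos q) h).symm
  have h2 : ∀ j ∈ Finset.range q, c j * (q - j) = q.choose (j + 1) := by
    intro j hj
    have hj' := Finset.mem_range.mp hj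
    have h := Nat.choose_succ_right_eq q j
    have e := h1 j hj
    have : (j + 1) * (c j * (q - j)) = (j + 1) * q.choose (j + 1) := by
      rw [mul_comm (j + 1) (q.choose (j + 1)), h, ← e]; ring
    exact Nat.eq_of_mul_eq_mul_left (Nat.succ_pos j) this
  have hd : ∀ j ∈ Finset.range q, dFun k ((c j : A) * (a ^ (j + 1) * b ^ (q - j))) =
      ((q.choose j : A) * (a ^ j * b ^ (q - j))) • dFun k a +
      ((q.choose (j + 1) : A) * (a ^ (j + 1) * b ^ (q - (j + 1)))) • dFun k b := by
    intro j hj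
    have hcast : dFun k ((c j : A)) = 0 := by
      have := dFun_algebraMap (k := k) (A := A) (c j : k)
      rwa [map_natCast] at this
    rw [dFun_mul, dFun_mul, hcast, smul_zero, add_zero, dFun_pow, dFun_pow, ← h1 j hj, ← h2 j hj,
      Nat.add_sub_cancel, Nat.sub_sub]
    push_cast
    module
  have hsum : dFun k (∑ j ∈ Finset.range q, (c j : A) * (a ^ (j + 1) * b ^ (q - j))) =
      ∑ j ∈ Finset.range q, dFun k ((c j : A) * (a ^ (j + 1) * b ^ (q - j))) := by
    simp only [dFun, map_sum]
  have e1 : (a + b) ^ q =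
      (∑ j ∈ Finset.range q, (q.choose j : A) * (a ^ j * b ^ (q - j))) + a ^ q := by
    rw [add_pow, Finset.sum_range_succ]
    simp only [Nat.sub_self, pow_zero, mul_one, Nat.choose_self, Nat.cast_one]
    congr 1
    exact Finset.sum_congr rfl fun j _ => mul_comm _ _
  have e2 : (a + b) ^ q =
      (∑ j ∈ Finset.range q, (q.choose (j + 1) : A) * (a ^ (j + 1) * b ^ (q - (j + 1)))) +
        b ^ q := by
    rw [add_pow, Finset.sum_range_succ']
    simp only [Nat.sub_zero, pow_zero, one_mul, Nat.choose_zero_right, Nat.cast_one, mul_one]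
    congr 1
    exact Finset.sum_congr rfl fun j _ => mul_comm _ _
  rw [extD_algebraMap, hsum, Finset.sum_congr rfl hd, Finset.sum_add_distrib, ← Finset.sum_smul,
    ← Finset.sum_smul, Nat.add_sub_cancel, dFun_add, smul_add]
  nth_rewrite 2 [e2]
  rw [e1]
  module

end Cartier

section Frobenius

theorem charP_of_algebra (k A : Type*) (p : ℕ) [Field k] [CharP k p] [CommRing A] [Nontrivial A]
    [Algebra k A] : CharP A p :=
  charP_of_injective_algebraMap (algebraMap k A).injective p

theorem dFun_pow_p (k : Type*) {A : Type*} (p : ℕ) [Field k] [CharP k p] [CommRing A]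
    [Nontrivial A] [Algebra k A] (a : A) : dFun k (a ^ p) = 0 := by
  have := charP_of_algebra k A p
  rw [dFun_pow, CharP.cast_eq_zero, zero_mul, zero_smul]

variable (k A : Type*) (p : ℕ) [Field k] [CharP k p] [Fact p.Prime] [CommRing A]
  [Nontrivial A] [Algebra k A]

/-- The `n`-th iterate of the Frobenius of a `k`-algebra. -/
def frob (n : ℕ) : A →+* A :=
  haveI := charP_of_algebra k A p
  iterateFrobenius A p n

variable {A} in
@[simp] theorem frob_apply (n : ℕ) (a : A) : frob k A p n a = a ^ p ^ n := rfl

/-- The cohomology algebra of the complex `F_* Ω^•`: closed forms modulo exact forms, where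
`a : A` acts as `a ^ p`. -/
def FrobCohomology : Type _ := have _ := p; closedForms k A ⧸ exactForms k A

instance : Ring (FrobCohomology k A p) :=
  inferInstanceAs (Ring (closedForms k A ⧸ exactForms k A))

/-- The class of a closed form. -/
def FrobCohomology.mk : closedForms k A →+* FrobCohomology k A p :=
  Ideal.Quotient.mk (exactForms k A)

/-- The ring homomorphism `a ↦ [a ^ p]`. -/
def FrobCohomology.ofFun : A →+* FrobCohomology k A p :=
  (FrobCohomology.mk k A p).comp <|
    ((algebraMap A (Forms k A)).comp (frob k A p 1)).codRestrict (closedForms k A) fun a => by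
      rw [mem_closedForms]
      simp [dFun_pow_p, -map_pow]

variable {k A p}

theorem FrobCohomology.mk_surjective : Function.Surjective (FrobCohomology.mk k A p) :=
  Ideal.Quotient.mk_surjective

theorem FrobCohomology.mk_eq_zero {ω : closedForms k A} :
    FrobCohomology.mk k A p ω = 0 ↔ ∃ τ : Forms k A, extD k A τ = ω :=
  Ideal.Quotient.eq_zero_iff_mem

theorem FrobCohomology.ofFun_commutes (a : A) (x : FrobCohomology k A p) :
    FrobCohomology.ofFun k A p a * x = x * FrobCohomology.ofFun k A p a := by
  obtain ⟨z, rfl⟩ := FrobCohomology.mk_surjective x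
  rw [FrobCohomology.ofFun, RingHom.comp_apply, ← map_mul, ← map_mul]
  exact congrArg _ (Subtype.ext (Algebra.commutes (frob k A p 1 a) (z : Forms k A)))

instance : Algebra A (FrobCohomology k A p) :=
  (FrobCohomology.ofFun k A p).toAlgebra' FrobCohomology.ofFun_commutes

instance : Algebra k (FrobCohomology k A p) :=
  ((FrobCohomology.ofFun k A p).comp (algebraMap k A)).toAlgebra' fun c =>
    FrobCohomology.ofFun_commutes (algebraMap k A c)

instance : IsScalarTower k A (FrobCohomology k A p) :=
  IsScalarTower.of_algebraMap_eq fun _ => rfl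

theorem pow_p_smul_mem (a : A) (z : closedForms k A) :
    a ^ p • (z : Forms k A) ∈ closedForms k A := by
  rw [mem_closedForms, extD_smul, dFun_pow_p, mem_closedForms.mp z.2, zero_mul, smul_zero,
    add_zero]

theorem FrobCohomology.smul_mk (a : A) (z : closedForms k A) :
    a • FrobCohomology.mk k A p z =
      FrobCohomology.mk k A p ⟨a ^ p • (z : Forms k A), pow_p_smul_mem a z⟩ := by
  rw [Algebra.smul_def]
  change FrobCohomology.ofFun k A p a * _ = _
  rw [FrobCohomology.ofFun, RingHom.comp_apply, ← map_mul]
  refine congrArg _ (Subtype.ext ?_)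
  change algebraMap A _ (a ^ p ^ 1) * _ = _
  rw [pow_one, ← Algebra.smul_def]

variable (k A p)

/-- The derivation `a ↦ [a ^ (p - 1) da]`. -/
def cartierDer : Derivation k A (FrobCohomology k A p) :=
  Derivation.mk'
    { toFun := fun a => FrobCohomology.mk k A p ⟨a ^ (p - 1) • dFun k a, pow_smul_dFun_mem a _⟩
      map_add' := fun a b => by
        rw [← sub_eq_zero, ← sub_sub, ← map_sub, ← map_sub, FrobCohomology.mk_eq_zero]
        exact exists_extD_eq a b p Fact.out
      map_smul' := fun c a => by
        rw [RingHom.id_apply, ← algebraMap_smul A c a,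
          ← algebraMap_smul A c (FrobCohomology.mk _ _ _ _), FrobCohomology.smul_mk]
        refine congrArg _ (Subtype.ext ?_)
        simp only [smul_eq_mul, dFun_mul, dFun_algebraMap, smul_zero, add_zero, smul_smul]
        congr 1
        obtain ⟨q, hq⟩ : ∃ q, p = q + 1 :=
          ⟨p - 1, (Nat.succ_pred_eq_of_pos (Fact.out : p.Prime).pos).symm⟩
        subst hq
        rw [Nat.add_sub_cancel]
        ring }
    fun a b => by
      change FrobCohomology.mk k A p _ = a • FrobCohomology.mk k A p _ +
        b • FrobCohomology.mk k A p _
      rw [FrobCohomology.smul_mk, FrobCohomology.smul_mk, ← map_add]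
      refine congrArg _ (Subtype.ext ?_)
      change (a * b) ^ (p - 1) • dFun k (a * b) =
        a ^ p • b ^ (p - 1) • dFun k b + b ^ p • a ^ (p - 1) • dFun k a
      obtain ⟨q, hq⟩ : ∃ q, p = q + 1 :=
        ⟨p - 1, (Nat.succ_pred_eq_of_pos (Fact.out : p.Prime).pos).symm⟩
      subst hq
      rw [Nat.add_sub_cancel, dFun_mul]
      module

/-- The `A`-linear map on one-forms with `a db ↦ [a ^ p b ^ (p - 1) db]`. -/
def cartierOneForm : Ω[A⁄k] →ₗ[A] FrobCohomology k A p :=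
  (cartierDer k A p).liftKaehlerDifferential

variable {k A p}

theorem cartierOneForm_D (a : A) : cartierOneForm k A p (KaehlerDifferential.D k A a) =
    FrobCohomology.mk k A p ⟨a ^ (p - 1) • dFun k a, pow_smul_dFun_mem a _⟩ :=
  (cartierDer k A p).liftKaehlerDifferential_comp_D a

theorem exists_cartierOneForm_eq (m : Ω[A⁄k]) : ∃ (x : Ω[A⁄k])
    (hx : ExteriorAlgebra.ι A x ∈ closedForms k A),
    cartierOneForm k A p m = FrobCohomology.mk k A p ⟨ExteriorAlgebra.ι A x, hx⟩ := by
  induction m using span_induction_forms with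
  | hadd y z hy hz =>
    obtain ⟨y', h1, h2⟩ := hy
    obtain ⟨z', h3, h4⟩ := hz
    refine ⟨y' + z', by rw [map_add]; exact add_mem h1 h3, ?_⟩
    rw [map_add, h2, h4, ← map_add]
    exact congrArg _ (Subtype.ext (map_add _ _ _).symm)
  | h0 =>
    refine ⟨0, by rw [map_zero]; exact zero_mem _, ?_⟩
    rw [map_zero, ← map_zero (FrobCohomology.mk k A p)]
    exact congrArg _ (Subtype.ext (map_zero _).symm)
  | hD a b =>
    have e : a ^ p • b ^ (p - 1) • dFun k b =
        ExteriorAlgebra.ι A (a ^ p • b ^ (p - 1) • KaehlerDifferential.D k A b) := by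
      rw [map_smul, map_smul]; rfl
    refine ⟨a ^ p • b ^ (p - 1) • KaehlerDifferential.D k A b, ?_, ?_⟩
    · rw [← e]
      exact pow_p_smul_mem a ⟨_, pow_smul_dFun_mem b _⟩
    · rw [map_smul, cartierOneForm_D, FrobCohomology.smul_mk]
      exact congrArg _ (Subtype.ext e)

theorem cartierOneForm_sq (m : Ω[A⁄k]) :
    cartierOneForm k A p m * cartierOneForm k A p m = 0 := by
  obtain ⟨x, hx, e⟩ := exists_cartierOneForm_eq (p := p) m
  rw [e, ← map_mul, ← map_zero (FrobCohomology.mk k A p)]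
  exact congrArg _ (Subtype.ext (ExteriorAlgebra.ι_sq_zero x))

variable (k A p)

/-- The inverse Cartier operator `C⁻¹`, the homomorphism of `A`-algebras from forms to the
cohomology of `F_* Ω^•` with `a db₁ ∧ ⋯ ∧ dbᵢ ↦ [aᵖ b₁ᵖ⁻¹ db₁ ∧ ⋯ ∧ bᵢᵖ⁻¹ dbᵢ]`. -/
def cartierInv : Forms k A →ₐ[A] FrobCohomology k A p :=
  ExteriorAlgebra.lift A ⟨cartierOneForm k A p, cartierOneForm_sq⟩

variable {k A}

/-- The graph of the Cartier operator: `ω` is closed and `C ω = η`, that is, `C⁻¹ η` is the class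
of `ω` modulo exact forms. -/
def IsCartier (ω η : Forms k A) : Prop :=
  ∃ h : ω ∈ closedForms k A, FrobCohomology.mk k A p ⟨ω, h⟩ = cartierInv k A p η

/-- The graph of the iterated Cartier operator: `Cₙ ω = η`. The forms `ω` for which `Cₙ ω` is
defined are those of `Zₙ Ω`, and those with `Cₙ ω = 0` are the forms of `Bₙ Ω`. -/
def IsCartierIter : ℕ → Forms k A → Forms k A → Prop
  | 0, ω, η => ω = η
  | n + 1, ω, η => ∃ ζ, IsCartier p ω ζ ∧ IsCartierIter n ζ η

variable {p}

theorem isCartierIter_one_zero {ω : Forms k A} :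
    IsCartierIter p 1 ω 0 ↔ ∃ τ, extD k A τ = ω := by
  constructor
  · rintro ⟨_, ⟨h, e⟩, rfl⟩
    rw [map_zero, FrobCohomology.mk_eq_zero] at e
    exact e
  · rintro ⟨τ, rfl⟩
    refine ⟨0, ⟨extD_extD τ, ?_⟩, rfl⟩
    rw [map_zero, FrobCohomology.mk_eq_zero]
    exact ⟨τ, rfl⟩

theorem IsCartier.add {ω₁ ω₂ η₁ η₂ : Forms k A} (h₁ : IsCartier p ω₁ η₁)
    (h₂ : IsCartier p ω₂ η₂) : IsCartier p (ω₁ + ω₂) (η₁ + η₂) := by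
  obtain ⟨h₁, e₁⟩ := h₁
  obtain ⟨h₂, e₂⟩ := h₂
  refine ⟨add_mem h₁ h₂, ?_⟩
  rw [map_add, ← e₁, ← e₂, ← map_add]
  rfl

theorem IsCartier.pow_smul {ω η : Forms k A} (h : IsCartier p ω η) (a : A) :
    IsCartier p (a ^ p • ω) (a • η) := by
  obtain ⟨h, e⟩ := h
  refine ⟨pow_p_smul_mem a ⟨ω, h⟩, ?_⟩
  rw [map_smul, ← e, FrobCohomology.smul_mk]

theorem IsCartierIter.add {n : ℕ} {ω₁ ω₂ η₁ η₂ : Forms k A} (h₁ : IsCartierIter p n ω₁ η₁)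
    (h₂ : IsCartierIter p n ω₂ η₂) : IsCartierIter p n (ω₁ + ω₂) (η₁ + η₂) := by
  induction n generalizing ω₁ ω₂ with
  | zero => exact congrArg₂ _ h₁ h₂
  | succ n ih =>
    obtain ⟨ζ₁, a₁, b₁⟩ := h₁
    obtain ⟨ζ₂, a₂, b₂⟩ := h₂
    exact ⟨ζ₁ + ζ₂, a₁.add a₂, ih b₁ b₂⟩

theorem IsCartierIter.pow_smul {n : ℕ} {ω η : Forms k A} (h : IsCartierIter p n ω η) (a : A) :
    IsCartierIter p n (a ^ p ^ n • ω) (a • η) := by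
  induction n generalizing ω with
  | zero =>
    rw [pow_zero, pow_one]
    exact congrArg (a • ·) h
  | succ n ih =>
    obtain ⟨ζ, h₁, h₂⟩ := h
    refine ⟨a ^ p ^ n • ζ, ?_, ih h₂⟩
    rw [pow_succ, pow_mul]
    exact h₁.pow_smul _

theorem IsCartierIter.zero (n : ℕ) : IsCartierIter p n (0 : Forms k A) 0 := by
  induction n with
  | zero => rfl
  | succ n ih =>
    refine ⟨0, ⟨map_zero _, ?_⟩, ih⟩
    rw [map_zero, FrobCohomology.mk_eq_zero]
    exact ⟨0, map_zero _⟩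

theorem IsCartier.neg {ω η : Forms k A} (h : IsCartier p ω η) : IsCartier p (-ω) (-η) := by
  obtain ⟨h, e⟩ := h
  refine ⟨neg_mem h, ?_⟩
  rw [map_neg, ← e, ← map_neg]
  rfl

theorem IsCartierIter.neg {n : ℕ} {ω η : Forms k A} (h : IsCartierIter p n ω η) :
    IsCartierIter p n (-ω) (-η) := by
  induction n generalizing ω with
  | zero => exact congrArg _ h
  | succ n ih =>
    obtain ⟨ζ, h₁, h₂⟩ := h
    exact ⟨-ζ, h₁.neg, ih h₂⟩

end Frobenius

section Functoriality

variable (k A B : Type*) [CommRing k] [CommRing A] [CommRing B] [Algebra k A] [Algebra k B]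
  [Algebra A B] [IsScalarTower k A B]

/-- The pullback of differential forms along `A → B`. -/
def pullback : Forms k A →ₐ[A] Forms k B :=
  ExteriorAlgebra.lift A
    ⟨(ExteriorAlgebra.ι B).restrictScalars A ∘ₗ KaehlerDifferential.map k k A B, fun m =>
      ExteriorAlgebra.ι_sq_zero (KaehlerDifferential.map k k A B m)⟩

theorem pullback_ι (m : Ω[A⁄k]) : pullback k A B (ExteriorAlgebra.ι A m) =
    ExteriorAlgebra.ι B (KaehlerDifferential.map k k A B m) :=
  ExteriorAlgebra.lift_ι_apply _ _ _ _

/-- Forms on a domain with free module of differentials embed into forms on its fraction field. -/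
theorem pullback_injective [IsDomain A] [IsFractionRing A B] [Module.Free A Ω[A⁄k]] :
    Function.Injective (pullback k A B) := by
  classical
  let b := Module.Free.chooseBasis A Ω[A⁄k]
  let : LinearOrder (Module.Free.ChooseBasisIndex A Ω[A⁄k]) := linearOrderOfSTO WellOrderingRel
  let b' := b.ofIsLocalizedModule B (nonZeroDivisors A) (KaehlerDifferential.map k k A B)
  have key : ∀ s, pullback k A B (b.ExteriorAlgebra s) = b'.ExteriorAlgebra s := by
    intro s
    rw [ExteriorAlgebra.basis_apply, ExteriorAlgebra.basis_apply]
    simp only [ExteriorAlgebra.ιMulti_family, ExteriorAlgebra.ιMulti_apply, map_list_prod,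
      List.map_ofFn]
    congr 2
    funext i
    simp [pullback_ι, b']
  rw [injective_iff_map_eq_zero]
  intro x hx
  obtain ⟨c, rfl⟩ : ∃ c : Finset (Module.Free.ChooseBasisIndex A Ω[A⁄k]) →₀ A,
      x = ∑ s ∈ c.support, c s • b.ExteriorAlgebra s :=
    ⟨b.ExteriorAlgebra.repr x, (b.ExteriorAlgebra.linearCombination_repr x).symm⟩
  have h2 : ∑ s ∈ c.support, (algebraMap A B (c s)) • b'.ExteriorAlgebra s = 0 := by
    rw [← hx, map_sum]
    refine Finset.sum_congr rfl fun s _ => ?_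
    rw [map_smul, key, algebraMap_smul]
  have h3 := linearIndependent_iff'.mp b'.ExteriorAlgebra.linearIndependent _ _ h2
  refine Finset.sum_eq_zero fun s hs => ?_
  have := h3 s hs
  rw [(FaithfulSMul.algebraMap_injective A B).eq_iff' (map_zero _)] at this
  rw [this, zero_smul]

end Functoriality

section Push

variable (k : Type*) (p n : ℕ) (M : Type*)

/-- `Fⁿ_* M`: the group `M`, on which a scalar `r` acts as `r ^ (p ^ n)`. -/
def FPush : Type _ := have _ := k; have _ := p; have _ := n; M

variable {R : Type*} [Field k] [CharP k p] [Fact p.Prime] [CommRing R] [Nontrivial R]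
  [Algebra k R] [AddCommGroup M] [Module R M]

instance : AddCommGroup (FPush k p n M) := inferInstanceAs (AddCommGroup M)

instance : Module R (FPush k p n M) := Module.compHom M (frob k R p n)

/-- The identity map `M → Fⁿ_* M`. -/
def FPush.of : M ≃+ FPush k p n M := AddEquiv.refl M

variable {M}

theorem FPush.smul_of (r : R) (x : M) :
    r • FPush.of k p n M x = FPush.of k p n M (r ^ p ^ n • x) := rfl

/-- The submodule `Fⁿ_* N` of `Fⁿ_* M`. -/
def FPush.submodule (N : Submodule R M) : Submodule R (FPush k p n M) where
  carrier := {x | (FPush.of k p n M).symm x ∈ N}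
  add_mem' hx hy := N.add_mem hx hy
  zero_mem' := N.zero_mem
  smul_mem' r _ hx := N.smul_mem (r ^ p ^ n) hx

end Push

section Reflexive

variable (k R : Type*) [Field k] [CommRing R] [IsDomain R] [Algebra k R]

variable {R} in
/-- The local ring of `Spec R` at `q`. -/
abbrev Stalk (q : PrimeSpectrum R) : Type _ := Localization.AtPrime q.asIdeal

instance (q : PrimeSpectrum R) : IsScalarTower k (Stalk q) (FractionRing R) :=
  IsScalarTower.of_algebraMap_eq fun c => by
    rw [IsScalarTower.algebraMap_apply k R (FractionRing R),
      IsScalarTower.algebraMap_apply k R (Stalk q), ← IsScalarTower.algebraMap_apply R (Stalk q) (FractionRing R)]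

/-- Rational differential forms on `Spec R`. -/
abbrev RatForms : Type _ := Forms k (FractionRing R)

variable {R} in
/-- Forms on the local ring at `q`, as rational forms. -/
abbrev germToRat (q : PrimeSpectrum R) : Forms k (Stalk q) →ₐ[Stalk q] RatForms k R :=
  pullback k (Stalk q) (FractionRing R)

/-- The module `Ω^[i]` of reflexive `i`-forms, that is, of `i`-forms on the smooth locus of
`Spec R` over `k`: the rational forms that are regular at every point of the smooth locus. -/
def reflForms (i : ℕ) : Submodule R (RatForms k R) where
  carrier := {ω | ∀ q ∈ Algebra.smoothLocus k R,
    ∃ ω' ∈ ⋀[Stalk q]^i Ω[Stalk q⁄k], germToRat k q ω' = ω}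
  add_mem' {x y} hx hy q hq := by
    obtain ⟨x', h1, rfl⟩ := hx q hq
    obtain ⟨y', h2, rfl⟩ := hy q hq
    exact ⟨x' + y', add_mem h1 h2, map_add _ _ _⟩
  zero_mem' q _ := ⟨0, zero_mem _, map_zero _⟩
  smul_mem' r x hx q hq := by
    obtain ⟨x', h1, rfl⟩ := hx q hq
    refine ⟨algebraMap R (Stalk q) r • x', Submodule.smul_mem _ _ h1, ?_⟩
    rw [map_smul, algebraMap_smul]

/-- The module `Ω^[i](D)`, where `I` is the ideal `𝒪(-D)` of the effective Cartier divisor `D`: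
the rational forms `ω` with `I ω ⊆ Ω^[i]`. -/
def reflFormsTwist (I : Ideal R) (i : ℕ) : Submodule R (RatForms k R) where
  carrier := {ω | ∀ a ∈ I, a • ω ∈ reflForms k R i}
  add_mem' {x y} hx hy a ha := by rw [smul_add]; exact add_mem (hx a ha) (hy a ha)
  zero_mem' a _ := by rw [smul_zero]; exact zero_mem _
  smul_mem' r x hx a ha := by rw [smul_comm]; exact Submodule.smul_mem _ _ (hx a ha)

theorem reflForms_le_twist (I : Ideal R) (i : ℕ) : reflForms k R i ≤ reflFormsTwist k R I i :=
  fun _ hω a _ => Submodule.smul_mem _ a hω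

variable (p : ℕ) [CharP k p] [Fact p.Prime]

/-- The graph of the reflexive Cartier operator `Cₙ : Zₙ Ω^[i] → Ω^[i]`: at every point of the
smooth locus, `ω` and `η` are regular `i`-forms and `Cₙ ω = η`. -/
def IsReflCartier (n i : ℕ) (ω η : RatForms k R) : Prop :=
  ∀ q ∈ Algebra.smoothLocus k R, ∃ ω' ∈ ⋀[Stalk q]^i Ω[Stalk q⁄k],
    ∃ η' ∈ ⋀[Stalk q]^i Ω[Stalk q⁄k],
      germToRat k q ω' = ω ∧ germToRat k q η' = η ∧ IsCartierIter p n ω' η'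

/-- The submodule `Bₙ Ω^[i]` of `Fⁿ_* Ω^[i]`: the rational forms that lie in `Bₙ Ωⁱ`, the kernel
of `Cₙ`, at every point of the smooth locus. -/
def reflB (n i : ℕ) : Submodule R (FPush k p n (RatForms k R)) where
  carrier := {ω | ∀ q ∈ Algebra.smoothLocus k R, ∃ ω' ∈ ⋀[Stalk q]^i Ω[Stalk q⁄k],
    FPush.of k p n _ (germToRat k q ω') = ω ∧ IsCartierIter p n ω' 0}
  add_mem' {x y} hx hy q hq := by
    obtain ⟨x', h1, rfl, h2⟩ := hx q hq
    obtain ⟨y', h3, rfl, h4⟩ := hy q hq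
    exact ⟨x' + y', add_mem h1 h3, by rw [map_add, map_add], by simpa using h2.add h4⟩
  zero_mem' q _ := ⟨0, zero_mem _, by rw [map_zero, map_zero], IsCartierIter.zero n⟩
  smul_mem' r x hx q hq := by
    obtain ⟨x', h1, rfl, h2⟩ := hx q hq
    refine ⟨algebraMap R (Stalk q) r ^ p ^ n • x', Submodule.smul_mem _ _ h1, ?_, ?_⟩
    · rw [map_smul, FPush.smul_of, ← map_pow, algebraMap_smul]
    · simpa using h2.pow_smul (algebraMap R (Stalk q) r)

/-- Surjectivity of the Cartier operator `C : Z Ω^[i] → Ω^[i]`. -/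
def CartierSurjective (i : ℕ) : Prop :=
  ∀ η ∈ reflForms k R i, ∃ ω ∈ reflForms k R i, IsReflCartier k R p 1 i ω η

variable {k R p}

theorem germToRat_injective [Algebra.FiniteType k R] {q : PrimeSpectrum R}
    (hq : q ∈ Algebra.smoothLocus k R) : Function.Injective (germToRat k q) := by
  have : Algebra.FormallySmooth k (Stalk q) := hq
  have : Module.Free (Stalk q) Ω[Stalk q⁄k] := Module.free_of_flat_of_isLocalRing
  exact pullback_injective k (Stalk q) (FractionRing R)

theorem IsReflCartier.add {n i : ℕ} {ω₁ ω₂ η₁ η₂ : RatForms k R}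
    (h₁ : IsReflCartier k R p n i ω₁ η₁) (h₂ : IsReflCartier k R p n i ω₂ η₂) :
    IsReflCartier k R p n i (ω₁ + ω₂) (η₁ + η₂) := fun q hq => by
  obtain ⟨x₁, hx₁, y₁, hy₁, rfl, rfl, c₁⟩ := h₁ q hq
  obtain ⟨x₂, hx₂, y₂, hy₂, rfl, rfl, c₂⟩ := h₂ q hq
  exact ⟨x₁ + x₂, add_mem hx₁ hx₂, y₁ + y₂, add_mem hy₁ hy₂, map_add _ _ _, map_add _ _ _,
    c₁.add c₂⟩

theorem IsReflCartier.pow_smul {n i : ℕ} {ω η : RatForms k R}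
    (h : IsReflCartier k R p n i ω η) (r : R) :
    IsReflCartier k R p n i (r ^ p ^ n • ω) (r • η) := fun q hq => by
  obtain ⟨x, hx, y, hy, rfl, rfl, c⟩ := h q hq
  refine ⟨algebraMap R (Stalk q) r ^ p ^ n • x, Submodule.smul_mem _ _ hx,
    algebraMap R (Stalk q) r • y, Submodule.smul_mem _ _ hy, ?_, ?_, c.pow_smul _⟩
  · rw [map_smul, ← map_pow, algebraMap_smul]
  · rw [map_smul, algebraMap_smul]

theorem IsReflCartier.mem_left {n i : ℕ} {ω η : RatForms k R}
    (h : IsReflCartier k R p n i ω η) : ω ∈ reflForms k R i := fun q hq => by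
  obtain ⟨x, hx, y, hy, rfl, rfl, c⟩ := h q hq
  exact ⟨x, hx, rfl⟩

/-- `Cₙ` has kernel `Bₙ Ω^[i]`. -/
theorem IsReflCartier.sub_mem [Algebra.FiniteType k R] {n i : ℕ} {ω₁ ω₂ η : RatForms k R}
    (h₁ : IsReflCartier k R p n i ω₁ η) (h₂ : IsReflCartier k R p n i ω₂ η) :
    FPush.of k p n _ (ω₁ - ω₂) ∈ reflB k R p n i := fun q hq => by
  obtain ⟨x₁, hx₁, y₁, hy₁, rfl, e₁, c₁⟩ := h₁ q hq
  obtain ⟨x₂, hx₂, y₂, hy₂, rfl, e₂, c₂⟩ := h₂ q hq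
  obtain rfl := germToRat_injective hq (e₁.trans e₂.symm)
  refine ⟨x₁ - x₂, _root_.sub_mem hx₁ hx₂, by rw [map_sub], ?_⟩
  simpa [sub_eq_add_neg] using c₁.add c₂.neg

/-- If `C : Z Ω^[i] → Ω^[i]` is surjective, then so is `Cₙ : Zₙ Ω^[i] → Ω^[i]`. -/
theorem CartierSurjective.iter [Algebra.FiniteType k R] {i : ℕ} (h : CartierSurjective k R p i)
    (n : ℕ) {η : RatForms k R} (hη : η ∈ reflForms k R i) :
    ∃ ω, IsReflCartier k R p n i ω η := by
  induction n with
  | zero =>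
    refine ⟨η, fun q hq => ?_⟩
    obtain ⟨y, hy, rfl⟩ := hη q hq
    exact ⟨y, hy, y, hy, rfl, rfl, rfl⟩
  | succ n ih =>
    obtain ⟨ζ, hζ⟩ := ih
    obtain ⟨ω, -, hω⟩ := h ζ hζ.mem_left
    refine ⟨ω, fun q hq => ?_⟩
    obtain ⟨x, hx, y, hy, rfl, rfl, c⟩ := hζ q hq
    obtain ⟨z, hz, x', hx', rfl, e, c'⟩ := hω q hq
    obtain rfl := germToRat_injective hq e
    obtain ⟨_, c', rfl⟩ := c'
    exact ⟨z, hz, y, hy, rfl, rfl, _, c', c⟩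

variable (k R p)

/-- The module `Fⁿ_* Ω^[i] / Bₙ Ω^[i]`. -/
abbrev ReflQuot (n i : ℕ) : Type _ :=
  FPush.submodule k p n (reflForms k R i) ⧸
    (reflB k R p n i).submoduleOf (FPush.submodule k p n (reflForms k R i))

/-- The module `Fⁿ_* Ω^[i](D) / Bₙ Ω^[i]`, where `I = 𝒪(-D)`. -/
abbrev ReflQuotTwist (I : Ideal R) (n i : ℕ) : Type _ :=
  FPush.submodule k p n (reflFormsTwist k R I i) ⧸
    (reflB k R p n i).submoduleOf (FPush.submodule k p n (reflFormsTwist k R I i))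

variable {k R p}

/-- The class in `Fⁿ_* Ω^[i] / Bₙ Ω^[i]` of a form in `Zₙ Ω^[i]`. -/
def IsReflCartier.toQuot {n i : ℕ} {ω η : RatForms k R} (h : IsReflCartier k R p n i ω η) :
    ReflQuot k R p n i :=
  Submodule.Quotient.mk ⟨FPush.of k p n _ ω, h.mem_left⟩

theorem IsReflCartier.toQuot_eq [Algebra.FiniteType k R] {n i : ℕ} {ω₁ ω₂ η : RatForms k R}
    (h₁ : IsReflCartier k R p n i ω₁ η) (h₂ : IsReflCartier k R p n i ω₂ η) :
    h₁.toQuot = h₂.toQuot :=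
  (Submodule.Quotient.eq _).mpr (h₁.sub_mem h₂)

variable [Algebra.FiniteType k R]

/-- The iterated inverse Cartier operator `Cₙ⁻¹ : Ω^[i] → Fⁿ_* Ω^[i] / Bₙ Ω^[i]`, which sends `η`
to the class of any `ω` in `Zₙ Ω^[i]` with `Cₙ ω = η`. -/
def CartierSurjective.inverse {i : ℕ} (h : CartierSurjective k R p i) (n : ℕ) :
    reflForms k R i →ₗ[R] ReflQuot k R p n i where
  toFun η := (h.iter n η.2).choose_spec.toQuot
  map_add' η₁ η₂ := (h.iter n (η₁ + η₂).2).choose_spec.toQuot_eq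
    ((h.iter n η₁.2).choose_spec.add (h.iter n η₂.2).choose_spec)
  map_smul' r η := (h.iter n (r • η).2).choose_spec.toQuot_eq
    ((h.iter n η.2).choose_spec.pow_smul r)

theorem CartierSurjective.inverse_apply {i : ℕ} (h : CartierSurjective k R p i) (n : ℕ)
    (η : reflForms k R i) {ω : RatForms k R} (hω : IsReflCartier k R p n i ω η) :
    h.inverse n η = hω.toQuot :=
  (h.iter n η.2).choose_spec.toQuot_eq hω

variable (k R p)

/-- The natural map `Fⁿ_* Ω^[i] / Bₙ Ω^[i] → Fⁿ_* Ω^[i](D) / Bₙ Ω^[i]`, where `I = 𝒪(-D)`. -/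
def reflQuotTwistMap (I : Ideal R) (n i : ℕ) :
    ReflQuot k R p n i →ₗ[R] ReflQuotTwist k R p I n i :=
  Submodule.mapQ _ _
    (Submodule.inclusion (p := FPush.submodule k p n (reflForms k R i))
      (p' := FPush.submodule k p n (reflFormsTwist k R I i))
      fun _ h => reflForms_le_twist k R I i h)
    fun _ h => h

end Reflexive

section Main

universe u v

variable (k : Type v) (R : Type u) (p : ℕ) [Field k] [CharP k p] [Fact p.Prime] [CommRing R]
  [IsDomain R] [Algebra k R] [Algebra.FiniteType k R]

/-- The codimension in `Spec R` of the singular locus, the complement of the smooth locus over `k`: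
the infimum of the heights of its points. It is `⊤` when the singular locus is empty. -/
def codimSing : ℕ∞ := ⨅ q ∈ (Algebra.smoothLocus k R)ᶜ, q.asIdeal.height

/-- `Spec R` is pre-`m`-`F`-rational. An effective Cartier divisor `D` is given by its ideal
`I = 𝒪(-D)`, an ideal that is invertible as a fractional ideal. -/
def IsPreFRational (m : ℕ) : Prop :=
  ∃ hC : ∀ i ≤ m, CartierSurjective k R p i,
    ∀ (𝔪 : Ideal R) [𝔪.IsMaximal] (I : Ideal R),
      IsUnit (I : FractionalIdeal (nonZeroDivisors R) (FractionRing R)) →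
        ∃ n₀ > 0, ∀ (i : ℕ) (hi : i ≤ m) (j n : ℕ), n₀ ≤ n →
          ((i + j : ℕ) : WithBot ℕ∞) ≤ ringKrullDim R →
            Function.Injective ((localCohomology 𝔪 j).map
              (ModuleCat.ofHom (reflQuotTwistMap k R p I n i ∘ₗ (hC i hi).inverse n)))

end Main

end HigherF

end

/-! The proof is an induction on `i`. What is carried along is the vanishing of `H^j(B₁ Ω^[i])` at
all closed points for `j ≤ d - i` (`lcVanish_reflB_one`). It starts from `B₁ Ω^[0] = 0`.

From `B₁ Ω^[i]` to `Ω^[i]` (`lcVanish_reflForms`). The sequences `0 → Fⁿ_* B₁ → B_(n+1) → Bₙ → 0`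
carry the vanishing over to every `Bₙ`, so `H^j(Fⁿ_* Ω^[i]) → H^j(Fⁿ_* Ω^[i] / Bₙ)` is surjective
for `j < d - i`. There is a single `c ≠ 0` in `R`, the same for all `n`, such that multiplication by
`c` on the group underlying `Fⁿ_* Ω^[i]` induces zero on `H^j` for `j < d` (`exists_lcMap_eq_zero`).
Let `D` be the divisor of `c`. The inclusion `Fⁿ_* Ω^[i] → Fⁿ_* Ω^[i](D)` is multiplication by `c`
followed by division by `c`, hence zero on `H^j`; by surjectivity `H^j(Fⁿ_* Ω^[i] / Bₙ) → H^j(Fⁿ_*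
Ω^[i](D) / Bₙ)` is zero too. Its composite with `Cₙ⁻¹` is injective for large `n`, so `H^j(Ω^[i]) =
0`.

From `Ω^[i]` to `B₁ Ω^[i+1]`. Since `H^j(B₁) = 0` for `j ≤ d - i`, the map `C` embeds `H^j(Z)` in
`H^j(Ω^[i])`, and `C_(n+1)⁻¹` (with `D = 0`) is injective on the latter. The composite `C_(n+1)⁻¹ ∘
C` factors through `Z ⊆ F_* Ω^[i]`, so `H^j(Z) → H^j(F_* Ω^[i])` is injective for `j ≤ d - i`
(`lcMap_inclusion_reflZ_injective`). The sequence `0 → Z → F_* Ω^[i] → dΩ^[i] → 0` then gives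
`H^j(dΩ^[i]) = 0` for `j < d - i`. Finally `dΩ^[i] = B₁ Ω^[i+1]` (`range_reflD_eq`): the two agree
on the smooth locus, and the singular locus has dimension at most `d - m - 2`, too small for a
module of depth at least `d - i` at every closed point to have a nonzero `Ext¹` from it (an
Ischebeck-type bound).

The uniform `c` comes from a Noether normalization `S ⊆ R` with variables in `𝔪`. Some nonzero `c₀ ∈
S` makes `c₀ · id` on the module factor through a free `S`-module, so `c₀` kills all colon modules
of powers of the variables. This property passes to `Fⁿ_*` and forces `c₀^(j+1)` to kill `H^j`.

These arguments rest on the Cartier isomorphism at smooth points, proved in logarithmic coordinates,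
and on long exact sequences for local cohomology, regarded as a colimit of `Ext` groups. -/

set_option linter.unusedSectionVars false

noncomputable section

namespace HigherF

/-! ### Comparison of two constructions of `Ext`. -/

section DerivedExt

universe u

open CategoryTheory Opposite HomologicalComplex Limits

variable {R : Type u} [CommRing R]

/-- The functor `X ↦ Hom(X, Y)` with values in the opposite of the category of modules. -/
abbrev homFun (Y : ModuleCat.{u} R) : ModuleCat.{u} R ⥤ (ModuleCat.{u} R)ᵒᵖ :=
  ((linearYoneda R (ModuleCat.{u} R)).obj Y).rightOp

/-- The complex `Hom(P, Y)`, as a chain complex in the opposite category. -/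
abbrev homComplex {X : ModuleCat.{u} R} (P : ProjectiveResolution X) (Y : ModuleCat.{u} R) :
    ChainComplex (ModuleCat.{u} R)ᵒᵖ ℕ :=
  ((homFun Y).mapHomologicalComplex _).obj P.complex

/-- The module underlying the derived functor `Extⁿ(X, Y)`. -/
abbrev DerivedExt (X Y : ModuleCat.{u} R) (n : ℕ) : ModuleCat.{u} R :=
  ((_root_.Ext R (ModuleCat.{u} R) n).obj (op X)).obj Y

/-- `Extⁿ(X, Y)` as homology of `Hom(P, Y)`. -/
def derivedIso {X : ModuleCat.{u} R} (P : ProjectiveResolution X) (Y : ModuleCat.{u} R) (n : ℕ) :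
    ((homFun Y).leftDerived n).obj X ≅ (homComplex P Y).homology n :=
  P.isoLeftDerivedObj (homFun Y) n

/-- The map from cocycles in `Hom(Pₙ, Y)` to `Extⁿ(X, Y)`. -/
def cocyclesToExt {X : ModuleCat.{u} R} (P : ProjectiveResolution X) (Y : ModuleCat.{u} R)
    (n : ℕ) : ((homComplex P Y).opcycles n).unop ⟶ DerivedExt X Y n :=
  ((derivedIso P Y n).hom ≫ (homComplex P Y).homologyι n).unop

/-- The inclusion of cocycles into `Hom(Pₙ, Y)`. -/
def cocyclesIncl {X : ModuleCat.{u} R} (P : ProjectiveResolution X) (Y : ModuleCat.{u} R)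
    (n : ℕ) : ((homComplex P Y).opcycles n).unop ⟶ ModuleCat.of R (P.complex.X n ⟶ Y) :=
  ((homComplex P Y).pOpcycles n).unop

variable {X : ModuleCat.{u} R} (P : ProjectiveResolution X) {Y : ModuleCat.{u} R} {n : ℕ}

/-- The cocycle `f : Pₙ → Y` represents the class `e` in `Extⁿ(X, Y)`. -/
def Represents (f : P.complex.X n ⟶ Y) (e : DerivedExt X Y n) : Prop :=
  ∃ z, cocyclesIncl P Y n z = f ∧ cocyclesToExt P Y n z = e

theorem cocyclesIncl_injective : Function.Injective (cocyclesIncl P Y n) := by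
  rw [← ModuleCat.mono_iff_injective]
  exact unop_mono_of_epi _

theorem cocyclesToExt_surjective : Function.Surjective (cocyclesToExt P Y n) := by
  rw [← ModuleCat.epi_iff_surjective]
  exact unop_epi_of_mono _

theorem d_comp_cocyclesIncl (m : ℕ) (z) : P.complex.d m n ≫ cocyclesIncl P Y n z = 0 := by
  have h := congrArg Quiver.Hom.unop ((homComplex P Y).d_pOpcycles m n)
  have := congrArg (fun f => (ModuleCat.Hom.hom f) z) h
  exact this

/-- Opcycles are a cokernel in the opposite category, so after `unop` they become the kernel of
precomposition with the differential. -/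
theorem exists_cocyclesIncl (f : P.complex.X n ⟶ Y) (hf : P.complex.d (n + 1) n ≫ f = 0) :
    ∃ z, cocyclesIncl P Y n z = f := by
  have hex : (ShortComplex.mk _ _ ((homComplex P Y).d_pOpcycles (n + 1) n)).Exact :=
    ShortComplex.exact_of_g_is_cokernel _
      ((homComplex P Y).opcyclesIsCokernel (n + 1) n (by simp))
  have h2 := (ShortComplex.moduleCat_exact_iff _).mp hex.unop
  exact h2 f hf

theorem cocyclesToExt_eq_zero_iff (m : ℕ) (z : ((homComplex P Y).opcycles (m + 1)).unop) :
    cocyclesToExt P Y (m + 1) z = 0 ↔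
      ∃ g : P.complex.X m ⟶ Y, P.complex.d (m + 1) m ≫ g = cocyclesIncl P Y (m + 1) z := by
  have hex : (ShortComplex.mk _ _ ((homComplex P Y).homologyι_comp_fromOpcycles (m + 1) m)).Exact :=
    ShortComplex.exact_of_f_is_kernel _
      ((homComplex P Y).homologyIsKernel (m + 1) m (by simp))
  have h2 := (ShortComplex.moduleCat_exact_iff _).mp hex.unop
  have hfac : ∀ g : P.complex.X m ⟶ Y, cocyclesIncl P Y (m + 1)
      (((homComplex P Y).fromOpcycles (m + 1) m).unop g) = P.complex.d (m + 1) m ≫ g := by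
    intro g
    have h := congrArg Quiver.Hom.unop ((homComplex P Y).p_fromOpcycles (m + 1) m)
    have := congrArg (fun f => (ModuleCat.Hom.hom f) g) h
    exact this
  have hz : ∀ z, cocyclesToExt P Y (m + 1) z = 0 ↔
      ((homComplex P Y).homologyι (m + 1)).unop z = 0 := by
    intro z
    have hinj : Function.Injective (derivedIso P Y (m + 1)).hom.unop := by
      rw [← ModuleCat.mono_iff_injective]
      exact unop_mono_of_epi _
    exact map_eq_zero_iff (derivedIso P Y (m + 1)).hom.unop.hom hinj
  rw [hz]
  constructor
  · intro h
    obtain ⟨g, hg⟩ := h2 z h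
    exact ⟨g, (hfac g).symm.trans (congrArg (cocyclesIncl P Y (m + 1)) hg)⟩
  · rintro ⟨g, hg⟩
    rw [← hfac] at hg
    rw [← cocyclesIncl_injective P hg]
    have h := congrArg Quiver.Hom.unop ((homComplex P Y).homologyι_comp_fromOpcycles (m + 1) m)
    have := congrArg (fun f => (ModuleCat.Hom.hom f) g) h
    exact this

theorem cocyclesToExt_zero_injective : Function.Injective (cocyclesToExt P Y 0) := by
  rw [← ModuleCat.mono_iff_injective]
  have : Epi ((derivedIso P Y 0).hom ≫ (homComplex P Y).homologyι 0) := inferInstance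
  exact unop_mono_of_epi _

variable {P}

theorem Represents.comp {f : P.complex.X n ⟶ Y} {e : DerivedExt X Y n} (h : Represents P f e)
    {Y' : ModuleCat.{u} R} (g : Y ⟶ Y') :
    Represents P (f ≫ g) (((_root_.Ext R (ModuleCat.{u} R) n).obj (op X)).map g e) := by
  obtain ⟨z, rfl, rfl⟩ := h
  let α : homFun Y' ⟶ homFun Y := NatTrans.rightOp ((linearYoneda R (ModuleCat.{u} R)).map g)
  let φ : homComplex P Y' ⟶ homComplex P Y := (NatTrans.mapHomologicalComplex α _).app P.complex
  refine ⟨(opcyclesMap φ n).unop z, ?_, ?_⟩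
  · have h := congrArg Quiver.Hom.unop (p_opcyclesMap φ n)
    have := congrArg (fun f => (ModuleCat.Hom.hom f) z) h
    exact this
  · have h1 : (NatTrans.leftDerived α n).app X = (derivedIso P Y' n).hom ≫ homologyMap φ n ≫
        (derivedIso P Y n).inv := P.leftDerived_app_eq α n
    have h2 : (NatTrans.leftDerived α n).app X ≫ (derivedIso P Y n).hom ≫
        (homComplex P Y).homologyι n = ((derivedIso P Y' n).hom ≫
        (homComplex P Y').homologyι n) ≫ opcyclesMap φ n := by
      rw [h1]
      simp only [Category.assoc, Iso.inv_hom_id_assoc, homologyι_naturality]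
    have := congrArg (fun f => (ModuleCat.Hom.hom f.unop) z) h2
    exact this.symm

theorem Represents.precomp {X' : ModuleCat.{u} R} {P' : ProjectiveResolution X'} {g : X' ⟶ X}
    (φ : ProjectiveResolution.Hom P' P g) {f : P.complex.X n ⟶ Y} {e : DerivedExt X Y n}
    (h : Represents P f e) :
    Represents P' (φ.hom.f n ≫ f) (((_root_.Ext R (ModuleCat.{u} R) n).map g.op).app Y e) := by
  obtain ⟨z, rfl, rfl⟩ := h
  let ψ : homComplex P' Y ⟶ homComplex P Y := ((homFun Y).mapHomologicalComplex _).map φ.hom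
  refine ⟨(opcyclesMap ψ n).unop z, ?_, ?_⟩
  · have h := congrArg Quiver.Hom.unop (p_opcyclesMap ψ n)
    have := congrArg (fun f => (ModuleCat.Hom.hom f) z) h
    exact this
  · have h1 : ((homFun Y).leftDerived n).map g ≫ (derivedIso P Y n).hom =
        (derivedIso P' Y n).hom ≫ homologyMap ψ n :=
      ProjectiveResolution.isoLeftDerivedObj_hom_naturality g P' P φ.hom
        (by simpa using φ.hom_f_zero_comp_π_f_zero) (homFun Y) n
    have h2 : ((homFun Y).leftDerived n).map g ≫ (derivedIso P Y n).hom ≫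
        (homComplex P Y).homologyι n = ((derivedIso P' Y n).hom ≫
        (homComplex P' Y).homologyι n) ≫ opcyclesMap ψ n := by
      rw [reassoc_of% h1]
      simp only [Category.assoc, homologyι_naturality]
    have := congrArg (fun f => (ModuleCat.Hom.hom f.unop) z) h2
    exact this.symm

theorem Represents.add {f f' : P.complex.X n ⟶ Y} {e e' : DerivedExt X Y n}
    (h : Represents P f e) (h' : Represents P f' e') : Represents P (f + f') (e + e') := by
  obtain ⟨z, rfl, rfl⟩ := h
  obtain ⟨z', rfl, rfl⟩ := h'
  exact ⟨z + z', map_add _ _ _, map_add _ _ _⟩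

theorem Represents.sub {f f' : P.complex.X n ⟶ Y} {e e' : DerivedExt X Y n}
    (h : Represents P f e) (h' : Represents P f' e') : Represents P (f - f') (e - e') := by
  obtain ⟨z, rfl, rfl⟩ := h
  obtain ⟨z', rfl, rfl⟩ := h'
  exact ⟨z - z', map_sub _ _ _, map_sub _ _ _⟩

theorem Represents.cocycle {f : P.complex.X n ⟶ Y} {e : DerivedExt X Y n}
    (h : Represents P f e) : P.complex.d (n + 1) n ≫ f = 0 := by
  obtain ⟨z, rfl, rfl⟩ := h
  exact d_comp_cocyclesIncl P _ z

/-- A resolution has nothing beyond `P₀`, so in degree zero the only coboundary is zero. -/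
theorem extMk_zero_eq_zero_iff (f : P.complex.X 0 ⟶ Y) (hf : P.complex.d 1 0 ≫ f = 0) :
    P.extMk f 1 rfl hf = 0 ↔ f = 0 := by
  constructor
  · intro h
    rw [← P.extEquivCohomologyClass.apply_eq_iff_eq,
      ProjectiveResolution.extEquivCohomologyClass_extMk,
      ProjectiveResolution.extEquivCohomologyClass_zero,
      CochainComplex.HomComplex.CohomologyClass.mk_eq_zero_iff,
      CochainComplex.HomComplex.Cocycle.toSingleMk_mem_coboundaries_iff _ _ _ _ _ 1 (by simp)] at h
    obtain ⟨g, hg⟩ := h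
    have hz : IsZero (P.cochainComplex.X 1) :=
      CochainComplex.isZero_of_isStrictlyLE _ 0 _
    rw [hz.eq_of_src g 0, comp_zero] at hg
    rw [← cancel_epi (P.cochainComplexXIso (-((0 : ℕ) : ℤ)) 0 rfl).hom, comp_zero]
    exact hg.symm
  · rintro rfl
    simp

/-- In positive degree both sides say that the cocycle is a coboundary; in degree zero both say that
it is zero. This makes `extToDerived` additive and injective, so that the long exact sequences of
`Abelian.Ext` become available for local cohomology. -/
theorem Represents.eq_zero_iff {f : P.complex.X n ⟶ Y} {e : DerivedExt X Y n}
    (h : Represents P f e) : e = 0 ↔ P.extMk f (n + 1) rfl h.cocycle = 0 := by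
  cases n with
  | zero =>
    rw [extMk_zero_eq_zero_iff]
    obtain ⟨z, rfl, rfl⟩ := h
    rw [map_eq_zero_iff _ (cocyclesToExt_zero_injective P),
      map_eq_zero_iff _ (cocyclesIncl_injective P)]
  | succ m =>
    rw [P.extMk_eq_zero_iff _ _ _ _ m rfl]
    obtain ⟨z, rfl, rfl⟩ := h
    exact cocyclesToExt_eq_zero_iff P m z

theorem Represents.eq_iff {f f' : P.complex.X n ⟶ Y} {e e' : DerivedExt X Y n}
    (h : Represents P f e) (h' : Represents P f' e') :
    e = e' ↔ P.extMk f (n + 1) rfl h.cocycle = P.extMk f' (n + 1) rfl h'.cocycle := by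
  rw [← sub_eq_zero, (h.sub h').eq_zero_iff, ← sub_eq_zero (a := P.extMk f _ _ _), P.sub_extMk]

theorem exists_represents (x : Abelian.Ext X Y n) : ∃ (e : DerivedExt X Y n)
    (f : (projectiveResolution X).complex.X n ⟶ Y)
    (h : Represents (projectiveResolution X) f e),
    (projectiveResolution X).extMk f (n + 1) rfl h.cocycle = x := by
  obtain ⟨f, hf, rfl⟩ := (projectiveResolution X).extMk_surjective x (n + 1) rfl
  obtain ⟨z, rfl⟩ := exists_cocyclesIncl _ f hf
  exact ⟨_, _, ⟨z, rfl, rfl⟩, rfl⟩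

/-- The comparison of `Ext` in the derived category with the derived functor of `Hom`. -/
def extToDerived (X Y : ModuleCat.{u} R) (n : ℕ) : Abelian.Ext X Y n →+ DerivedExt X Y n where
  toFun x := (exists_represents x).choose
  map_zero' := by
    obtain ⟨f, h, e⟩ := (exists_represents (0 : Abelian.Ext X Y n)).choose_spec
    rw [h.eq_zero_iff, e]
  map_add' x y := by
    obtain ⟨f, h, e⟩ := (exists_represents x).choose_spec
    obtain ⟨f', h', e'⟩ := (exists_represents y).choose_spec
    obtain ⟨f'', h'', e''⟩ := (exists_represents (x + y)).choose_spec
    rw [h''.eq_iff (h.add h'), e'', ← ProjectiveResolution.add_extMk _ _ _ _ _ h.cocycle h'.cocycle,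
      e, e']

theorem extToDerived_eq {f : (projectiveResolution X).complex.X n ⟶ Y} {e : DerivedExt X Y n}
    (h : Represents (projectiveResolution X) f e) :
    extToDerived X Y n ((projectiveResolution X).extMk f (n + 1) rfl h.cocycle) = e := by
  obtain ⟨f', h', e'⟩ := (exists_represents
    ((projectiveResolution X).extMk f (n + 1) rfl h.cocycle)).choose_spec
  exact (h'.eq_iff h).mpr e'

theorem extToDerived_injective : Function.Injective (extToDerived X Y n) := by
  rw [injective_iff_map_eq_zero]
  intro x hx
  obtain ⟨e, f, h, rfl⟩ := exists_represents x
  rw [extToDerived_eq h] at hx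
  exact h.eq_zero_iff.mp hx

theorem extToDerived_surjective : Function.Surjective (extToDerived X Y n) := by
  intro e
  obtain ⟨z, rfl⟩ := cocyclesToExt_surjective (projectiveResolution X) e
  exact ⟨_, extToDerived_eq ⟨z, rfl, rfl⟩⟩

theorem extToDerived_comp (x : Abelian.Ext X Y n) {Y' : ModuleCat.{u} R} (g : Y ⟶ Y') :
    extToDerived X Y' n (x.comp (Abelian.Ext.mk₀ g) (add_zero n)) =
      ((_root_.Ext R (ModuleCat.{u} R) n).obj (op X)).map g (extToDerived X Y n x) := by
  obtain ⟨e, f, h, rfl⟩ := exists_represents x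
  rw [extToDerived_eq h, ProjectiveResolution.extMk_comp_mk₀, extToDerived_eq (h.comp g)]

theorem extToDerived_precomp (x : Abelian.Ext X Y n) {X' : ModuleCat.{u} R} (g : X' ⟶ X) :
    extToDerived X' Y n ((Abelian.Ext.mk₀ g).comp x (zero_add n)) =
      ((_root_.Ext R (ModuleCat.{u} R) n).map g.op).app Y (extToDerived X Y n x) := by
  obtain ⟨e, f, h, rfl⟩ := exists_represents x
  let φ : ProjectiveResolution.Hom (projectiveResolution X') (projectiveResolution X) g :=
    ⟨ProjectiveResolution.lift g _ _, by
      simpa using ProjectiveResolution.lift_commutes_zero g _ _⟩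
  rw [extToDerived_eq h, ProjectiveResolution.mk₀_comp_extMk _ _ _ _ φ,
    extToDerived_eq (h.precomp φ)]

end DerivedExt

/-! ### Local cohomology classes represented at finite stages. -/

section LocalCohomology

universe u

open CategoryTheory Opposite Limits Abelian

variable {R : Type u} [CommRing R] (I : Ideal R)

/-- The module `R / Iⁿ`. -/
abbrev quotPow (n : ℕ) : ModuleCat.{u} R := ModuleCat.of R (R ⧸ I ^ n)

/-- The projection `R / Iⁿ → R / Iᵐ` for `m ≤ n`. -/
def quotPowMap {m n : ℕ} (h : m ≤ n) : quotPow I n ⟶ quotPow I m :=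
  ModuleCat.ofHom (Submodule.mapQ _ _ LinearMap.id (Ideal.pow_le_pow_right h))

/-- The class in local cohomology of an element of `Extʲ(R / Iⁿ, M)`. -/
def lcOf (M : ModuleCat.{u} R) (j n : ℕ) :
    Ext (quotPow I n) M j →+ (localCohomology I j).obj M :=
  ((colimit.ι (localCohomology.diagram (localCohomology.idealPowersDiagram I) j)
    (op (op n))).app M).hom.toAddMonoidHom.comp (extToDerived (quotPow I n) M j)

theorem lcOf_map {M N : ModuleCat.{u} R} (f : M ⟶ N) (j n : ℕ) (x : Ext (quotPow I n) M j) :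
    (localCohomology I j).map f (lcOf I M j n x) =
      lcOf I N j n (x.comp (Ext.mk₀ f) (add_zero j)) := by
  have h := (colimit.ι (localCohomology.diagram (localCohomology.idealPowersDiagram I) j)
    (op (op n))).naturality f
  have h2 := congrArg (fun g => ModuleCat.Hom.hom g (extToDerived (quotPow I n) M j x)) h
  refine h2.symm.trans ?_
  exact (congrArg (ModuleCat.Hom.hom ((colimit.ι (localCohomology.diagram
    (localCohomology.idealPowersDiagram I) j) (op (op n))).app N)) (extToDerived_comp x f)).symm

theorem lcOf_precomp (M : ModuleCat.{u} R) (j : ℕ) {m n : ℕ} (h : m ≤ n)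
    (x : Ext (quotPow I m) M j) :
    lcOf I M j n ((Ext.mk₀ (quotPowMap I h)).comp x (zero_add j)) = lcOf I M j m x := by
  have h1 := colimit.w (localCohomology.diagram (localCohomology.idealPowersDiagram I) j)
    (homOfLE h).op.op
  have h2 := congrArg (fun g => ModuleCat.Hom.hom (g.app M) (extToDerived (quotPow I m) M j x)) h1
  exact (congrArg (ModuleCat.Hom.hom ((colimit.ι (localCohomology.diagram
    (localCohomology.idealPowersDiagram I) j) (op (op n))).app M))
      (extToDerived_precomp x (quotPowMap I h))).trans h2

/-- The colimit cocone that defines local cohomology of a module. -/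
def lcIsColimit (M : ModuleCat.{u} R) (j : ℕ) :
    IsColimit (((evaluation _ (ModuleCat.{u} R)).obj M).mapCocone (colimit.cocone
      (localCohomology.diagram (localCohomology.idealPowersDiagram I) j))) :=
  isColimitOfPreserves _ (colimit.isColimit _)

instance : PreservesColimitsOfShape ℕᵒᵖᵒᵖ (forget (ModuleCat.{u} R)) := by
  have : PreservesFilteredColimitsOfSize.{0, 0} (forget (ModuleCat.{u} R)) :=
    preservesFilteredColimitsOfSize_shrink _
  exact PreservesFilteredColimitsOfSize.preserves_filtered_colimits _

theorem exists_lcOf_eq {M : ModuleCat.{u} R} {j : ℕ} (y : (localCohomology I j).obj M) :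
    ∃ n x, lcOf I M j n x = y := by
  obtain ⟨⟨⟨n⟩⟩, e, he⟩ := Concrete.isColimit_exists_rep _ (lcIsColimit I M j) y
  obtain ⟨x, rfl⟩ := extToDerived_surjective (X := quotPow I n) (Y := M) (n := j) e
  exact ⟨n, x, he⟩

theorem exists_map_eq_zero_of_isColimit {J : Type} [SmallCategory J] [IsFiltered J]
    [PreservesColimitsOfShape J (forget (ModuleCat.{u} R))] {F : J ⥤ ModuleCat.{u} R}
    {D : Cocone F} (hD : IsColimit D) {i : J} (x : F.obj i) (hx : D.ι.app i x = 0) :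
    ∃ (k : J) (f : i ⟶ k), F.map f x = 0 := by
  obtain ⟨k, f, g, e⟩ := Concrete.isColimit_exists_of_rep_eq F hD x (0 : F.obj i)
    (hx.trans (map_zero (ModuleCat.Hom.hom _)).symm)
  exact ⟨k, f, e.trans (map_zero (ModuleCat.Hom.hom _))⟩

/-- In a filtered colimit of modules a class that dies does so at a finite stage. Together with
`exists_lcOf_eq` this transports exactness from `Ext(R / Iⁿ, -)` to local cohomology. -/
theorem exists_precomp_eq_zero {M : ModuleCat.{u} R} {j n : ℕ} {x : Ext (quotPow I n) M j}
    (hx : lcOf I M j n x = 0) :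
    ∃ (m : ℕ) (h : n ≤ m), (Ext.mk₀ (quotPowMap I h)).comp x (zero_add j) = 0 := by
  obtain ⟨⟨⟨m⟩⟩, f, e⟩ := exists_map_eq_zero_of_isColimit (lcIsColimit I M j) (i := op (op n))
    (extToDerived (quotPow I n) M j x) hx
  have hnm : n ≤ m := leOfHom f.unop.unop
  refine ⟨m, hnm, extToDerived_injective ?_⟩
  rw [map_zero, extToDerived_precomp]
  exact e

end LocalCohomology


/-! ### Long exact sequence of local cohomology. -/

section LongExact

universe u

open CategoryTheory Abelian

variable {R : Type u} [CommRing R] (I : Ideal R)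

/-- The local cohomology module of `M` in degree `j` with support in `I`. -/
abbrev LC (j : ℕ) (M : Type u) [AddCommGroup M] [Module R M] : Type u :=
  (localCohomology I j).obj (ModuleCat.of R M)

variable {A B C A' B' C' : Type u} [AddCommGroup A] [Module R A] [AddCommGroup B] [Module R B]
  [AddCommGroup C] [Module R C] [AddCommGroup A'] [Module R A'] [AddCommGroup B'] [Module R B']
  [AddCommGroup C'] [Module R C']

/-- The map on local cohomology induced by a linear map. -/
def lcMap (j : ℕ) (f : A →ₗ[R] B) : LC I j A →ₗ[R] LC I j B :=
  ((localCohomology I j).map (ModuleCat.ofHom f)).hom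

theorem lcMap_comp (j : ℕ) (f : A →ₗ[R] B) (g : B →ₗ[R] C) :
    lcMap I j (g ∘ₗ f) = lcMap I j g ∘ₗ lcMap I j f := by
  simp [lcMap]

theorem lcMap_comp_apply (j : ℕ) (f : A →ₗ[R] B) (g : B →ₗ[R] C) (x : LC I j A) :
    lcMap I j g (lcMap I j f x) = lcMap I j (g ∘ₗ f) x := by
  rw [lcMap_comp]; rfl

theorem lcMap_id (j : ℕ) : lcMap I j (LinearMap.id : A →ₗ[R] A) = LinearMap.id := by
  unfold lcMap
  rw [ModuleCat.ofHom_id, CategoryTheory.Functor.map_id]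
  rfl

theorem lcMap_lcOf (j n : ℕ) (f : A →ₗ[R] B) (x : Ext (quotPow I n) (ModuleCat.of R A) j) :
    lcMap I j f (lcOf I _ j n x) =
      lcOf I _ j n (x.comp (Ext.mk₀ (ModuleCat.ofHom f)) (add_zero j)) :=
  lcOf_map I (ModuleCat.ofHom f) j n x

theorem lcMap_zero (j : ℕ) : lcMap I j (0 : A →ₗ[R] B) = 0 := by
  ext y
  obtain ⟨n, x, rfl⟩ := exists_lcOf_eq I y
  rw [lcMap_lcOf]
  have : ModuleCat.ofHom (0 : A →ₗ[R] B) = 0 := rfl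
  rw [this, Ext.mk₀_zero, Ext.comp_zero, map_zero]
  rfl

theorem lcMap_bijective (j : ℕ) (e : A ≃ₗ[R] B) :
    Function.Bijective (lcMap I j (e : A →ₗ[R] B)) := by
  refine Function.bijective_iff_has_inverse.mpr ⟨lcMap I j (e.symm : B →ₗ[R] A), ?_, ?_⟩ <;>
    intro x <;> rw [lcMap_comp_apply] <;> simp [lcMap_id]

theorem lc_subsingleton_congr (j : ℕ) (e : A ≃ₗ[R] B) :
    Subsingleton (LC I j A) ↔ Subsingleton (LC I j B) :=
  (Equiv.ofBijective _ (lcMap_bijective I j e)).subsingleton_congr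

/-- Every class in local cohomology is annihilated by a power of `I`. -/
theorem exists_pow_lcMap_eq_zero (j : ℕ) (y : LC I j A) :
    ∃ n, ∀ r ∈ I ^ n, lcMap I j (r • (LinearMap.id : A →ₗ[R] A)) y = 0 := by
  obtain ⟨n, x, rfl⟩ := exists_lcOf_eq I y
  refine ⟨n, fun r hr => ?_⟩
  rw [lcMap_lcOf]
  have h1 : ModuleCat.ofHom (r • (LinearMap.id : A →ₗ[R] A)) = r • 𝟙 (ModuleCat.of R A) := rfl
  have h2 : r • 𝟙 (quotPow I n) = 0 := by
    refine ModuleCat.hom_ext (LinearMap.ext fun a => ?_)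
    obtain ⟨a, rfl⟩ := Ideal.Quotient.mk_surjective a
    change r • (Ideal.Quotient.mk (I ^ n) a) = 0
    rw [← Ideal.Quotient.mk_eq_mk, ← Submodule.Quotient.mk_smul, Submodule.Quotient.mk_eq_zero]
    exact Ideal.mul_mem_right _ _ hr
  have h3 : r • x = (r • Ext.mk₀ (𝟙 (quotPow I n))).comp x (zero_add j) := by
    rw [Ext.smul_comp, Ext.mk₀_id_comp]
  rw [h1, ← Ext.smul_eq_comp_mk₀, h3, ← Ext.mk₀_smul, h2, Ext.mk₀_zero, Ext.zero_comp, map_zero]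

/-- The short complex attached to an exact pair of linear maps. -/
abbrev sesOf {f : A →ₗ[R] B} {g : B →ₗ[R] C} (h : Function.Exact f g) :
    ShortComplex (ModuleCat.{u} R) :=
  ShortComplex.mk (ModuleCat.ofHom f) (ModuleCat.ofHom g)
    (by rw [← ModuleCat.ofHom_comp, h.linearMap_comp_eq_zero]; rfl)

variable {I} {f : A →ₗ[R] B} {g : B →ₗ[R] C}

theorem sesOf_shortExact (hf : Function.Injective f) (h : Function.Exact f g)
    (hg : Function.Surjective g) : (sesOf h).ShortExact where
  exact := (ShortComplex.moduleCat_exact_iff _).mpr fun x hx => (h x).mp hx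
  mono_f := (ModuleCat.mono_iff_injective _).mpr hf
  epi_g := (ModuleCat.epi_iff_surjective _).mpr hg

/-- The graph of the connecting homomorphism of local cohomology. -/
def IsDelta (hf : Function.Injective f) (h : Function.Exact f g)
    (hg : Function.Surjective g) {j : ℕ} (c : LC I j C) (a : LC I (j + 1) A) : Prop :=
  ∃ n, ∃ x : Ext (quotPow I n) (ModuleCat.of R C) j, lcOf I _ j n x = c ∧
    lcOf I _ (j + 1) n (x.comp (sesOf_shortExact hf h hg).extClass rfl) = a

theorem lc_exact (hf : Function.Injective f) (h : Function.Exact f g)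
    (hg : Function.Surjective g) {j : ℕ} {y : LC I j B} (hy : lcMap I j g y = 0) :
    ∃ x, lcMap I j f x = y := by
  obtain ⟨n, x, rfl⟩ := exists_lcOf_eq I y
  rw [lcMap_lcOf] at hy
  obtain ⟨m, hnm, e⟩ := exists_precomp_eq_zero I hy
  rw [← Ext.comp_assoc_of_third_deg_zero] at e
  obtain ⟨x₁, hx₁⟩ := Ext.covariant_sequence_exact₂ _ (sesOf_shortExact hf h hg) _ e
  refine ⟨lcOf I _ j m x₁, ?_⟩
  rw [lcMap_lcOf, ← lcOf_precomp I _ j hnm x]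
  exact congrArg _ hx₁

theorem exists_isDelta (hf : Function.Injective f) (h : Function.Exact f g)
    (hg : Function.Surjective g) {j : ℕ} (c : LC I j C) : ∃ a, IsDelta hf h hg c a := by
  obtain ⟨n, x, rfl⟩ := exists_lcOf_eq I c
  exact ⟨_, n, x, rfl, rfl⟩

theorem exists_isDelta_of_lcMap_eq_zero (hf : Function.Injective f) (h : Function.Exact f g)
    (hg : Function.Surjective g) {j : ℕ} {a : LC I (j + 1) A}
    (ha : lcMap I (j + 1) f a = 0) : ∃ c, IsDelta hf h hg c a := by
  obtain ⟨n, x, rfl⟩ := exists_lcOf_eq I a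
  rw [lcMap_lcOf] at ha
  obtain ⟨m, hnm, e⟩ := exists_precomp_eq_zero I ha
  rw [← Ext.comp_assoc_of_third_deg_zero] at e
  obtain ⟨x₃, hx₃⟩ := Ext.covariant_sequence_exact₁ _ (sesOf_shortExact hf h hg) _ e rfl
  refine ⟨lcOf I _ j m x₃, m, x₃, rfl, ?_⟩
  rw [hx₃, lcOf_precomp]

theorem IsDelta.lcMap_eq_zero {hf : Function.Injective f} {h : Function.Exact f g}
    {hg : Function.Surjective g} {j : ℕ} {c : LC I j C} {a : LC I (j + 1) A}
    (hd : IsDelta hf h hg c a) : lcMap I (j + 1) f a = 0 := by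
  obtain ⟨n, x, rfl, rfl⟩ := hd
  rw [lcMap_lcOf, Ext.comp_assoc_of_third_deg_zero]
  have := (sesOf_shortExact hf h hg).extClass_comp
  rw [show Ext.mk₀ (ModuleCat.ofHom f) = Ext.mk₀ (sesOf h).f from rfl, this, Ext.comp_zero,
    map_zero]

theorem IsDelta.exists_lcMap_eq {hf : Function.Injective f} {h : Function.Exact f g}
    {hg : Function.Surjective g} {j : ℕ} {c : LC I j C}
    (hd : IsDelta hf h hg c 0) : ∃ b, lcMap I j g b = c := by
  obtain ⟨n, x, rfl, ha⟩ := hd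
  obtain ⟨m, hnm, e⟩ := exists_precomp_eq_zero I ha
  rw [← Ext.comp_assoc _ _ _ (zero_add j) rfl (by omega)] at e
  obtain ⟨x₂, hx₂⟩ := Ext.covariant_sequence_exact₃ _ (sesOf_shortExact hf h hg) _ rfl e
  refine ⟨lcOf I _ j m x₂, ?_⟩
  rw [lcMap_lcOf, ← lcOf_precomp I _ j hnm x]
  exact congrArg _ hx₂

/-- The connecting map is handled as a relation. Of its single-valuedness only this case is ever
needed. -/
theorem IsDelta.eq_zero {hf : Function.Injective f} {h : Function.Exact f g}
    {hg : Function.Surjective g} {j : ℕ} {a : LC I (j + 1) A}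
    (hd : IsDelta hf h hg 0 a) : a = 0 := by
  obtain ⟨n, x, hx, rfl⟩ := hd
  obtain ⟨m, hnm, e⟩ := exists_precomp_eq_zero I hx
  rw [← lcOf_precomp I _ (j + 1) hnm, ← Ext.comp_assoc _ _ _ (zero_add j) rfl (by omega), e,
    Ext.zero_comp, map_zero]

theorem IsDelta.naturality {hf : Function.Injective f} {h : Function.Exact f g}
    {hg : Function.Surjective g} {f' : A' →ₗ[R] B'} {g' : B' →ₗ[R] C'} {hf' : Function.Injective f'}
    {h' : Function.Exact f' g'} {hg' : Function.Surjective g'} (α : A →ₗ[R] A') (β : B →ₗ[R] B')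
    (γ : C →ₗ[R] C') (hαβ : f' ∘ₗ α = β ∘ₗ f) (hβγ : g' ∘ₗ β = γ ∘ₗ g) {j : ℕ} {c : LC I j C}
    {a : LC I (j + 1) A} (hd : IsDelta hf h hg c a) :
    IsDelta hf' h' hg' (lcMap I j γ c) (lcMap I (j + 1) α a) := by
  obtain ⟨n, x, rfl, rfl⟩ := hd
  refine ⟨n, x.comp (Ext.mk₀ (ModuleCat.ofHom γ)) (add_zero j), (lcMap_lcOf I j n γ x).symm, ?_⟩
  rw [lcMap_lcOf, Ext.comp_assoc_of_third_deg_zero, Ext.comp_assoc_of_second_deg_zero]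
  let φ : sesOf h ⟶ sesOf h' :=
    { τ₁ := ModuleCat.ofHom α
      τ₂ := ModuleCat.ofHom β
      τ₃ := ModuleCat.ofHom γ
      comm₁₂ := by rw [← ModuleCat.ofHom_comp, ← ModuleCat.ofHom_comp, hαβ]
      comm₂₃ := by rw [← ModuleCat.ofHom_comp, ← ModuleCat.ofHom_comp, hβγ] }
  have := ShortComplex.ShortExact.extClass_naturality (sesOf_shortExact hf h hg)
    (sesOf_shortExact hf' h' hg') φ
  exact congrArg (fun y => lcOf I _ (j + 1) n (x.comp y rfl)) this.symm

theorem lcMap_zero_injective (hf : Function.Injective f) : Function.Injective (lcMap I 0 f) := by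
  rw [injective_iff_map_eq_zero]
  intro y hy
  obtain ⟨n, x, rfl⟩ := exists_lcOf_eq I y
  rw [lcMap_lcOf] at hy
  obtain ⟨m, hnm, e⟩ := exists_precomp_eq_zero I hy
  rw [← Ext.comp_assoc_of_third_deg_zero] at e
  have : Mono (ModuleCat.ofHom f) := (ModuleCat.mono_iff_injective _).mpr hf
  rw [← lcOf_precomp I _ 0 hnm x]
  have h2 := Ext.postcomp_mk₀_injective_of_mono (quotPow I m) (ModuleCat.ofHom f)
    (e.trans (map_zero ((Ext.mk₀ (ModuleCat.ofHom f)).postcomp _ (add_zero 0))).symm)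
  rw [h2, map_zero]

theorem lcMap_injective_of_subsingleton_left (hf : Function.Injective f) (h : Function.Exact f g)
    (hg : Function.Surjective g) (j : ℕ) [Subsingleton (LC I j A)] :
    Function.Injective (lcMap I j g) := by
  rw [injective_iff_map_eq_zero]
  intro y hy
  obtain ⟨x, rfl⟩ := lc_exact hf h hg hy
  rw [Subsingleton.elim x 0, map_zero]

theorem lcMap_injective_of_subsingleton_right (hf : Function.Injective f) (h : Function.Exact f g)
    (hg : Function.Surjective g) (j : ℕ) [Subsingleton (LC I j C)] :
    Function.Injective (lcMap I (j + 1) f) := by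
  rw [injective_iff_map_eq_zero]
  intro y hy
  obtain ⟨c, hc⟩ := exists_isDelta_of_lcMap_eq_zero hf h hg hy
  rw [Subsingleton.elim c 0] at hc
  exact hc.eq_zero

theorem lcMap_surjective_of_subsingleton (hf : Function.Injective f) (h : Function.Exact f g)
    (hg : Function.Surjective g) (j : ℕ) [Subsingleton (LC I (j + 1) A)] :
    Function.Surjective (lcMap I j g) := by
  intro c
  obtain ⟨a, ha⟩ := exists_isDelta hf h hg c
  rw [Subsingleton.elim a 0] at ha
  exact ha.exists_lcMap_eq

theorem lc_subsingleton_middle (hf : Function.Injective f) (h : Function.Exact f g)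
    (hg : Function.Surjective g) (j : ℕ) [Subsingleton (LC I j A)] [Subsingleton (LC I j C)] :
    Subsingleton (LC I j B) :=
  (lcMap_injective_of_subsingleton_left hf h hg j).subsingleton

/-- The connecting map lands in the kernel of `H^(j+1)(f)`, so it vanishes and `H^j(B)` surjects
onto `H^j(C)`. -/
theorem lc_subsingleton_right (hf : Function.Injective f) (h : Function.Exact f g)
    (hg : Function.Surjective g) (j : ℕ) [Subsingleton (LC I j B)]
    (hinj : Function.Injective (lcMap I (j + 1) f)) : Subsingleton (LC I j C) := by
  refine subsingleton_of_forall_eq 0 fun c => ?_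
  obtain ⟨a, ha⟩ := exists_isDelta hf h hg c
  have : a = 0 := hinj (by rw [ha.lcMap_eq_zero, map_zero])
  subst this
  obtain ⟨b, rfl⟩ := ha.exists_lcMap_eq
  rw [Subsingleton.elim b 0, map_zero]

end LongExact

/-! ### Vanishing of local cohomology and regular elements. -/

section Depth

universe u

open CategoryTheory Abelian

variable {R : Type u} [CommRing R] (I : Ideal R)

/-- Vanishing of local cohomology in all degrees less than `t`. -/
def LCVanish (t : ℕ) (M : Type u) [AddCommGroup M] [Module R M] : Prop :=
  ∀ j < t, Subsingleton (LC I j M)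

variable {I} {M M' : Type u} [AddCommGroup M] [Module R M] [AddCommGroup M'] [Module R M']

/-- Multiplication by `x`, as the first map of an exact sequence. -/
theorem smul_id_injective {x : R} (hx : IsSMulRegular M x) :
    Function.Injective (x • (LinearMap.id : M →ₗ[R] M)) := hx

theorem smul_id_exact_mkQ (x : R) : Function.Exact (x • (LinearMap.id : M →ₗ[R] M))
    (LinearMap.range (x • (LinearMap.id : M →ₗ[R] M))).mkQ := by
  intro y
  rw [Submodule.mkQ_apply, Submodule.Quotient.mk_eq_zero]
  rfl

/-- The quotient `M / xM`. -/
abbrev ModSMul (M : Type u) [AddCommGroup M] [Module R M] (x : R) : Type u :=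
  M ⧸ LinearMap.range (x • (LinearMap.id : M →ₗ[R] M))

theorem LCVanish.quotient {t : ℕ} (h : LCVanish I (t + 1) M) {x : R} (hx : IsSMulRegular M x) :
    LCVanish I t (ModSMul M x) := fun j hj => by
  have := h j (by omega)
  have := h (j + 1) (by omega)
  exact lc_subsingleton_right (smul_id_injective hx) (smul_id_exact_mkQ x)
    (Submodule.mkQ_surjective _) j (Function.injective_of_subsingleton _)

theorem lcMap_smul_pow (j : ℕ) (x : R) (n : ℕ) (y : LC I j M) :
    ((lcMap I j (x • (LinearMap.id : M →ₗ[R] M)))^[n]) y =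
      lcMap I j (x ^ n • (LinearMap.id : M →ₗ[R] M)) y := by
  induction n with
  | zero => simp [lcMap_id]
  | succ n ih =>
    rw [Function.iterate_succ_apply', ih, lcMap_comp_apply]
    congr 2
    ext m
    simp [pow_succ', mul_smul]

/-- Multiplication by `x` is injective on `H^j`, while every class is killed by a power of `x ∈ I`.
-/
theorem LCVanish.of_quotient {t : ℕ} {x : R} (hxI : x ∈ I) (hx : IsSMulRegular M x)
    (h : LCVanish I t (ModSMul M x)) : LCVanish I (t + 1) M := fun j hj => by
  have hinj : Function.Injective (lcMap I j (x • (LinearMap.id : M →ₗ[R] M))) := by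
    cases j with
    | zero => exact lcMap_zero_injective (smul_id_injective hx)
    | succ j =>
      have := h j (by omega)
      exact lcMap_injective_of_subsingleton_right (smul_id_injective hx) (smul_id_exact_mkQ x)
        (Submodule.mkQ_surjective _) j
  refine subsingleton_of_forall_eq 0 fun y => ?_
  obtain ⟨n, hn⟩ := exists_pow_lcMap_eq_zero I j y
  have h1 := hn (x ^ n) (Ideal.pow_mem_pow hxI n)
  rw [← lcMap_smul_pow] at h1
  have h0 : (lcMap I j (x • (LinearMap.id : M →ₗ[R] M)))^[n] 0 = 0 :=
    Function.iterate_fixed (map_zero _) n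
  exact hinj.iterate n (h1.trans h0.symm)

/-- A finite module whose local cohomology vanishes in degree zero has a regular element in `I`. -/
theorem LCVanish.exists_isSMulRegular [IsNoetherianRing R] [Module.Finite R M] {t : ℕ}
    (h : LCVanish I (t + 1) M) : ∃ x ∈ I, IsSMulRegular M x := by
  have hsub : Subsingleton ((R ⧸ I) →ₗ[R] M) := by
    refine subsingleton_of_forall_eq 0 fun φ => ?_
    have := h 0 (by omega)
    let e : R ⧸ I ^ 1 →ₗ[R] R ⧸ I := Submodule.mapQ _ _ LinearMap.id (by simp)
    have h0 : lcOf I (ModuleCat.of R M) 0 1 (Ext.mk₀ (ModuleCat.ofHom (φ ∘ₗ e))) = 0 :=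
      Subsingleton.elim _ _
    -- The transition map sends `1` to `1`, so the vanishing of the composite at stage `m` already
    -- gives `φ 1 = 0`.
    obtain ⟨m, hm, e0⟩ := exists_precomp_eq_zero I h0
    rw [Ext.mk₀_comp_mk₀, ← Ext.mk₀_zero] at e0
    have e1 := (Ext.mk₀_bijective _ _).1 e0
    have e2 := congrArg (fun f => ModuleCat.Hom.hom f (Submodule.Quotient.mk 1)) e1
    have e3 : φ (Submodule.Quotient.mk 1) = 0 := e2
    refine LinearMap.ext fun a => ?_
    obtain ⟨a, rfl⟩ := Submodule.Quotient.mk_surjective _ a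
    have : (Submodule.Quotient.mk a : R ⧸ I) = a • Submodule.Quotient.mk 1 := by
      rw [← Submodule.Quotient.mk_smul, smul_eq_mul, mul_one]
    rw [this, map_smul, e3, smul_zero]
    rfl
  obtain ⟨x, hx, hreg⟩ := IsSMulRegular.subsingleton_linearMap_iff.mp hsub
  rw [Ideal.annihilator_quotient] at hx
  exact ⟨x, hx, hreg⟩

/-- Vanishing of local cohomology passes to the module on which scalars act through their
`q`-th powers. -/
theorem LCVanish.of_pow_semilinear [IsNoetherianRing R] {t q : ℕ}
    [Module.Finite R M] (h : LCVanish I t M) (e : M ≃+ M')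
    (he : ∀ (r : R) (m : M), e (r ^ q • m) = r • e m) : LCVanish I t M' := by
  induction t generalizing M M' with
  | zero => intro j hj; omega
  | succ t ih =>
    obtain ⟨x, hxI, hx⟩ := h.exists_isSMulRegular
    -- The action of `x` on `M'` is that of `x ^ q` on `M`. For the same reason `M' / x` corresponds
    -- to `M / x ^ q`, to which the induction applies.
    have hx' : IsSMulRegular M' x := by
      intro a b hab
      obtain ⟨a, rfl⟩ := e.surjective a
      obtain ⟨b, rfl⟩ := e.surjective b
      dsimp only at hab
      rw [← he, ← he] at hab
      exact congrArg e (hx.pow q (e.injective hab))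
    refine LCVanish.of_quotient hxI hx' ?_
    let e' : ModSMul M (x ^ q) ≃+ ModSMul M' x :=
      QuotientAddGroup.congr _ _ e (by
        ext y
        simp only [AddSubgroup.mem_map, Submodule.mem_toAddSubgroup, LinearMap.mem_range,
          LinearMap.smul_apply, LinearMap.id_apply]
        constructor
        · rintro ⟨_, ⟨m, rfl⟩, rfl⟩
          exact ⟨e m, (he x m).symm⟩
        · rintro ⟨m', rfl⟩
          obtain ⟨m, rfl⟩ := e.surjective m'
          exact ⟨_, ⟨m, rfl⟩, he x m⟩)
    refine ih (h.quotient (hx.pow q)) e' ?_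
    intro r m
    obtain ⟨m, rfl⟩ := Submodule.Quotient.mk_surjective _ m
    change e' (Submodule.Quotient.mk (r ^ q • m)) = r • e' (Submodule.Quotient.mk m)
    change (Submodule.Quotient.mk (e (r ^ q • m)) : ModSMul M' x) = r • Submodule.Quotient.mk (e m)
    rw [he, Submodule.Quotient.mk_smul]

end Depth


/-! ### Vanishing of `Ext` from modules of small dimension. -/

section Ischebeck

universe u

open CategoryTheory Abelian

variable {R : Type u} [CommRing R]

/-- Dimension shifting: for a finite free cover of `N` with kernel `K`, the group `Ext^(j+1)(N, M)`
is a quotient of `Ext^j(K, M)`. -/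
theorem ext_finite [IsNoetherianRing R] (M : Type u) [AddCommGroup M] [Module R M]
    [Module.Finite R M] (j : ℕ) (N : Type u) [AddCommGroup N] [Module R N] [Module.Finite R N] :
    Module.Finite R (Ext (ModuleCat.of R N) (ModuleCat.of R M) j) := by
  induction j generalizing N with
  | zero =>
    let e : Ext (ModuleCat.of R N) (ModuleCat.of R M) 0 ≃ₗ[R] (N →ₗ[R] M) :=
      Ext.linearEquiv₀.trans ModuleCat.homLinearEquiv
    have : Module.Finite R (N →ₗ[R] M) := by
      obtain ⟨n, g, hg⟩ := Module.Finite.exists_fin' R N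
      exact Module.Finite.of_injective (LinearMap.lcomp R M g)
        (fun a b hab => LinearMap.ext fun x => by
          obtain ⟨y, rfl⟩ := hg x
          exact LinearMap.congr_fun hab y)
    exact Module.Finite.equiv e.symm
  | succ j ih =>
    obtain ⟨n, g, hg⟩ := Module.Finite.exists_fin' R N
    let g' : (ULift.{u} (Fin n) → R) →ₗ[R] N :=
      g ∘ₗ (LinearEquiv.funCongrLeft R R Equiv.ulift.symm).toLinearMap
    have hg' : Function.Surjective g' := hg.comp (LinearEquiv.surjective _)
    have hS := sesOf_shortExact (f := (LinearMap.ker g').subtype) (g := g')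
      (Submodule.injective_subtype _) (fun x => by simp) hg'
    let φ : Ext (ModuleCat.of R (LinearMap.ker g')) (ModuleCat.of R M) j →ₗ[R]
        Ext (ModuleCat.of R N) (ModuleCat.of R M) (j + 1) :=
      { toFun := fun x => hS.extClass.comp x (add_comm 1 j)
        map_add' := fun x y => Ext.comp_add _ _ _ _
        map_smul' := fun r x => Ext.comp_smul _ _ _ _ }
    have := ih (LinearMap.ker g')
    refine Module.Finite.of_surjective φ fun x => ?_
    have : Projective (sesOf (f := (LinearMap.ker g').subtype) (g := g') (fun x => by simp)).X₂ :=
      ModuleCat.projective_of_free (Pi.basisFun R _)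
    exact Ext.contravariant_sequence_exact₃ hS _ x (Ext.eq_zero_of_projective _) (add_comm 1 j)

theorem ext_subsingleton_middle {A B C M : Type u} [AddCommGroup A] [Module R A] [AddCommGroup B]
    [Module R B] [AddCommGroup C] [Module R C] [AddCommGroup M] [Module R M] {f : A →ₗ[R] B}
    {g : B →ₗ[R] C} (hf : Function.Injective f) (h : Function.Exact f g)
    (hg : Function.Surjective g) (j : ℕ)
    (hA : Subsingleton (Ext (ModuleCat.of R A) (ModuleCat.of R M) j))
    (hC : Subsingleton (Ext (ModuleCat.of R C) (ModuleCat.of R M) j)) :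
    Subsingleton (Ext (ModuleCat.of R B) (ModuleCat.of R M) j) := by
  refine subsingleton_of_forall_eq 0 fun x => ?_
  obtain ⟨y, rfl⟩ := Ext.contravariant_sequence_exact₂ (sesOf_shortExact hf h hg) _ x
    (Subsingleton.elim (α := Ext (ModuleCat.of R A) (ModuleCat.of R M) j) _ _)
  rw [Subsingleton.elim (α := Ext (ModuleCat.of R C) (ModuleCat.of R M) j) y 0, Ext.comp_zero]

theorem ext_subsingleton_of_equiv {A B M : Type u} [AddCommGroup A] [Module R A] [AddCommGroup B]
    [Module R B] [AddCommGroup M] [Module R M] (e : A ≃ₗ[R] B) (j : ℕ)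
    (hA : Subsingleton (Ext (ModuleCat.of R A) (ModuleCat.of R M) j)) :
    Subsingleton (Ext (ModuleCat.of R B) (ModuleCat.of R M) j) := by
  refine subsingleton_of_forall_eq 0 fun x => ?_
  have h : x = (Ext.mk₀ (ModuleCat.ofHom (e.symm : B →ₗ[R] A))).comp
      ((Ext.mk₀ (ModuleCat.ofHom (e : A →ₗ[R] B))).comp x (zero_add j)) (zero_add j) := by
    rw [Ext.mk₀_comp_mk₀_assoc, ← ModuleCat.ofHom_comp]
    have : (e : A →ₗ[R] B) ∘ₗ (e.symm : B →ₗ[R] A) = LinearMap.id := by ext; simp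
    rw [this, ModuleCat.ofHom_id, Ext.mk₀_id_comp]
  rw [h, Subsingleton.elim ((Ext.mk₀ (ModuleCat.ofHom (e : A →ₗ[R] B))).comp x (zero_add j)) 0,
    Ext.comp_zero]

/-- `Ext` out of a finite module vanishes if it vanishes out of `R / p` for all `p` in the
support. -/
theorem ext_subsingleton_of_support [IsNoetherianRing R] {M : Type u} [AddCommGroup M] [Module R M]
    (j : ℕ) {N : Type u} [AddCommGroup N] [Module R N] [hN : Module.Finite R N]
    (h : ∀ p ∈ Module.support R N,
      Subsingleton (Ext (ModuleCat.of R (R ⧸ p.asIdeal)) (ModuleCat.of R M) j)) :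
    Subsingleton (Ext (ModuleCat.of R N) (ModuleCat.of R M) j) := by
  induction hN using IsNoetherianRing.induction_on_isQuotientEquivQuotientPrime R with
  | subsingleton N =>
    have : Limits.IsZero (ModuleCat.of R N) := ModuleCat.isZero_of_subsingleton _
    refine subsingleton_of_forall_eq 0 fun x => ?_
    rw [← Ext.mk₀_id_comp x, this.eq_of_src (𝟙 _) 0, Ext.mk₀_zero, Ext.zero_comp]
  | quotient N p e =>
    refine ext_subsingleton_of_equiv e.symm j (h p ?_)
    rw [e.support_eq, Module.support_eq_zeroLocus, Ideal.annihilator_quotient]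
    exact le_refl p.asIdeal
  | exact N₁ N₂ N₃ f g hf hg hfg h₁ h₃ =>
    exact ext_subsingleton_middle hf hfg hg j
      (h₁ fun p hp => h p (Module.support_subset_of_injective f hf hp))
      (h₃ fun p hp => h p (Module.support_subset_of_surjective g hg hp))

/-- An `M`-regular `x ∈ I` acts as zero on `Ext(R / I, M)`, so `Ext^j(R / I, M / xM)` surjects onto
`Ext^(j+1)(R / I, M)`, and induction on `t` applies to `M / xM`. -/
theorem LCVanish.ext_subsingleton [IsNoetherianRing R] {I : Ideal R} {t : ℕ} {M : Type u}
    [AddCommGroup M] [Module R M] [Module.Finite R M] (h : LCVanish I t M) :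
    ∀ j < t, Subsingleton (Ext (ModuleCat.of R (R ⧸ I)) (ModuleCat.of R M) j) := by
  induction t generalizing M with
  | zero => intro j hj; omega
  | succ t ih =>
    intro j hj
    obtain ⟨x, hxI, hx⟩ := h.exists_isSMulRegular
    have hS := sesOf_shortExact (smul_id_injective hx) (smul_id_exact_mkQ x)
      (Submodule.mkQ_surjective _)
    have hzero : ∀ y : Ext (ModuleCat.of R (R ⧸ I)) (ModuleCat.of R M) j,
        y.comp (Ext.mk₀ (ModuleCat.ofHom (x • LinearMap.id))) (add_zero j) = 0 := by
      intro y
      have h1 : ModuleCat.ofHom (x • (LinearMap.id : M →ₗ[R] M)) = x • 𝟙 (ModuleCat.of R M) := rfl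
      have h2 : x • 𝟙 (ModuleCat.of R (R ⧸ I)) = 0 := by
        refine ModuleCat.hom_ext (LinearMap.ext fun a => ?_)
        obtain ⟨a, rfl⟩ := Ideal.Quotient.mk_surjective a
        change x • (Ideal.Quotient.mk I a) = 0
        rw [← Ideal.Quotient.mk_eq_mk, ← Submodule.Quotient.mk_smul, Submodule.Quotient.mk_eq_zero]
        exact Ideal.mul_mem_right _ _ hxI
      have h3 : x • y = (x • Ext.mk₀ (𝟙 (ModuleCat.of R (R ⧸ I)))).comp y (zero_add j) := by
        rw [Ext.smul_comp, Ext.mk₀_id_comp]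
      rw [h1, ← Ext.smul_eq_comp_mk₀, h3, ← Ext.mk₀_smul, h2, Ext.mk₀_zero, Ext.zero_comp]
    refine subsingleton_of_forall_eq 0 fun y => ?_
    cases j with
    | zero =>
      have : Mono (ModuleCat.ofHom (x • (LinearMap.id : M →ₗ[R] M))) :=
        (ModuleCat.mono_iff_injective _).mpr (smul_id_injective hx)
      exact Ext.postcomp_mk₀_injective_of_mono _ (ModuleCat.ofHom (x • LinearMap.id))
        ((hzero y).trans (map_zero ((Ext.mk₀ (ModuleCat.ofHom
          (x • (LinearMap.id : M →ₗ[R] M)))).postcomp _ (add_zero 0))).symm)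
    | succ j =>
      obtain ⟨z, rfl⟩ := Ext.covariant_sequence_exact₁ _ hS y (hzero y) rfl
      have := ih (h.quotient hx) j (by omega)
      rw [Subsingleton.elim (α := Ext (ModuleCat.of R (R ⧸ I)) (ModuleCat.of R (ModSMul M x)) j)
        z 0, Ext.zero_comp]

theorem withBot_le_of_add_one_le {a b : WithBot ℕ∞} (h : a + 1 ≤ b + 1) : a ≤ b := by
  induction a with
  | bot => exact bot_le
  | coe a =>
    induction b with
    | bot =>
      exact absurd h (by rw [WithBot.bot_add]; exact not_le_of_gt (WithBot.bot_lt_coe (a + 1)))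
    | coe b =>
      have h' : a + 1 ≤ b + 1 := WithBot.coe_le_coe.mp h
      exact WithBot.coe_le_coe.mpr ((ENat.add_le_add_iff_right ENat.one_ne_top).mp h')

/-- Any element of `Q` outside `P` is a nonzerodivisor on the domain `R / P`. -/
theorem ringKrullDim_quotient_lt {P Q : Ideal R} [P.IsPrime] (h : P < Q) :
    ringKrullDim (R ⧸ Q) + 1 ≤ ringKrullDim (R ⧸ P) := by
  obtain ⟨x, hxQ, hxP⟩ := Set.exists_of_ssubset h
  refine ringKrullDim_succ_le_of_surjective (Ideal.Quotient.factor h.le)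
    (Ideal.Quotient.factor_surjective h.le) (r := Ideal.Quotient.mk P x) ?_ ?_
  · rw [mem_nonZeroDivisors_iff_ne_zero, Ne, Ideal.Quotient.eq_zero_iff_mem]
    exact hxP
  · rw [Ideal.Quotient.factor_mk, Ideal.Quotient.eq_zero_iff_mem]
    exact hxQ

/-- Vanishing of `Ext(R / P, M)` in low degrees, for a finite module `M` of large depth at all
maximal ideals. -/
theorem ext_quotient_prime_subsingleton [IsNoetherianRing R] {t : ℕ} {M : Type u}
    [AddCommGroup M] [Module R M] [Module.Finite R M]
    (h : ∀ (𝔪 : Ideal R) [𝔪.IsMaximal], ∀ j < t,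
      Subsingleton (Ext (ModuleCat.of R (R ⧸ 𝔪)) (ModuleCat.of R M) j))
    (e j : ℕ) (hj : j + e < t) (P : Ideal R) [P.IsPrime] (hP : ringKrullDim (R ⧸ P) ≤ e) :
    Subsingleton (Ext (ModuleCat.of R (R ⧸ P)) (ModuleCat.of R M) j) := by
  induction e generalizing j P with
  | zero =>
    have : P.IsMaximal := by
      obtain ⟨𝔪, h𝔪, hle⟩ := Ideal.exists_le_maximal P (Ideal.IsPrime.ne_top ‹_›)
      rcases hle.eq_or_lt with rfl | hlt
      · exact h𝔪
      · have h1 := (ringKrullDim_quotient_lt hlt).trans hP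
        have h2 : (0 : WithBot ℕ∞) ≤ ringKrullDim (R ⧸ 𝔪) := ringKrullDim_nonneg_of_nontrivial
        have h3 : (0 : WithBot ℕ∞) + 1 ≤ 0 := (add_le_add_left h2 1).trans h1
        exact absurd h3 (by decide)
    exact h P j (by omega)
  | succ e ih =>
    by_cases hmax : P.IsMaximal
    · exact h P j (by omega)
    by_contra hne
    have hfin := ext_finite (R := R) M j (R ⧸ P)
    set E := Ext (ModuleCat.of R (R ⧸ P)) (ModuleCat.of R M) j with hE
    have hann : Module.annihilator R E ≠ ⊤ := by
      intro htop
      apply hne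
      refine subsingleton_of_forall_eq 0 fun y => ?_
      have : (1 : R) ∈ Module.annihilator R E := htop ▸ Submodule.mem_top
      rw [← one_smul R y]
      exact Module.mem_annihilator.mp this y
    -- The contradiction will come from Nakayama at a maximal ideal containing the annihilator of
    -- the finite module `E`.
    obtain ⟨𝔪, h𝔪, hle⟩ := Ideal.exists_le_maximal _ hann
    have hPE : P ≤ Module.annihilator R E := by
      intro x hx
      rw [Module.mem_annihilator]
      intro y
      have h2 : x • 𝟙 (ModuleCat.of R (R ⧸ P)) = 0 := by
        refine ModuleCat.hom_ext (LinearMap.ext fun a => ?_)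
        obtain ⟨a, rfl⟩ := Ideal.Quotient.mk_surjective a
        change x • (Ideal.Quotient.mk P a) = 0
        rw [← Ideal.Quotient.mk_eq_mk, ← Submodule.Quotient.mk_smul, Submodule.Quotient.mk_eq_zero]
        exact Ideal.mul_mem_right _ _ hx
      have h3 : x • y = (x • Ext.mk₀ (𝟙 (ModuleCat.of R (R ⧸ P)))).comp y (zero_add j) := by
        rw [Ext.smul_comp, Ext.mk₀_id_comp]
      rw [h3, ← Ext.mk₀_smul, h2, Ext.mk₀_zero, Ext.zero_comp]
    have hlt : P < 𝔪 := lt_of_le_of_ne (hPE.trans hle) fun heq => hmax (heq ▸ h𝔪)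
    obtain ⟨x, hx𝔪, hxP⟩ := Set.exists_of_ssubset hlt
    have hreg : IsSMulRegular (R ⧸ P) x := by
      intro a b hab
      obtain ⟨a, rfl⟩ := Ideal.Quotient.mk_surjective a
      obtain ⟨b, rfl⟩ := Ideal.Quotient.mk_surjective b
      dsimp only at hab
      rw [← Ideal.Quotient.mk_eq_mk, ← Ideal.Quotient.mk_eq_mk, ← Submodule.Quotient.mk_smul,
        ← Submodule.Quotient.mk_smul, Submodule.Quotient.eq, smul_eq_mul, smul_eq_mul,
        ← mul_sub] at hab
      rw [Ideal.Quotient.eq]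
      exact (Ideal.IsPrime.mem_or_mem ‹_› hab).resolve_left hxP
    have hS := sesOf_shortExact (smul_id_injective hreg) (smul_id_exact_mkQ x)
      (Submodule.mkQ_surjective _)
    -- The support of `R / (P + xR)` consists of primes strictly above `P`: the dimension drops by
    -- one while the degree rises by one, so `j + e` is unchanged.
    have hN : Subsingleton (Ext (ModuleCat.of R (ModSMul (R ⧸ P) x)) (ModuleCat.of R M)
        (1 + j)) := by
      refine ext_subsingleton_of_support (1 + j) fun p hp => ?_
      have hpa := Module.annihilator_le_of_mem_support hp
      have hPp : P ≤ p.asIdeal := by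
        intro r hr
        refine hpa (Module.mem_annihilator.mpr fun a => ?_)
        obtain ⟨a, rfl⟩ := Submodule.Quotient.mk_surjective _ a
        obtain ⟨a, rfl⟩ := Ideal.Quotient.mk_surjective a
        have h1 : r • Ideal.Quotient.mk P a = 0 := by
          rw [← Ideal.Quotient.mk_eq_mk, ← Submodule.Quotient.mk_smul,
            Submodule.Quotient.mk_eq_zero]
          exact Ideal.mul_mem_right _ _ hr
        rw [← Submodule.Quotient.mk_smul, h1]
        exact Submodule.Quotient.mk_zero _
      have hxp : x ∈ p.asIdeal := by
        refine hpa (Module.mem_annihilator.mpr fun a => ?_)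
        obtain ⟨a, rfl⟩ := Submodule.Quotient.mk_surjective _ a
        rw [← Submodule.Quotient.mk_smul, Submodule.Quotient.mk_eq_zero]
        exact ⟨a, rfl⟩
      have hlt : P < p.asIdeal := lt_of_le_of_ne hPp fun heq => hxP (heq ▸ hxp)
      refine ih (1 + j) (by omega) p.asIdeal ?_
      have h1 := (ringKrullDim_quotient_lt hlt).trans hP
      rw [Nat.cast_add, Nat.cast_one] at h1
      exact withBot_le_of_add_one_le h1
    have hsurj : ∀ y : E, ∃ z : E, x • z = y := by
      intro y
      obtain ⟨z, hz⟩ := Ext.contravariant_sequence_exact₁ hS _ y rfl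
        (Subsingleton.elim (α := Ext (ModuleCat.of R (ModSMul (R ⧸ P) x)) (ModuleCat.of R M)
          (1 + j)) _ _)
      refine ⟨z, ?_⟩
      rw [← hz]
      have h1 : (sesOf (smul_id_exact_mkQ (M := R ⧸ P) x)).f = x • 𝟙 (ModuleCat.of R (R ⧸ P)) := rfl
      rw [h1, Ext.mk₀_smul, Ext.smul_comp, Ext.mk₀_id_comp]
    -- From `xE = E` some `r ≡ 1` modulo `x` kills `E`; then both `r` and `x` lie in `𝔪`, which is
    -- absurd.
    obtain ⟨r, hr1, hr2⟩ := Submodule.exists_sub_one_mem_and_smul_eq_zero_of_fg_of_le_smul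
      (Ideal.span {x}) (⊤ : Submodule R E) hfin.fg_top (fun y _ => by
        obtain ⟨z, rfl⟩ := hsurj y
        exact Submodule.smul_mem_smul (Ideal.mem_span_singleton_self x) Submodule.mem_top)
    have hr𝔪 : r ∈ 𝔪 := hle (Module.mem_annihilator.mpr fun y => hr2 y Submodule.mem_top)
    have : (1 : R) ∈ 𝔪 := by
      have h1 : r - 1 ∈ 𝔪 := ((Ideal.span_singleton_le_iff_mem _).mpr hx𝔪) hr1
      simpa using 𝔪.sub_mem hr𝔪 h1
    exact h𝔪.ne_top ((Ideal.eq_top_iff_one _).mpr this)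

/-- A finite submodule `B` of large depth is saturated with respect to primes `P` of large height:
an element that is multiplied into `B` by `P` differs from an element of `B` by one that is
annihilated by `P`. -/
theorem exists_sub_smul_eq_zero [IsNoetherianRing R] {N : Type u} [AddCommGroup N] [Module R N]
    (B : Submodule R N) [Module.Finite R B] {t : ℕ}
    (h : ∀ (𝔪 : Ideal R) [𝔪.IsMaximal], LCVanish 𝔪 t B) (P : Ideal R) [P.IsPrime] (e : ℕ)
    (hP : ringKrullDim (R ⧸ P) ≤ e) (he : 1 + e < t) (b : N) (hb : ∀ r ∈ P, r • b ∈ B) :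
    ∃ b₀ ∈ B, ∀ r ∈ P, r • (b - b₀) = 0 := by
  have hsub := ext_quotient_prime_subsingleton (fun 𝔪 _ => (h 𝔪).ext_subsingleton) e 1 he P hP
  have hS := sesOf_shortExact (f := B.subtype) (g := B.mkQ) (Submodule.injective_subtype _)
    (fun x => by simp) (Submodule.mkQ_surjective _)
  -- Since `Ext¹(R / P, B) = 0`, the map `1 ↦ b mod B` lifts to `ψ : R / P → N`. Then `ψ 1` is
  -- killed by `P` and is congruent to `b` modulo `B`.
  let φ : R ⧸ P →ₗ[R] N ⧸ B := Submodule.liftQ P (LinearMap.toSpanSingleton R (N ⧸ B) (B.mkQ b))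
    (fun r hr => by
      rw [LinearMap.mem_ker, LinearMap.toSpanSingleton_apply, ← map_smul, Submodule.mkQ_apply,
        Submodule.Quotient.mk_eq_zero]
      exact hb r hr)
  obtain ⟨y, hy⟩ := Ext.covariant_sequence_exact₃ (ModuleCat.of R (R ⧸ P)) hS
    (Ext.mk₀ (ModuleCat.ofHom φ)) rfl
    (Subsingleton.elim (α := Ext (ModuleCat.of R (R ⧸ P)) (ModuleCat.of R B) 1) _ _)
  obtain ⟨ψ, rfl⟩ := (Ext.mk₀_bijective _ _).2 y
  rw [Ext.mk₀_comp_mk₀] at hy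
  have hy := (Ext.mk₀_bijective _ _).1 hy
  have h1 : B.mkQ (ψ.hom (Submodule.Quotient.mk 1)) = φ (Submodule.Quotient.mk 1) :=
    congrArg (fun f => ModuleCat.Hom.hom f (Submodule.Quotient.mk 1)) hy
  have h2 : φ (Submodule.Quotient.mk 1) = B.mkQ b := by
    change (1 : R) • B.mkQ b = _
    rw [one_smul]
  rw [h2, Submodule.mkQ_apply, Submodule.mkQ_apply, Submodule.Quotient.eq] at h1
  refine ⟨b - ψ.hom (Submodule.Quotient.mk 1), ?_, fun r hr => ?_⟩
  · rw [← neg_sub]; exact B.neg_mem h1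
  · rw [sub_sub_cancel, ← map_smul, ← Submodule.Quotient.mk_smul, smul_eq_mul, mul_one,
      (Submodule.Quotient.mk_eq_zero P).mpr hr, map_zero]

end Ischebeck


/-! ### From killed colon modules to killed local cohomology. -/

section Annihilation

universe u

variable {R : Type u} [CommRing R]

/-- For each exponent `b`, the map `γ` carries the colon module `(N : x ^ b)` into `N`, where `x`
is the head of the list, and the same condition holds for the tail modulo `x ^ b`. -/
def ColonKilled {M : Type u} [AddCommGroup M] [Module R M] (γ : M →ₗ[R] M) :
    List R → Submodule R M → Prop
  | [], _ => True
  | x :: l, N => ∀ b : ℕ, (∀ m, x ^ b • m ∈ N → γ m ∈ N) ∧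
      ColonKilled γ l (N ⊔ LinearMap.range (x ^ b • (LinearMap.id : M →ₗ[R] M)))

variable {I : Ideal R}

/-- A class `y` is killed by some `x ^ b`. Factor `μ = x ^ b` on `Q` through its image: `γ` is zero
on `ker μ`, and in `H^j(im μ)` the image of `y` comes from `H^(j-1)(Q / im μ)`, where `j` iterates
of `γ` suffice by induction. One more iterate removes what is left in `H^j(ker μ)`. -/
theorem lcMap_iterate_eq_zero {M : Type u} [AddCommGroup M] [Module R M] {γ : M →ₗ[R] M}
    {l : List R} {N : Submodule R M} (hl : ∀ x ∈ l, x ∈ I) (h : ColonKilled γ l N)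
    {Q : Type u} [AddCommGroup Q] [Module R Q] {γQ : Q →ₗ[R] Q} {π : M →ₗ[R] Q}
    (hπ : Function.Surjective π) (hγ : γQ ∘ₗ π = π ∘ₗ γ) (hN : LinearMap.ker π = N)
    {j : ℕ} (hj : j < l.length) (y : LC I j Q) : (lcMap I j γQ)^[j + 1] y = 0 := by
  induction l generalizing N Q j with
  | nil => simp at hj
  | cons x l ih =>
    obtain ⟨b, hb⟩ := exists_pow_lcMap_eq_zero I j y
    have hxb : lcMap I j (x ^ b • (LinearMap.id : Q →ₗ[R] Q)) y = 0 :=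
      hb _ (Ideal.pow_mem_pow (hl x (by simp)) b)
    obtain ⟨hT, htail⟩ := h b
    set μ : Q →ₗ[R] Q := x ^ b • LinearMap.id with hμ
    have hcomm : ∀ q, γQ (μ q) = μ (γQ q) := fun q => by simp [hμ]
    let ρ : LinearMap.range μ →ₗ[R] LinearMap.range μ := γQ.restrict (by
      rintro _ ⟨q, rfl⟩
      exact ⟨γQ q, (hcomm q).symm⟩)
    let γ' : (Q ⧸ LinearMap.range μ) →ₗ[R] (Q ⧸ LinearMap.range μ) :=
      Submodule.mapQ _ _ γQ (by
        rintro _ ⟨q, rfl⟩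
        exact ⟨γQ q, (hcomm q).symm⟩)
    have e1 : Function.Exact (LinearMap.range μ).subtype (LinearMap.range μ).mkQ := fun q => by
      simp
    have e2 : Function.Exact (LinearMap.ker μ).subtype μ.rangeRestrict := fun q => by
      simp [LinearMap.rangeRestrict, LinearMap.codRestrict, Subtype.ext_iff]
    have hγT : γQ ∘ₗ (LinearMap.ker μ).subtype = 0 := by
      ext ⟨t, ht⟩
      obtain ⟨m, rfl⟩ := hπ t
      have hm : x ^ b • m ∈ N := by
        rw [← hN, LinearMap.mem_ker, map_smul]
        exact ht
      have := hT m hm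
      rw [← hN, LinearMap.mem_ker] at this
      exact (LinearMap.congr_fun hγ m).trans this
    -- The inclusion `im μ → Q` sends the image of `y` to `x ^ b y = 0`. So that image vanishes if
    -- `j = 0` and is otherwise a connecting image, on which `ρ` acts as `γ'` acts on `Q / im μ`.
    have hdies : (lcMap I j ρ)^[j] (lcMap I j μ.rangeRestrict y) = 0 := by
      have h0 : lcMap I j (LinearMap.range μ).subtype (lcMap I j μ.rangeRestrict y) = 0 := by
        rw [lcMap_comp_apply]
        exact hxb
      cases j with
      | zero =>
        exact lcMap_zero_injective (Submodule.injective_subtype _) (h0.trans (map_zero _).symm)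
      | succ j =>
        obtain ⟨w, hw⟩ := exists_isDelta_of_lcMap_eq_zero (Submodule.injective_subtype _) e1
          (Submodule.mkQ_surjective _) h0
        have hiter : ∀ n, IsDelta (Submodule.injective_subtype _) e1 (Submodule.mkQ_surjective _)
            ((lcMap I j γ')^[n] w)
            ((lcMap I (j + 1) ρ)^[n] (lcMap I (j + 1) μ.rangeRestrict y)) := by
          intro n
          induction n with
          | zero => exact hw
          | succ n ihn =>
            rw [Function.iterate_succ_apply', Function.iterate_succ_apply']
            exact ihn.naturality ρ γQ γ' rfl rfl
        have hw0 : (lcMap I j γ')^[j + 1] w = 0 := by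
          refine ih (fun z hz => hl z (by simp [hz])) htail
            (π := (LinearMap.range μ).mkQ ∘ₗ π) ((Submodule.mkQ_surjective _).comp hπ) ?_ ?_
            (by simpa using hj) w
          · ext m
            exact congrArg (LinearMap.range μ).mkQ (LinearMap.congr_fun hγ m)
          · ext m
            simp only [LinearMap.mem_ker, LinearMap.comp_apply, Submodule.mkQ_apply,
              Submodule.Quotient.mk_eq_zero, LinearMap.mem_range, Submodule.mem_sup]
            constructor
            · rintro ⟨q, hq⟩
              obtain ⟨m', rfl⟩ := hπ q
              refine ⟨m - x ^ b • m', ?_, x ^ b • m', ⟨m', rfl⟩, by abel⟩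
              rw [← hN, LinearMap.mem_ker, map_sub, map_smul, ← hq]
              simp [hμ]
            · rintro ⟨n, hn, _, ⟨m', rfl⟩, rfl⟩
              rw [← hN, LinearMap.mem_ker] at hn
              exact ⟨π m', by simp [hμ, hn]⟩
        have := hiter (j + 1)
        rw [hw0] at this
        exact this.eq_zero
    have hcom : ∀ n, lcMap I j μ.rangeRestrict ((lcMap I j γQ)^[n] y) =
        (lcMap I j ρ)^[n] (lcMap I j μ.rangeRestrict y) := by
      intro n
      induction n with
      | zero => rfl
      | succ n ihn =>
        rw [Function.iterate_succ_apply', Function.iterate_succ_apply', ← ihn, lcMap_comp_apply,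
          lcMap_comp_apply]
        congr 2
        ext q
        exact (hcomm q).symm
    -- After `j` iterates the class comes from `ker μ`, which `γQ` annihilates.
    obtain ⟨t, ht⟩ := lc_exact (Submodule.injective_subtype _) e2
      (LinearMap.surjective_rangeRestrict μ) ((hcom j).trans hdies)
    rw [Function.iterate_succ_apply', ← ht, lcMap_comp_apply, hγT, lcMap_zero]
    rfl

/-- Multiplication by `x ^ b` on `M'` is multiplication by `x ^ (b * q)` on `M`. The condition
passes to Frobenius push-forwards because it is imposed for all exponents at once. -/
theorem ColonKilled.of_pow_semilinear {M M' : Type u} [AddCommGroup M] [Module R M]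
    [AddCommGroup M'] [Module R M'] {γ : M →ₗ[R] M} {γ' : M' →ₗ[R] M'} (e : M ≃+ M') {q : ℕ}
    (he : ∀ (r : R) (m : M), e (r ^ q • m) = r • e m) (hγ : ∀ m, γ' (e m) = e (γ m))
    {l : List R} {N : Submodule R M} {N' : Submodule R M'} (hN : ∀ m, e m ∈ N' ↔ m ∈ N)
    (h : ColonKilled γ l N) : ColonKilled γ' l N' := by
  induction l generalizing N N' with
  | nil => trivial
  | cons x l ih =>
    intro b
    obtain ⟨h1, h2⟩ := h (b * q)
    refine ⟨fun m' hm' => ?_, ih (fun m => ?_) h2⟩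
    · obtain ⟨m, rfl⟩ := e.surjective m'
      rw [← he, ← pow_mul, hN] at hm'
      rw [hγ, hN]
      exact h1 m hm'
    · simp only [Submodule.mem_sup, LinearMap.mem_range, LinearMap.smul_apply,
        LinearMap.id_apply]
      constructor
      · rintro ⟨n', hn', _, ⟨m', rfl⟩, hm⟩
        obtain ⟨n, rfl⟩ := e.surjective n'
        obtain ⟨m', rfl⟩ := e.surjective m'
        refine ⟨n, (hN n).mp hn', _, ⟨m', rfl⟩, e.injective ?_⟩
        rw [map_add, pow_mul, he, hm]
      · rintro ⟨n, hn, _, ⟨m', rfl⟩, rfl⟩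
        refine ⟨e n, (hN n).mpr hn, _, ⟨e m', rfl⟩, ?_⟩
        rw [map_add, pow_mul, he]

end Annihilation

/-! ### Noether normalization and a uniform annihilator. -/

section Normalization

universe u

theorem ringKrullDim_le_of_isIntegral (A B : Type*) [CommRing A] [CommRing B] [Algebra A B]
    [Algebra.IsIntegral A B] : ringKrullDim B ≤ ringKrullDim A :=
  Order.krullDim_le_of_strictMono (PrimeSpectrum.comap (algebraMap A B)) fun _ _ h =>
    Ideal.IsIntegral.comap_lt_comap h

/-- Each step up a chain of primes ending at `P` costs at least one dimension of the quotient. -/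
theorem ringKrullDim_quotient_add_height_le {R : Type*} [CommRing R] (P : PrimeSpectrum R) {n : ℕ}
    (h : (n : ℕ∞) ≤ P.asIdeal.height) :
    ringKrullDim (R ⧸ P.asIdeal) + n ≤ ringKrullDim R := by
  rw [PrimeSpectrum.height_eq_orderHeight] at h
  obtain ⟨s, hs, rfl⟩ := Order.exists_series_of_le_height P h
  have : ∀ i : Fin (s.length + 1),
      ringKrullDim (R ⧸ (s i).asIdeal) + (i : ℕ) ≤ ringKrullDim R := by
    intro i
    induction i using Fin.induction with
    | zero => simpa using ringKrullDim_quotient_le (s 0).asIdeal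
    | succ i ih =>
      have hlt : (s i.castSucc).asIdeal < (s i.succ).asIdeal := s.step i
      refine le_trans ?_ ih
      have := ringKrullDim_quotient_lt hlt
      simp only [Fin.val_succ, Fin.val_castSucc, Nat.cast_add, Nat.cast_one]
      rw [add_comm ((i : ℕ) : WithBot ℕ∞), ← add_assoc]
      exact add_le_add_left this _
  have hlast := this (Fin.last _)
  have e : s (Fin.last _) = P := hs
  rw [e] at hlast
  simpa using hlast

open MvPolynomial in
-- The point `𝔪` need not be rational over `k`, so a translation of the variables is not enough.
-- Each `Xᵢ` is replaced by `fᵢ(Xᵢ)`, where `fᵢ` is the minimal polynomial of the residue class of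
-- `g(Xᵢ)`.
theorem exists_normalization_mem (k R : Type*) [Field k] [CommRing R] [IsDomain R] [Algebra k R]
    [Algebra.FiniteType k R] (𝔪 : Ideal R) [𝔪.IsMaximal] :
    ∃ (s : ℕ) (g : MvPolynomial (Fin s) k →ₐ[k] R), Function.Injective g ∧ g.Finite ∧
      ∀ i, g (X i) ∈ 𝔪 := by
  obtain ⟨s, g, hg, hfin⟩ := exists_finite_inj_algHom_of_fg k R
  let _ : Field (R ⧸ 𝔪) := Ideal.Quotient.field 𝔪
  have : Module.Finite k (R ⧸ 𝔪) := finite_of_finite_type_of_isJacobsonRing k (R ⧸ 𝔪)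
  have hf : ∀ i : Fin s, ∃ f : Polynomial k, f.Monic ∧ f.natDegree ≠ 0 ∧
      Polynomial.aeval (g (X i)) f ∈ 𝔪 := by
    intro i
    have hint : IsIntegral k (Ideal.Quotient.mk 𝔪 (g (X i))) := Algebra.IsIntegral.isIntegral _
    refine ⟨minpoly k (Ideal.Quotient.mk 𝔪 (g (X i))), minpoly.monic hint,
      (minpoly.natDegree_pos hint).ne', ?_⟩
    rw [← Ideal.Quotient.eq_zero_iff_mem]
    have := minpoly.aeval k (Ideal.Quotient.mk 𝔪 (g (X i)))
    rw [← this]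
    exact (Polynomial.aeval_algHom_apply (Ideal.Quotient.mkₐ k 𝔪) _ _).symm
  choose f hmon hdeg hmem using hf
  let h₀ : MvPolynomial (Fin s) k →ₐ[k] MvPolynomial (Fin s) k :=
    aeval fun i => Polynomial.aeval (X i) (f i)
  have hint : h₀.toRingHom.IsIntegral := by
    intro x
    induction x using MvPolynomial.induction_on with
    | C a =>
      have : h₀.toRingHom (C a) = C a := h₀.commutes a
      rw [← this]
      exact h₀.toRingHom.isIntegralElem_map
    | add p q hp hq => exact hp.add _ hq
    | mul_X p i hp =>
      -- Over the source of `h₀`, the variable `Xᵢ` is a root of the monic polynomial `fᵢ(T) - Xᵢ`,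
      -- because `h₀` sends `Xᵢ` to `fᵢ(Xᵢ)`.
      refine hp.mul _ ⟨(f i).map C - Polynomial.C (X i), ?_, ?_⟩
      · refine ((hmon i).map _).sub_of_left ?_
        refine lt_of_le_of_lt Polynomial.degree_C_le ?_
        rw [Polynomial.natDegree_pos_iff_degree_pos.symm, (hmon i).natDegree_map]
        exact Nat.pos_of_ne_zero (hdeg i)
      · rw [Polynomial.eval₂_sub, Polynomial.eval₂_C, Polynomial.eval₂_map]
        have h1 : h₀.toRingHom (X i) = Polynomial.aeval (X i) (f i) := aeval_X _ i
        have h2 : h₀.toRingHom.comp C = C := RingHom.ext fun a => h₀.commutes a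
        rw [h1, h2, sub_eq_zero]
        rfl
  -- A nonzero `a` in the kernel would make a ring of dimension `s` integral over a quotient of
  -- dimension less than `s`.
  have hinj : Function.Injective h₀ := by
    rw [injective_iff_map_eq_zero]
    intro a ha
    by_contra hne
    let φ := Ideal.Quotient.lift (Ideal.span {a}) h₀.toRingHom (fun x hx => by
      obtain ⟨c, rfl⟩ := Ideal.mem_span_singleton'.mp hx
      rw [map_mul]
      exact mul_eq_zero_of_right _ ha)
    let _ := φ.toAlgebra
    have : Algebra.IsIntegral (MvPolynomial (Fin s) k ⧸ Ideal.span {a}) (MvPolynomial (Fin s) k) :=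
      ⟨RingHom.IsIntegral.tower_top (Ideal.Quotient.mk _) φ hint⟩
    have h1 := ringKrullDim_le_of_isIntegral (MvPolynomial (Fin s) k ⧸ Ideal.span {a})
      (MvPolynomial (Fin s) k)
    have h2 := ringKrullDim_quotient_succ_le_of_nonZeroDivisor
      (mem_nonZeroDivisors_of_ne_zero hne)
    have h3 : ringKrullDim (MvPolynomial (Fin s) k) = s := by
      rw [MvPolynomial.ringKrullDim_of_isNoetherianRing, ringKrullDim_eq_zero_of_field]
      simp
    have h4 := (add_le_add_left h1 1).trans h2
    rw [h3] at h4
    have h5 : s + 1 ≤ s := by exact_mod_cast h4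
    omega
  refine ⟨s, g.comp h₀, hg.comp hinj, ?_, fun i => ?_⟩
  · refine RingHom.Finite.comp hfin ?_
    refine RingHom.IsIntegral.to_finite hint ?_
    have h : algebraMap k (MvPolynomial (Fin s) k) = h₀.toRingHom.comp (algebraMap k _) :=
      (h₀.comp_algebraMap).symm
    have h' : (algebraMap k (MvPolynomial (Fin s) k)).FiniteType :=
      RingHom.finiteType_algebraMap.mpr inferInstance
    rw [h] at h'
    exact h'.of_comp_finiteType
  · have : h₀ (X i) = Polynomial.aeval (X i) (f i) := aeval_X _ i
    rw [AlgHom.comp_apply, this, ← Polynomial.aeval_algHom_apply]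
    exact hmem i

/-- A maximal independent set of generators spans a free submodule. Each generator has a nonzero
multiple in it, and `c` is the product of the multipliers. -/
theorem exists_smul_factors_free (S M : Type*) [CommRing S] [IsDomain S] [AddCommGroup M]
    [Module S M] [Module.Finite S M] : ∃ (ι : Type) (_ : Finite ι) (φ : M →ₗ[S] ι → S)
      (ψ : (ι → S) →ₗ[S] M) (c : S), c ≠ 0 ∧ ∀ m, ψ (φ m) = c • m := by
  obtain ⟨n, v, hv⟩ := Module.Finite.exists_fin (R := S) (M := M)
  obtain ⟨s, hs, hmax⟩ := exists_maximal_linearIndepOn S v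
  have hmax' : ∀ i, ∃ a : S, a ≠ 0 ∧ a • v i ∈ Submodule.span S (v '' s) := by
    intro i
    by_cases hi : i ∈ s
    · exact ⟨1, one_ne_zero, by rw [one_smul]; exact Submodule.subset_span ⟨i, hi, rfl⟩⟩
    · exact hmax i hi
  choose a ha hav using hmax'
  let c := ∏ i, a i
  have hc : ∀ m, c • m ∈ Submodule.span S (Set.range fun i : s => v i) := by
    have : Submodule.span S (v '' s) = Submodule.span S (Set.range fun i : s => v i) := by
      rw [Set.image_eq_range]
    rw [← this]
    intro m
    have hm : m ∈ Submodule.span S (Set.range v) := hv ▸ Submodule.mem_top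
    induction hm using Submodule.span_induction with
    | mem x hx =>
      obtain ⟨i, rfl⟩ := hx
      have : c = (∏ l ∈ Finset.univ.erase i, a l) * a i :=
        (Finset.prod_erase_mul _ _ (Finset.mem_univ i)).symm
      rw [this, mul_smul]
      exact Submodule.smul_mem _ _ (hav i)
    | zero => rw [smul_zero]; exact zero_mem _
    | add x y _ _ hx hy => rw [smul_add]; exact add_mem hx hy
    | smul r x _ hx => rw [smul_comm]; exact Submodule.smul_mem _ _ hx
  let B := Module.Basis.span (v := fun i : s => v i) hs
  let φ₀ : M →ₗ[S] Submodule.span S (Set.range fun i : s => v i) :=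
    (c • LinearMap.id : M →ₗ[S] M).codRestrict _ hc
  refine ⟨s, inferInstance, B.equivFun.toLinearMap ∘ₗ φ₀,
    (Submodule.subtype _) ∘ₗ B.equivFun.symm.toLinearMap, c,
    Finset.prod_ne_zero_iff.mpr fun i _ => ha i, fun m => ?_⟩
  simp only [LinearMap.comp_apply, LinearEquiv.coe_coe, LinearEquiv.symm_apply_apply]
  rfl

open MvPolynomial in
-- Membership in a monomial ideal is read off monomial by monomial, and multiplying by `Xᵢ` changes
-- none of the exponents with index in `L`.
theorem mem_span_X_pow_of_X_pow_mul_mem {σ k : Type*} [Field k] {L : Finset σ} {a : σ → ℕ} {i : σ}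
    (hi : i ∉ L) {b : ℕ} {f : MvPolynomial σ k}
    (h : X i ^ b * f ∈ Ideal.span ((fun l => X l ^ a l) '' (L : Set σ) : Set (MvPolynomial σ k))) :
    f ∈ Ideal.span ((fun l => X l ^ a l) '' (L : Set σ) : Set (MvPolynomial σ k)) := by
  classical
  have himg : ((fun l => X l ^ a l) '' (L : Set σ) : Set (MvPolynomial σ k)) =
      (fun s => monomial s (1 : k)) '' ((fun l => Finsupp.single l (a l)) '' (L : Set σ)) := by
    rw [Set.image_image]
    simp only [X_pow_eq_monomial]
  rw [himg, mem_ideal_span_monomial_image] at h ⊢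
  intro e he
  have he' : Finsupp.single i b + e ∈ (X i ^ b * f).support := by
    rw [mem_support_iff, X_pow_eq_monomial, coeff_monomial_mul, one_mul]
    exact mem_support_iff.mp he
  obtain ⟨_, ⟨l, hl, rfl⟩, hle⟩ := h _ he'
  refine ⟨_, ⟨l, hl, rfl⟩, ?_⟩
  have hil : i ≠ l := fun h => hi (h ▸ hl)
  rw [Finsupp.single_le_iff] at hle ⊢
  simpa [Finsupp.single_apply, hil] using hle

open MvPolynomial in
-- The map `φ` carries a colon relation to the free module, where it is trivial because powers of
-- distinct variables form a regular sequence; `ψ` brings the conclusion back at the cost of `c`.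
theorem colonKilled_of_factors_free {k R : Type*} [Field k] [CommRing R] {s : ℕ}
    [Algebra (MvPolynomial (Fin s) k) R] {M : Type _} [AddCommGroup M] [Module R M]
    [Module (MvPolynomial (Fin s) k) M] [IsScalarTower (MvPolynomial (Fin s) k) R M]
    {ι : Type} [Finite ι] (φ : M →ₗ[MvPolynomial (Fin s) k] ι → MvPolynomial (Fin s) k)
    (ψ : (ι → MvPolynomial (Fin s) k) →ₗ[MvPolynomial (Fin s) k] M) (c : MvPolynomial (Fin s) k)
    (hc : ∀ m, ψ (φ m) = c • m) (l : List (Fin s)) (hl : l.Nodup) (L : Finset (Fin s))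
    (hL : ∀ i ∈ l, i ∉ L) (a : Fin s → ℕ) :
    ColonKilled (algebraMap (MvPolynomial (Fin s) k) R c • (LinearMap.id : M →ₗ[R] M))
      (l.map fun i => algebraMap (MvPolynomial (Fin s) k) R (X i))
      ((Ideal.span ((fun l => X l ^ a l) '' (L : Set (Fin s)) :
        Set (MvPolynomial (Fin s) k))).map (algebraMap (MvPolynomial (Fin s) k) R) • ⊤) := by
  classical
  have hmem : ∀ (J : Ideal (MvPolynomial (Fin s) k)) (m : M),
      m ∈ (J.map (algebraMap (MvPolynomial (Fin s) k) R) • ⊤ : Submodule R M) ↔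
        m ∈ (J • ⊤ : Submodule (MvPolynomial (Fin s) k) M) := by
    intro J m
    have := Ideal.smul_restrictScalars J (⊤ : Submodule R M)
    rw [Submodule.restrictScalars_top] at this
    rw [← this]
    rfl
  induction l generalizing L a with
  | nil => trivial
  | cons i l ih =>
    intro b
    set J := Ideal.span ((fun l => X l ^ a l) '' (L : Set (Fin s)) :
      Set (MvPolynomial (Fin s) k)) with hJ
    have hiL : i ∉ L := hL i (by simp)
    constructor
    · intro m hm
      rw [← map_pow, algebraMap_smul, hmem] at hm
      rw [LinearMap.smul_apply, LinearMap.id_apply, algebraMap_smul, hmem, ← hc]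
      have h1 : φ (X i ^ b • m) ∈ J • (⊤ : Submodule (MvPolynomial (Fin s) k) _) :=
        Submodule.smul_top_le_comap_smul_top J φ hm
      have h2 : ∀ x, φ m x ∈ J := by
        intro x
        refine mem_span_X_pow_of_X_pow_mul_mem hiL (b := b) ?_
        have h3 := Submodule.smul_top_le_comap_smul_top J
          (LinearMap.proj (R := MvPolynomial (Fin s) k) x) h1
        simpa using h3
      have := Fintype.ofFinite ι
      have h4 : φ m ∈ J • (⊤ : Submodule (MvPolynomial (Fin s) k) _) := by
        rw [pi_eq_sum_univ (φ m)]
        exact Submodule.sum_mem _ fun x _ => Submodule.smul_mem_smul (h2 x) Submodule.mem_top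
      exact Submodule.smul_top_le_comap_smul_top J ψ h4
    · have hil : i ∉ l := (List.nodup_cons.mp hl).1
      have := ih (List.nodup_cons.mp hl).2 (insert i L) (fun x hx => by
        rw [Finset.mem_insert, not_or]
        exact ⟨fun h => hil (h ▸ hx), hL x (by simp [hx])⟩) (Function.update a i b)
      have himg : ((fun l => X l ^ Function.update a i b l) '' ((insert i L : Finset _) : Set _) :
          Set (MvPolynomial (Fin s) k)) = insert (X i ^ b) ((fun l => X l ^ a l) '' (L : Set _)) := by
        rw [Finset.coe_insert, Set.image_insert_eq, Function.update_self]
        congr 1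
        refine Set.image_congr fun x hx => ?_
        rw [Function.update_of_ne]
        rintro rfl
        exact hiL hx
      rw [himg, Ideal.span_insert, ← hJ, sup_comm, Ideal.map_sup, Submodule.sup_smul,
        Ideal.map_span _ {_}, Set.image_singleton, map_pow] at this
      convert! this using 2
      ext m
      rw [Submodule.ideal_span_singleton_smul]
      simp [Submodule.mem_smul_pointwise_iff_exists]

/-- The order of quantifiers matters: `c` serves all exponents `q`, so the divisor `D` of `c` can be
fixed before the Frobenius power `n` is chosen. This is possible because `ColonKilled` is
insensitive to `q`. -/
theorem exists_lcMap_eq_zero {k : Type*} {R M : Type u} [Field k] [CommRing R] [IsDomain R]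
    [Algebra k R] [Algebra.FiniteType k R] {d : ℕ} (hd : ringKrullDim R = d) (𝔪 : Ideal R)
    [𝔪.IsMaximal] [AddCommGroup M] [Module R M] [Module.Finite R M] :
    ∃ c : R, c ≠ 0 ∧ ∀ (M' : Type u) [AddCommGroup M'] [Module R M'] (e : M ≃+ M') (q : ℕ)
      (_ : ∀ (r : R) (m : M), e (r ^ q • m) = r • e m) (γ : M' →ₗ[R] M')
      (_ : ∀ m, γ (e m) = e (c • m)), ∀ j < d, lcMap 𝔪 j γ = 0 := by
  obtain ⟨s, g, hg, hfin, hX⟩ := exists_normalization_mem k R 𝔪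
  let _ := g.toRingHom.toAlgebra
  have : Module.Finite (MvPolynomial (Fin s) k) R := hfin
  have hs : d ≤ s := by
    have h1 := ringKrullDim_le_of_isIntegral (MvPolynomial (Fin s) k) R
    rw [hd, MvPolynomial.ringKrullDim_of_isNoetherianRing, ringKrullDim_eq_zero_of_field] at h1
    simpa using h1
  let _ : Module (MvPolynomial (Fin s) k) M := Module.compHom M (algebraMap _ R)
  have : IsScalarTower (MvPolynomial (Fin s) k) R M := ⟨fun a r m => by
    rw [Algebra.smul_def, mul_smul]; rfl⟩
  have : Module.Finite (MvPolynomial (Fin s) k) M := Module.Finite.trans R M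
  obtain ⟨ι, _, φ, ψ, c, hc0, hc⟩ := exists_smul_factors_free (MvPolynomial (Fin s) k) M
  have hcR : algebraMap (MvPolynomial (Fin s) k) R c ≠ 0 :=
    (map_ne_zero_iff _ hg).mpr hc0
  -- Degree `j` needs `j + 1` factors of `c`, so `d` of them suffice for all `j < d`.
  refine ⟨algebraMap _ R c ^ d, pow_ne_zero _ hcR, fun M' _ _ e q he γ hγ j hj => ?_⟩
  let γ₀ : M' →ₗ[R] M' :=
    { toFun := fun x => e (algebraMap (MvPolynomial (Fin s) k) R c • e.symm x)
      map_add' := fun x y => by rw [map_add, smul_add, map_add]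
      map_smul' := fun r x => by
        obtain ⟨m, rfl⟩ := e.surjective x
        rw [← he, e.symm_apply_apply, e.symm_apply_apply, smul_comm, he]
        rfl }
  have hkill := colonKilled_of_factors_free (R := R) φ ψ c hc (List.finRange s)
    (List.nodup_finRange s) ∅ (by simp) 0
  have hkill' : ColonKilled γ₀ ((List.finRange s).map fun i =>
      algebraMap (MvPolynomial (Fin s) k) R (MvPolynomial.X i)) ⊥ :=
    hkill.of_pow_semilinear e he (fun m => by simp [γ₀]) (fun m => by simp)
  have hγ₀ : γ = (γ₀ : Module.End R M') ^ d := by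
    have : ∀ n (m : M), ((γ₀ : Module.End R M') ^ n) (e m) =
        e (algebraMap (MvPolynomial (Fin s) k) R c ^ n • m) := by
      intro n
      induction n with
      | zero => intro m; simp
      | succ n ih => intro m; rw [pow_succ', Module.End.mul_apply, ih]; simp [γ₀, pow_succ', mul_smul]
    ext x
    obtain ⟨m, rfl⟩ := e.surjective x
    rw [hγ, this]
  have hit : ∀ n (y : LC 𝔪 j M'), lcMap 𝔪 j ((γ₀ : Module.End R M') ^ n) y =
      (lcMap 𝔪 j γ₀)^[n] y := by
    intro n
    induction n with
    | zero => intro y; exact LinearMap.congr_fun (lcMap_id 𝔪 j) y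
    | succ n ih =>
      intro y
      rw [Function.iterate_succ_apply', ← ih, lcMap_comp_apply]
      congr 2
      rw [pow_succ']
      rfl
  ext y
  rw [hγ₀, hit, show d = (d - (j + 1)) + (j + 1) by omega, Function.iterate_add_apply,
    lcMap_iterate_eq_zero (π := LinearMap.id) ?_ hkill' Function.surjective_id rfl
      (LinearMap.ker_id) (by simpa using by omega) y]
  · exact Function.iterate_fixed (map_zero _) _
  · intro x hx
    obtain ⟨i, -, rfl⟩ := List.mem_map.mp hx
    exact hX i

end Normalization


/-! ### Cartan calculus on forms. -/

section Lie

variable {k A : Type*} [CommRing k] [CommRing A] [Algebra k A]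

/-- Contraction of forms with a vector field, given as a linear form on one-forms. -/
def contr (φ : Ω[A⁄k] →ₗ[A] A) : Forms k A →ₗ[A] Forms k A := CliffordAlgebra.contractLeft φ

variable (φ : Ω[A⁄k] →ₗ[A] A)

theorem contr_ι (m : Ω[A⁄k]) : contr φ (ExteriorAlgebra.ι A m) = algebraMap A _ (φ m) :=
  CliffordAlgebra.contractLeft_ι _ φ m

theorem contr_algebraMap (a : A) : contr φ (algebraMap A _ a) = 0 :=
  CliffordAlgebra.contractLeft_algebraMap _ φ a

theorem contr_mul (x y : Forms k A) : contr φ (x * y) = contr φ x * y + sgn x * contr φ y := by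
  induction x using ExteriorAlgebra.induction generalizing y with
  | algebraMap r =>
    rw [contr_algebraMap, zero_mul, zero_add, AlgHom.commutes]
    exact CliffordAlgebra.contractLeft_algebraMap_mul φ r y
  | ι m =>
    rw [contr_ι, sgn_ι, neg_mul, ← sub_eq_add_neg, ← Algebra.smul_def]
    exact CliffordAlgebra.contractLeft_ι_mul φ m y
  | mul a b ha hb => rw [mul_assoc, ha, hb, ha, map_mul]; noncomm_ring
  | add a b ha hb => rw [add_mul, map_add, ha, hb, map_add, map_add]; noncomm_ring

theorem contr_sgn (x : Forms k A) : contr φ (sgn x) = -sgn (contr φ x) := by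
  induction x using ExteriorAlgebra.induction with
  | algebraMap r => rw [AlgHom.commutes, contr_algebraMap, map_zero, neg_zero]
  | ι m => rw [sgn_ι, map_neg, contr_ι, AlgHom.commutes]
  | mul a b ha hb =>
    rw [map_mul, contr_mul, ha, hb, contr_mul, map_add, map_mul, map_mul]
    noncomm_ring
  | add a b ha hb => rw [map_add, map_add, ha, hb, map_add, map_add]; abel

/-- The Lie derivative along a vector field, by Cartan's formula. -/
def lie : AddMonoid.End (Forms k A) :=
  (extD k A).comp (contr φ).toAddMonoidHom + (contr φ).toAddMonoidHom.comp (extD k A)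

theorem lie_apply (x : Forms k A) : lie φ x = extD k A (contr φ x) + contr φ (extD k A x) := rfl

theorem lie_mul (x y : Forms k A) : lie φ (x * y) = lie φ x * y + x * lie φ y := by
  simp only [lie_apply, contr_mul, extD_mul, map_add, extD_sgn, contr_sgn, sgn_sgn]
  noncomm_ring

theorem lie_algebraMap (a : A) :
    lie φ (algebraMap A _ a) = algebraMap A _ (φ (KaehlerDifferential.D k A a)) := by
  rw [lie_apply, contr_algebraMap, map_zero, zero_add, extD_algebraMap, dFun, contr_ι]

theorem lie_smul (a : A) (y : Forms k A) :
    lie φ (a • y) = φ (KaehlerDifferential.D k A a) • y + a • lie φ y := by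
  rw [Algebra.smul_def, lie_mul, lie_algebraMap, ← Algebra.smul_def, ← Algebra.smul_def]

theorem extD_lie (x : Forms k A) : extD k A (lie φ x) = lie φ (extD k A x) := by
  rw [lie_apply, lie_apply, map_add, extD_extD, extD_extD, map_zero, zero_add, add_zero]

theorem lie_eq_extD {x : Forms k A} (hx : extD k A x = 0) : lie φ x = extD k A (contr φ x) := by
  rw [lie_apply, hx, map_zero, add_zero]

theorem end_pow_succ_apply {M : Type*} [AddCommMonoid M] (f : AddMonoid.End M) (n : ℕ) (x : M) :
    (f ^ (n + 1)) x = f ((f ^ n) x) := by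
  rw [pow_succ']; rfl

theorem extD_lie_pow (n : ℕ) (x : Forms k A) :
    extD k A ((lie φ ^ n) x) = (lie φ ^ n) (extD k A x) := by
  induction n generalizing x with
  | zero => rfl
  | succ n ih =>
    rw [end_pow_succ_apply, end_pow_succ_apply, extD_lie, ih]

end Lie

/-! ### The `p`-th power of a derivation. -/

section DerivationPow

variable {k A : Type*} [CommRing k] [CommRing A] [Algebra k A]

open TensorProduct in
-- The Leibniz rule says that multiplication intertwines `θ ⊗ 1 + 1 ⊗ θ` with `θ`. The two summands
-- commute, so in characteristic `p` the `p`-th power of the sum is `θ^p ⊗ 1 + 1 ⊗ θ^p`.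
theorem exists_derivation_pow (p : ℕ) [Fact p.Prime] [CharP k p] (θ : Derivation k A A) :
    ∃ δ : Derivation k A A, ∀ a, δ a = ((θ : A →ₗ[k] A) ^ p : Module.End k A) a := by
  let t : Module.End k A := (θ : A →ₗ[k] A)
  let u : Module.End k (A ⊗[k] A) := LinearMap.rTensor A t
  let v : Module.End k (A ⊗[k] A) := LinearMap.lTensor A t
  have huv : Commute u v := by
    change u * v = v * u
    refine TensorProduct.ext' fun a b => ?_
    simp [u, v]
  have hu : ∀ n (a b : A), (u ^ n) (a ⊗ₜ b) = (t ^ n) a ⊗ₜ b := by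
    intro n a b
    induction n generalizing a with
    | zero => rfl
    | succ n ih => rw [pow_succ, pow_succ, Module.End.mul_apply, Module.End.mul_apply, ← ih]; rfl
  have hv : ∀ n (a b : A), (v ^ n) (a ⊗ₜ b) = a ⊗ₜ (t ^ n) b := by
    intro n a b
    induction n generalizing b with
    | zero => rfl
    | succ n ih => rw [pow_succ, pow_succ, Module.End.mul_apply, Module.End.mul_apply, ← ih]; rfl
  have hmul : ∀ n (z : A ⊗[k] A),
      (t ^ n) (LinearMap.mul' k A z) = LinearMap.mul' k A (((u + v) ^ n) z) := by
    intro n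
    induction n with
    | zero => intro z; rfl
    | succ n ih =>
      intro z
      rw [pow_succ, pow_succ, Module.End.mul_apply, Module.End.mul_apply, ← ih]
      congr 1
      induction z with
      | zero => simp
      | add y z hy hz => rw [map_add, map_add, map_add, map_add, hy, hz]
      | tmul a b =>
        simp only [LinearMap.mul'_apply, LinearMap.add_apply, u, v, LinearMap.rTensor_tmul,
          LinearMap.lTensor_tmul, map_add]
        change θ (a * b) = θ a * b + a * θ b
        rw [θ.leibniz]
        simp [mul_comm, add_comm]
  have hpow : (u + v) ^ p = u ^ p + v ^ p := by
    obtain ⟨r, hr⟩ := huv.exists_add_pow_prime_eq (Fact.out : p.Prime)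
    have h0 : (p : Module.End k (A ⊗[k] A)) = 0 := by
      rw [← map_natCast (algebraMap k (Module.End k (A ⊗[k] A))), CharP.cast_eq_zero, map_zero]
    rw [hr, h0, zero_mul, zero_mul, zero_mul, add_zero]
  refine ⟨Derivation.mk' (t ^ p) fun a b => ?_, fun a => rfl⟩
  have := hmul p (a ⊗ₜ b)
  rw [hpow, LinearMap.add_apply, hu, hv, map_add] at this
  simp only [LinearMap.mul'_apply] at this
  rw [this, smul_eq_mul, smul_eq_mul, add_comm, mul_comm b]

end DerivationPow

/-! ### The Cartier isomorphism in logarithmic coordinates. -/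

section Coordinates

variable {k A : Type*} {p : ℕ} [Fact p.Prime] [Field k] [CharP k p] [CommRing A] [Nontrivial A]
  [Algebra k A] {ι : Type*} [Fintype ι] [LinearOrder ι] (b : Module.Basis ι A Ω[A⁄k])

theorem basis_mem_submonoid (S : Submonoid (Forms k A)) (h : ∀ l, ExteriorAlgebra.ι A (b l) ∈ S)
    (s : Finset ι) : b.ExteriorAlgebra s ∈ S := by
  rw [ExteriorAlgebra.basis_apply]
  simp only [ExteriorAlgebra.ιMulti_family, ExteriorAlgebra.ιMulti_apply]
  refine Submonoid.list_prod_mem _ fun x hx => ?_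
  obtain ⟨i, rfl⟩ := List.mem_ofFn.mp hx
  exact h _

theorem repr_eq_zero_of_mem {i : ℕ} {ω : Forms k A} (hω : ω ∈ ⋀[A]^i Ω[A⁄k]) {s : Finset ι}
    (hs : s.card ≠ i) : b.ExteriorAlgebra.repr ω s = 0 := by
  let f : ⋀[A]^i Ω[A⁄k] →ₗ[A] A := b.ExteriorAlgebra.coord s ∘ₗ Submodule.subtype _
  have hf : f = 0 := (b.exteriorPower i).ext fun t => by
    change b.ExteriorAlgebra.repr (b.exteriorPower i t : Forms k A) s = 0
    rw [← ExteriorAlgebra.basis_eq_coe_basis, Module.Basis.repr_self, Finsupp.single_apply_eq_zero]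
    rintro rfl
    exact absurd t.2 hs
  exact LinearMap.congr_fun hf ⟨ω, hω⟩

theorem mem_of_repr_eq_zero {i : ℕ} {ω : Forms k A}
    (h : ∀ s : Finset ι, s.card ≠ i → b.ExteriorAlgebra.repr ω s = 0) :
    ω ∈ ⋀[A]^i Ω[A⁄k] := by
  rw [← b.ExteriorAlgebra.sum_repr ω]
  refine Submodule.sum_mem _ fun s _ => ?_
  by_cases hs : s.card = i
  · refine Submodule.smul_mem _ _ ?_
    have := ExteriorAlgebra.basis_eq_coe_basis b (⟨s, hs⟩ : Set.powersetCard ι i)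
    exact this ▸ Subtype.coe_prop _
  · rw [h s hs, zero_smul]
    exact zero_mem _

/-- The derivation dual to the basis vector `b l` of the module of differentials. -/
def coordDer (l : ι) : Derivation k A A := (b.coord l).compDer (KaehlerDifferential.D k A)

theorem coordDer_apply (l : ι) (a : A) : coordDer b l a = b.coord l (KaehlerDifferential.D k A a) :=
  rfl

theorem D_eq_zero_of_coordDer {a : A} (h : ∀ l, coordDer b l a = 0) :
    KaehlerDifferential.D k A a = 0 :=
  b.ext_elem fun l => by rw [map_zero]; exact h l

variable {b} {x : ι → Aˣ}

/-- The basis `b` consists of the logarithmic differentials of the units `x`. -/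
def IsLogBasis (b : Module.Basis ι A Ω[A⁄k]) (x : ι → Aˣ) : Prop :=
  ∀ l, b l = (((x l)⁻¹ : Aˣ) : A) • KaehlerDifferential.D k A (x l : A)

theorem IsLogBasis.D_unit (h : IsLogBasis b x) (l : ι) :
    KaehlerDifferential.D k A (x l : A) = (x l : A) • b l := by
  rw [h l, smul_smul, Units.mul_inv, one_smul]

theorem IsLogBasis.coordDer_unit (h : IsLogBasis b x) (l m : ι) :
    coordDer b l (x m : A) = if m = l then (x m : A) else 0 := by
  rw [coordDer_apply, h.D_unit, map_smul, Module.Basis.coord_apply, Module.Basis.repr_self,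
    Finsupp.single_apply]
  split_ifs <;> simp

theorem IsLogBasis.derivation_ext (h : IsLogBasis b x) {δ δ' : Derivation k A A}
    (hδ : ∀ l, δ (x l : A) = δ' (x l : A)) : δ = δ' := by
  have : δ.liftKaehlerDifferential = δ'.liftKaehlerDifferential := b.ext fun l => by
    rw [h l, map_smul, map_smul, Derivation.liftKaehlerDifferential_comp_D,
      Derivation.liftKaehlerDifferential_comp_D, hδ]
  ext a
  rw [← δ.liftKaehlerDifferential_comp_D, this, δ'.liftKaehlerDifferential_comp_D]

/-- The operator `coordDer b l` as an endomorphism of the `k`-module `A`. -/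
def coordEnd (b : Module.Basis ι A Ω[A⁄k]) (l : ι) : Module.End k A :=
  (coordDer b l : A →ₗ[k] A)

theorem coordEnd_apply (l : ι) (a : A) : coordEnd b l a = coordDer b l a := rfl

theorem IsLogBasis.coordEnd_pow_unit (h : IsLogBasis b x) (l m : ι) (n : ℕ) :
    (coordEnd b l ^ (n + 1)) (x m : A) = if m = l then (x m : A) else 0 := by
  induction n with
  | zero => rw [zero_add, pow_one]; exact h.coordDer_unit l m
  | succ n ih =>
    rw [pow_succ', Module.End.mul_apply, ih]
    split_ifs with hm
    · rw [coordEnd_apply, h.coordDer_unit, if_pos hm]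
    · rw [map_zero]

/-- Both sides are derivations, and both send `x l` to itself and every other coordinate to zero. -/
theorem IsLogBasis.coordEnd_pow_p (h : IsLogBasis b x) (p : ℕ) [Fact p.Prime] [CharP k p]
    (l : ι) : coordEnd b l ^ p = coordEnd b l := by
  obtain ⟨δ, hδ⟩ := exists_derivation_pow p (coordDer b l)
  obtain ⟨q, hq⟩ : ∃ q, p = q + 1 :=
    ⟨p - 1, (Nat.succ_pred_eq_of_pos (Fact.out : p.Prime).pos).symm⟩
  have : δ = coordDer b l := h.derivation_ext fun m => by
    rw [hδ, h.coordDer_unit, hq]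
    exact h.coordEnd_pow_unit l m q
  ext a
  rw [coordEnd_apply, ← this, hδ]
  rfl

theorem IsLogBasis.commute_coordEnd (h : IsLogBasis b x) (l m : ι) :
    Commute (coordEnd b l) (coordEnd b m) := by
  have : ⁅coordDer b l, coordDer b m⁆ = 0 := h.derivation_ext fun j => by
    rw [Derivation.commutator_apply, h.coordDer_unit, h.coordDer_unit]
    split_ifs with h1 h2 h2
    · rw [h.coordDer_unit, h.coordDer_unit, if_pos h1, if_pos h2, sub_self]; rfl
    · rw [h.coordDer_unit, map_zero, if_neg h2, sub_zero]; rfl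
    · rw [h.coordDer_unit, map_zero, if_neg h1, sub_zero]; rfl
    · rw [map_zero, map_zero, sub_zero]; rfl
  change _ * _ = _ * _
  ext a
  have h2 := congrArg (fun δ : Derivation k A A => δ a) this
  simp only [Derivation.commutator_apply, Derivation.coe_zero, Pi.zero_apply, sub_eq_zero] at h2
  exact h2

/-- The projection of `A` onto the kernel of `coordDer b l`. -/
def coordProj (p : ℕ) (b : Module.Basis ι A Ω[A⁄k]) (l : ι) : Module.End k A :=
  1 - coordEnd b l ^ (p - 1)

/-- The projection of `A` onto the constants. -/
def constProj (p : ℕ) (b : Module.Basis ι A Ω[A⁄k]) (L : List ι) : Module.End k A :=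
  (L.map (coordProj p b)).prod

/-- The analogue of `coordProj` for forms. -/
def lieProj (p : ℕ) (b : Module.Basis ι A Ω[A⁄k]) (l : ι) : AddMonoid.End (Forms k A) :=
  1 - lie (b.coord l) ^ (p - 1)

/-- The analogue of `constProj` for forms. -/
def formProj (p : ℕ) (b : Module.Basis ι A Ω[A⁄k]) (L : List ι) : AddMonoid.End (Forms k A) :=
  (L.map (lieProj p b)).prod

theorem formProj_cons (p : ℕ) (l : ι) (L : List ι) (ω : Forms k A) :
    formProj p b (l :: L) ω = lieProj p b l (formProj p b L ω) := by
  rw [formProj, List.map_cons, List.prod_cons]; rfl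

theorem constProj_cons (p : ℕ) (l : ι) (L : List ι) (a : A) :
    constProj p b (l :: L) a = coordProj p b l (constProj p b L a) := by
  rw [constProj, List.map_cons, List.prod_cons]; rfl

theorem lieProj_apply (p : ℕ) (l : ι) (ω : Forms k A) :
    lieProj p b l ω = ω - (lie (b.coord l) ^ (p - 1)) ω := rfl

theorem coordProj_apply (p : ℕ) (l : ι) (a : A) :
    coordProj p b l a = a - (coordEnd b l ^ (p - 1)) a := rfl

theorem exists_prime_eq (p : ℕ) [Fact p.Prime] : ∃ q, p - 1 = q + 1 :=
  ⟨p - 2, by have := (Fact.out : p.Prime).two_le; omega⟩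

theorem coordProj_of_coordDer_eq_zero {l : ι} {a : A} (h : coordDer b l a = 0) :
    coordProj p b l a = a := by
  obtain ⟨q, hq⟩ := exists_prime_eq p
  rw [coordProj_apply, hq, pow_succ, Module.End.mul_apply, coordEnd_apply, h, map_zero, sub_zero]

theorem constProj_of_D_eq_zero {a : A} (h : KaehlerDifferential.D k A a = 0) (L : List ι) :
    constProj p b L a = a := by
  induction L with
  | nil => rfl
  | cons l L ih =>
    rw [constProj_cons, ih, coordProj_of_coordDer_eq_zero]
    rw [coordDer_apply, h, map_zero]

/-- With `θ = coordEnd b l`, the identity `θ^p = θ` gives `θ (1 - θ^(p-1)) = 0`, and `θ` commutes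
with the other factors. -/
theorem IsLogBasis.coordEnd_mul_constProj (h : IsLogBasis b x) {l : ι} {L : List ι} (hl : l ∈ L) :
    coordEnd b l * constProj p b L = 0 := by
  induction L with
  | nil => simp at hl
  | cons m L ih =>
    have hc : Commute (coordEnd b l) (coordProj p b m) :=
      (Commute.one_right _).sub_right ((h.commute_coordEnd l m).pow_right _)
    have hcons : constProj p b (m :: L) = coordProj p b m * constProj p b L := by
      rw [constProj, List.map_cons, List.prod_cons]; rfl
    rw [hcons]
    by_cases hlm : l = m
    · subst hlm
      rw [← mul_assoc, coordProj, mul_sub, mul_one, ← pow_succ',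
        Nat.sub_add_cancel (Fact.out : p.Prime).one_le, h.coordEnd_pow_p p, sub_self, zero_mul]
    · rw [← mul_assoc, hc.eq, mul_assoc, ih ((List.mem_cons.mp hl).resolve_left hlm), mul_zero]

theorem IsLogBasis.D_constProj (h : IsLogBasis b x) {L : List ι} (hL : ∀ l, l ∈ L) (a : A) :
    KaehlerDifferential.D k A (constProj p b L a) = 0 :=
  D_eq_zero_of_coordDer b fun l =>
    LinearMap.congr_fun (h.coordEnd_mul_constProj (p := p) (hL l)) a

theorem IsLogBasis.extD_ι (h : IsLogBasis b x) (l : ι) :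
    extD k A (ExteriorAlgebra.ι A (b l)) = 0 := by
  have e : ExteriorAlgebra.ι A (b l) = (((x l)⁻¹ : Aˣ) : A) • dFun k (x l : A) := by
    rw [h l, map_smul]; rfl
  have e2 : dFun k (((x l)⁻¹ : Aˣ) : A) = -((((x l)⁻¹ : Aˣ) : A) ^ 2 • dFun k (x l : A)) := by
    have h0 : dFun k ((x l : A) * (((x l)⁻¹ : Aˣ) : A)) = 0 := by rw [Units.mul_inv, dFun_one]
    rw [dFun_mul] at h0
    have h1 := congrArg ((((x l)⁻¹ : Aˣ) : A) • ·) h0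
    simp only [smul_add, smul_smul, Units.inv_mul, one_smul, smul_zero] at h1
    rw [pow_two]
    exact eq_neg_of_add_eq_zero_left h1
  rw [e, extD_smul, extD_dFun, smul_zero, add_zero, e2, neg_mul, smul_mul_assoc]
  simp [dFun]

theorem IsLogBasis.extD_basis (h : IsLogBasis b x) (s : Finset ι) :
    extD k A (b.ExteriorAlgebra s) = 0 :=
  basis_mem_submonoid b (closedForms k A).toSubmonoid h.extD_ι s

theorem IsLogBasis.lie_basis (h : IsLogBasis b x) (l : ι) (s : Finset ι) :
    lie (b.coord l) (b.ExteriorAlgebra s) = 0 := by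
  let S : Submonoid (Forms k A) :=
    { carrier := {ω | lie (b.coord l) ω = 0}
      one_mem' := by
        have := lie_algebraMap (b.coord l) (1 : A)
        rwa [map_one, Derivation.map_one_eq_zero, map_zero, map_zero] at this
      mul_mem' := fun {y z} hy hz => by
        simp only [Set.mem_ofPred_eq] at *
        rw [lie_mul, hy, hz, zero_mul, mul_zero, add_zero] }
  refine basis_mem_submonoid b S (fun m => ?_) s
  change lie (b.coord l) _ = 0
  rw [lie_apply, h.extD_ι, map_zero, add_zero, contr_ι, extD_algebraMap, Module.Basis.coord_apply,
    Module.Basis.repr_self, Finsupp.single_apply]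
  split_ifs <;> simp

theorem IsLogBasis.lie_pow_smul_basis (h : IsLogBasis b x) (l : ι) (s : Finset ι) (n : ℕ) (a : A) :
    (lie (b.coord l) ^ n) (a • b.ExteriorAlgebra s) =
      (coordEnd b l ^ n) a • b.ExteriorAlgebra s := by
  induction n with
  | zero => rfl
  | succ n ih =>
    rw [end_pow_succ_apply, ih, lie_smul, h.lie_basis, smul_zero, add_zero, pow_succ']
    rfl

theorem IsLogBasis.formProj_smul_basis (h : IsLogBasis b x) (p : ℕ) (L : List ι) (s : Finset ι)
    (a : A) : formProj p b L (a • b.ExteriorAlgebra s) =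
      constProj p b L a • b.ExteriorAlgebra s := by
  induction L with
  | nil => rfl
  | cons l L ih =>
    rw [formProj_cons, ih, lieProj_apply, h.lie_pow_smul_basis, constProj_cons, coordProj_apply,
      sub_smul]

theorem IsLogBasis.formProj_eq_sum (h : IsLogBasis b x) (p : ℕ) (L : List ι) (ω : Forms k A) :
    formProj p b L ω =
      ∑ s, constProj p b L (b.ExteriorAlgebra.repr ω s) • b.ExteriorAlgebra s := by
  conv_lhs => rw [← b.ExteriorAlgebra.sum_repr ω]
  rw [map_sum]
  exact Finset.sum_congr rfl fun s _ => h.formProj_smul_basis p L s _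

theorem IsLogBasis.repr_formProj (h : IsLogBasis b x) (p : ℕ) (L : List ι) (ω : Forms k A)
    (s : Finset ι) : b.ExteriorAlgebra.repr (formProj p b L ω) s =
      constProj p b L (b.ExteriorAlgebra.repr ω s) := by
  rw [h.formProj_eq_sum, Module.Basis.repr_sum_self]

theorem extD_formProj (p : ℕ) (L : List ι) (ω : Forms k A) :
    extD k A (formProj p b L ω) = formProj p b L (extD k A ω) := by
  induction L with
  | nil => rfl
  | cons l L ih =>
    rw [formProj_cons, formProj_cons, lieProj_apply, lieProj_apply, map_sub, extD_lie_pow, ih]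

/-- The projection commutes with `d` and leaves only constant coefficients, which stand in front of
closed basis forms. -/
theorem IsLogBasis.formProj_extD (h : IsLogBasis b x) {L : List ι} (hL : ∀ l, l ∈ L)
    (τ : Forms k A) : formProj p b L (extD k A τ) = 0 := by
  rw [← extD_formProj, h.formProj_eq_sum, map_sum]
  refine Finset.sum_eq_zero fun s _ => ?_
  rw [extD_smul, h.extD_basis, smul_zero, add_zero, dFun, h.D_constProj hL, map_zero, zero_mul]

/-- On closed forms the Lie derivative is `d` after contraction, so the term `lie ^ (p - 1)`
subtracted by each projection is exact. Hence every closed form is cohomologous to its constant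
part. -/
theorem exists_extD_eq_sub_formProj {ω : Forms k A} (hω : extD k A ω = 0) (L : List ι) :
    ∃ τ, extD k A τ = ω - formProj p b L ω := by
  induction L with
  | nil => exact ⟨0, by rw [map_zero]; exact (sub_self ω).symm⟩
  | cons l L ih =>
    obtain ⟨τ, hτ⟩ := ih
    obtain ⟨q, hq⟩ := exists_prime_eq p
    have hcl : extD k A (formProj p b L ω) = 0 := by rw [extD_formProj, hω, map_zero]
    refine ⟨τ + (lie (b.coord l) ^ q) (contr (b.coord l) (formProj p b L ω)), ?_⟩
    rw [map_add, hτ, formProj_cons, lieProj_apply, hq, extD_lie_pow, ← lie_eq_extD _ hcl, pow_succ]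
    change _ + _ = ω - (_ - (lie (b.coord l) ^ q) (lie (b.coord l) _))
    abel

theorem IsCartier.mul {ω₁ ω₂ η₁ η₂ : Forms k A} (h₁ : IsCartier p ω₁ η₁)
    (h₂ : IsCartier p ω₂ η₂) : IsCartier p (ω₁ * ω₂) (η₁ * η₂) := by
  obtain ⟨h₁, e₁⟩ := h₁
  obtain ⟨h₂, e₂⟩ := h₂
  refine ⟨mul_mem h₁ h₂, ?_⟩
  rw [map_mul, ← e₁, ← e₂, ← map_mul]
  rfl

theorem isCartier_zero : IsCartier p (0 : Forms k A) 0 := by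
  obtain ⟨ζ, h, rfl⟩ := IsCartierIter.zero (k := k) (A := A) (p := p) 1
  exact h

theorem isCartier_one : IsCartier p (1 : Forms k A) 1 :=
  ⟨one_mem _, by rw [map_one]; exact map_one (FrobCohomology.mk k A p)⟩

theorem IsCartier.sum {κ : Type*} (S : Finset κ) {ω η : κ → Forms k A}
    (h : ∀ s ∈ S, IsCartier p (ω s) (η s)) : IsCartier p (∑ s ∈ S, ω s) (∑ s ∈ S, η s) := by
  classical
  induction S using Finset.induction_on with
  | empty => simpa using isCartier_zero
  | insert s S hs ih =>
    rw [Finset.sum_insert hs, Finset.sum_insert hs]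
    exact (h s (by simp)).add (ih fun t ht => h t (by simp [ht]))

theorem isCartier_dFun (a : A) : IsCartier p (a ^ (p - 1) • dFun k a) (dFun k a) := by
  refine ⟨pow_smul_dFun_mem a _, ?_⟩
  have : dFun k a = ExteriorAlgebra.ι A (KaehlerDifferential.D k A a) := rfl
  rw [cartierInv]
  conv_rhs => rw [this]
  rw [ExteriorAlgebra.lift_ι_apply, cartierOneForm_D]

theorem IsLogBasis.isCartier_basis (h : IsLogBasis b x) (s : Finset ι) :
    IsCartier p (b.ExteriorAlgebra s) (b.ExteriorAlgebra s) := by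
  let S : Submonoid (Forms k A) :=
    { carrier := {ω | IsCartier p ω ω}
      one_mem' := isCartier_one
      mul_mem' := fun hy hz => IsCartier.mul hy hz }
  refine basis_mem_submonoid b S (fun l => ?_) s
  have e : ExteriorAlgebra.ι A (b l) = (((x l)⁻¹ : Aˣ) : A) • dFun k (x l : A) := by
    rw [h l, map_smul]; rfl
  change IsCartier p _ _
  have := (isCartier_dFun (k := k) (p := p) (x l : A)).pow_smul (((x l)⁻¹ : Aˣ) : A)
  rw [e]
  convert this using 1
  rw [smul_smul]
  congr 1
  obtain ⟨q, hq⟩ : ∃ q, p = q + 1 :=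
    ⟨p - 1, (Nat.succ_pred_eq_of_pos (Fact.out : p.Prime).pos).symm⟩
  rw [hq, Nat.add_sub_cancel, pow_succ, mul_right_comm, ← mul_pow, Units.inv_mul, one_pow, one_mul]

theorem IsCartier.exists_extD_eq_sub {ω ω' η : Forms k A} (h : IsCartier p ω η)
    (h' : IsCartier p ω' η) : ∃ τ, extD k A τ = ω - ω' := by
  have := h.add h'.neg
  rw [add_neg_cancel, ← sub_eq_add_neg] at this
  obtain ⟨hc, e⟩ := this
  rw [map_zero, FrobCohomology.mk_eq_zero] at e
  exact e

theorem IsCartier.add_extD {ω η : Forms k A} (h : IsCartier p ω η) (τ : Forms k A) :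
    IsCartier p (ω + extD k A τ) η := by
  have h0 : IsCartier p (extD k A τ) 0 := by
    refine ⟨extD_extD τ, ?_⟩
    rw [map_zero, FrobCohomology.mk_eq_zero]
    exact ⟨τ, rfl⟩
  simpa using h.add h0

/-- In coordinates, the Cartier operator extracts `p`-th roots of the constant parts of the
coefficients. -/
theorem IsLogBasis.constProj_repr_eq (h : IsLogBasis b x) {ω η : Forms k A} (hC : IsCartier p ω η)
    {L : List ι} (hL : ∀ l, l ∈ L) (s : Finset ι) :
    constProj p b L (b.ExteriorAlgebra.repr ω s) = b.ExteriorAlgebra.repr η s ^ p := by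
  have h0 : IsCartier p (∑ s, b.ExteriorAlgebra.repr η s ^ p • b.ExteriorAlgebra s) η := by
    conv_rhs => rw [← b.ExteriorAlgebra.sum_repr η]
    exact IsCartier.sum _ fun s _ => (h.isCartier_basis s).pow_smul _
  obtain ⟨τ, hτ⟩ := hC.exists_extD_eq_sub h0
  have h1 := h.formProj_extD (p := p) hL τ
  rw [hτ, map_sub, sub_eq_zero] at h1
  have h2 := congrArg (fun z => b.ExteriorAlgebra.repr z s) h1
  rw [h.repr_formProj, h.repr_formProj, Module.Basis.repr_sum_self] at h2
  rw [h2]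
  refine constProj_of_D_eq_zero ?_ L
  have := charP_of_algebra k A p
  rw [Derivation.leibniz_pow, ← Nat.cast_smul_eq_nsmul A, CharP.cast_eq_zero, zero_smul]

theorem IsLogBasis.isCartier_unique [IsReduced A] (h : IsLogBasis b x) {ω η η' : Forms k A}
    (hC : IsCartier p ω η) (hC' : IsCartier p ω η') : η = η' := by
  have := charP_of_algebra k A p
  refine b.ExteriorAlgebra.ext_elem fun s => frobenius_inj A p ?_
  rw [frobenius_def, frobenius_def,
    ← h.constProj_repr_eq hC (L := Finset.univ.toList) (by simp),
    ← h.constProj_repr_eq hC' (L := Finset.univ.toList) (by simp)]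

theorem IsLogBasis.isCartier_mem [IsReduced A] (h : IsLogBasis b x) {i : ℕ} {ω η : Forms k A}
    (hC : IsCartier p ω η) (hω : ω ∈ ⋀[A]^i Ω[A⁄k]) : η ∈ ⋀[A]^i Ω[A⁄k] := by
  refine mem_of_repr_eq_zero b fun s hs => ?_
  have := h.constProj_repr_eq hC (L := Finset.univ.toList) (by simp) s
  rw [repr_eq_zero_of_mem b hω hs, map_zero] at this
  exact pow_eq_zero_iff (Fact.out : p.Prime).ne_zero |>.mp this.symm

/-- Modulo exact forms, `ω` has constant coefficients in a basis fixed by `C`; `p`-th roots of these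
coefficients give `η`. -/
theorem IsLogBasis.exists_isCartier (h : IsLogBasis b x)
    (hconst : ∀ a : A, KaehlerDifferential.D k A a = 0 → ∃ c, c ^ p = a) {ω : Forms k A}
    (hω : extD k A ω = 0) : ∃ η, IsCartier p ω η := by
  let L : List ι := Finset.univ.toList
  have hL : ∀ l, l ∈ L := by simp [L]
  obtain ⟨τ, hτ⟩ := exists_extD_eq_sub_formProj (p := p) (b := b) hω L
  choose c hc using fun s => hconst _ (h.D_constProj (p := p) hL (b.ExteriorAlgebra.repr ω s))
  have h0 : IsCartier p (∑ s, c s ^ p • b.ExteriorAlgebra s) (∑ s, c s • b.ExteriorAlgebra s) :=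
    IsCartier.sum _ fun s _ => (h.isCartier_basis s).pow_smul _
  refine ⟨∑ s, c s • b.ExteriorAlgebra s, ?_⟩
  convert h0.add_extD τ using 1
  rw [hτ, h.formProj_eq_sum]
  simp only [hc]
  abel

end Coordinates


/-! ### Existence of logarithmic coordinates. -/

section LogBasis

variable {k A : Type*} [Field k] [CommRing A] [Algebra k A]

/-- In a local ring `a` or `1 - a` is a unit, and `da = -d(1 - a)`, so logarithmic differentials of
units span. A spanning family of a free module over a local ring contains a basis. -/
theorem exists_isLogBasis [IsLocalRing A] [Module.Finite A Ω[A⁄k]] [Module.Free A Ω[A⁄k]] :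
    ∃ (n : ℕ) (b : Module.Basis (Fin n) A Ω[A⁄k]) (x : Fin n → Aˣ), IsLogBasis b x := by
  let v : Aˣ → Ω[A⁄k] := fun u => ((u⁻¹ : Aˣ) : A) • KaehlerDifferential.D k A (u : A)
  have hu : ∀ u : Aˣ, KaehlerDifferential.D k A (u : A) ∈ Submodule.span A (Set.range v) := by
    intro u
    have : KaehlerDifferential.D k A (u : A) = (u : A) • v u := by
      rw [smul_smul, Units.mul_inv, one_smul]
    rw [this]
    exact Submodule.smul_mem _ _ (Submodule.subset_span ⟨u, rfl⟩)
  have hv : Submodule.span A (Set.range v) = ⊤ := by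
    rw [eq_top_iff, ← KaehlerDifferential.span_range_derivation, Submodule.span_le]
    rintro _ ⟨a, rfl⟩
    rcases IsLocalRing.isUnit_or_isUnit_one_sub_self a with ha | ha
    · obtain ⟨u, rfl⟩ := ha
      exact hu u
    · obtain ⟨u, hu'⟩ := ha
      have h1 := hu u
      rw [hu', map_sub, Derivation.map_one_eq_zero, zero_sub] at h1
      simpa using Submodule.neg_mem _ h1
  have := Module.finitePresentation_of_projective A Ω[A⁄k]
  obtain ⟨κ, a, b, hb⟩ := Module.exists_basis_of_span_of_flat v hv
  have : Finite κ := Module.Finite.finite_basis b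
  obtain ⟨n, ⟨e⟩⟩ := Finite.exists_equiv_fin κ
  refine ⟨n, b.reindex e, fun l => a (e.symm l), fun l => ?_⟩
  rw [Module.Basis.reindex_apply, hb]

theorem IsLogBasis.map {k A K : Type*} [Field k] [CommRing A] [IsDomain A] [Algebra k A] [Field K]
    [Algebra k K] [Algebra A K] [IsScalarTower k A K] [IsFractionRing A K] {ι : Type*} [Fintype ι]
    [LinearOrder ι] {b : Module.Basis ι A Ω[A⁄k]} {x : ι → Aˣ} (h : IsLogBasis b x) :
    IsLogBasis (b.ofIsLocalizedModule K (nonZeroDivisors A) (KaehlerDifferential.map k k A K))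
      (fun l => Units.map (algebraMap A K).toMonoidHom (x l)) := by
  intro l
  rw [Module.Basis.ofIsLocalizedModule_apply, h l, map_smul, KaehlerDifferential.map_D,
    ← algebraMap_smul K]
  rfl

end LogBasis

/-! ### Constants are `p`-th powers. -/

section Constants

variable {k K : Type*} {p : ℕ} [Fact p.Prime] [Field k] [CharP k p] [PerfectField k] [Field K]
  [Algebra k K] {ι : Type*} [Fintype ι] [LinearOrder ι] {b : Module.Basis ι K Ω[K⁄k]} {x : ι → Kˣ}

/-- The subfield of `K` generated by the `p`-th powers and the elements `x`. -/
def powAdjoin (p : ℕ) [Fact p.Prime] (x : ι → Kˣ) : IntermediateField k K :=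
  (Algebra.adjoin k (Set.range (fun c : K => c ^ p) ∪ Set.range fun l => (x l : K))
    ).toIntermediateField fun z hz => by
      obtain ⟨q, hq⟩ := exists_prime_eq p
      have : z⁻¹ = z⁻¹ ^ p * z ^ (p - 1) := by
        by_cases h : z = 0
        · simp [h, (Fact.out : p.Prime).ne_zero]
        · obtain ⟨q, hq⟩ : ∃ q, p = q + 1 :=
            ⟨p - 1, (Nat.succ_pred_eq_of_pos (Fact.out : p.Prime).pos).symm⟩
          rw [hq, Nat.add_sub_cancel, pow_succ, mul_right_comm, ← mul_pow, inv_mul_cancel₀ h,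
            one_pow, one_mul]
      rw [this]
      exact mul_mem (Algebra.subset_adjoin (Or.inl ⟨z⁻¹, rfl⟩)) (pow_mem hz _)

/-- Over this subfield `K` is purely inseparable. It is also separable: its relative differentials
are spanned by the `b l`, and these vanish because the `x l` have become scalars. -/
theorem IsLogBasis.powAdjoin_eq_top [Algebra.EssFiniteType k K] (h : IsLogBasis b x) :
    powAdjoin (k := k) p x = ⊤ := by
  have : CharP K p := charP_of_algebra k K p
  have : CharP (powAdjoin (k := k) p x) p := charP_of_algebra k _ p
  have : ExpChar (powAdjoin (k := k) p x) p := ExpChar.prime Fact.out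
  have hpow : ∀ z : K, z ^ p ∈ powAdjoin (k := k) p x :=
    fun z => Algebra.subset_adjoin (Or.inl ⟨z, rfl⟩)
  have hxm : ∀ l, (x l : K) ∈ powAdjoin (k := k) p x :=
    fun l => Algebra.subset_adjoin (Or.inr ⟨l, rfl⟩)
  have hins : IsPurelyInseparable (powAdjoin (k := k) p x) K := by
    rw [isPurelyInseparable_iff_pow_mem _ p]
    exact fun z => ⟨1, ⟨z ^ p, hpow z⟩, by rw [pow_one]; rfl⟩
  have hess : Algebra.EssFiniteType (powAdjoin (k := k) p x) K :=
    Algebra.EssFiniteType.of_comp k _ K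
  have hsub : Subsingleton Ω[K⁄(powAdjoin (k := k) p x)] := by
    refine subsingleton_of_forall_eq 0 fun ω => ?_
    obtain ⟨ω, rfl⟩ := KaehlerDifferential.map_surjective_of_surjective k
      (powAdjoin (k := k) p x) K K Function.surjective_id ω
    have hz : (KaehlerDifferential.map k (powAdjoin (k := k) p x) K K) = 0 := by
      refine b.ext fun l => ?_
      rw [h l, map_smul, KaehlerDifferential.map_D, LinearMap.zero_apply]
      have : algebraMap K K (x l : K) = algebraMap (powAdjoin (k := k) p x) K ⟨_, hxm l⟩ := rfl
      rw [this, Derivation.map_algebraMap, smul_zero]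
    rw [hz, LinearMap.zero_apply]
  have hunr : Algebra.FormallyUnramified (powAdjoin (k := k) p x) K := ⟨hsub⟩
  have hsep : Algebra.IsSeparable (powAdjoin (k := k) p x) K :=
    Algebra.FormallyUnramified.isSeparable _ _
  rw [eq_top_iff]
  intro z _
  obtain ⟨y, rfl⟩ := IsPurelyInseparable.surjective_algebraMap_of_isSeparable
    (powAdjoin (k := k) p x) K z
  exact y.2

theorem coordEnd_pow_mul [CharP K p] (l : ι) (n : ℕ) (c z : K) :
    (coordEnd b l ^ n) (c ^ p * z) = c ^ p * (coordEnd b l ^ n) z := by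
  induction n with
  | zero => rfl
  | succ n ih =>
    rw [pow_succ', Module.End.mul_apply, ih, Module.End.mul_apply, coordEnd_apply,
      Derivation.leibniz, Derivation.leibniz_pow, ← Nat.cast_smul_eq_nsmul K, CharP.cast_eq_zero,
      zero_smul, smul_zero, add_zero]
    rfl

theorem IsLogBasis.coordDer_prod (h : IsLogBasis b x) (l : ι) (α : ι → ℕ) :
    coordDer b l (∏ m, (x m : K) ^ α m) = (α l : K) * ∏ m, (x m : K) ^ α m := by
  have : ∀ S : Finset ι, coordDer b l (∏ m ∈ S, (x m : K) ^ α m) =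
      (if l ∈ S then (α l : K) else 0) * ∏ m ∈ S, (x m : K) ^ α m := by
    intro S
    induction S using Finset.induction_on with
    | empty => simp
    | insert m S hm ih =>
      rw [Finset.prod_insert hm, Derivation.leibniz, ih, Derivation.leibniz_pow, h.coordDer_unit]
      by_cases hml : m = l
      · subst hml
        rw [if_pos rfl, if_neg hm, if_pos (Finset.mem_insert_self _ _)]
        cases hα : α m with
        | zero => simp
        | succ a =>
          simp only [zero_mul, Nat.add_sub_cancel, smul_eq_mul, nsmul_eq_mul]
          ring
      · rw [if_neg hml]
        simp only [Finset.mem_insert, Ne.symm hml, false_or, smul_eq_mul]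
        ring
  simpa using this Finset.univ

theorem IsLogBasis.coordEnd_pow_prod (h : IsLogBasis b x) (l : ι) (α : ι → ℕ) (n : ℕ) :
    (coordEnd b l ^ n) (∏ m, (x m : K) ^ α m) = (α l : K) ^ n * ∏ m, (x m : K) ^ α m := by
  induction n with
  | zero => simp
  | succ n ih =>
    rw [pow_succ, Module.End.mul_apply, coordEnd_apply, h.coordDer_prod, ← nsmul_eq_mul, map_nsmul,
      ih, nsmul_eq_mul, pow_succ']
    ring

/-- Each `coordEnd b l` multiplies the monomial by `α l`. By Fermat's little theorem `1 - (α
l)^(p-1)` is `1` or `0` according to whether `p` divides `α l`, so the surviving monomials are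
`p`-th powers. -/
theorem IsLogBasis.exists_constProj_monomial (h : IsLogBasis b x) (c : K) (α : ι → ℕ) :
    ∃ a, a ^ p = constProj p b Finset.univ.toList (c ^ p * ∏ m, (x m : K) ^ α m) := by
  have := charP_of_algebra k K p
  have hstep : ∀ l, coordProj p b l (c ^ p * ∏ m, (x m : K) ^ α m) =
      if p ∣ α l then c ^ p * ∏ m, (x m : K) ^ α m else 0 := by
    intro l
    rw [coordProj_apply, coordEnd_pow_mul, h.coordEnd_pow_prod]
    obtain ⟨q, hq⟩ := exists_prime_eq p
    split_ifs with hd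
    · rw [(CharP.cast_eq_zero_iff K p _).mpr hd, hq, pow_succ, mul_zero, zero_mul, mul_zero,
        sub_zero]
    · have h1 : ((α l : ℕ) : ZMod p) ^ (p - 1) = 1 :=
        ZMod.pow_card_sub_one_eq_one fun h0 => hd ((ZMod.natCast_eq_zero_iff _ _).mp h0)
      have h2 : ((α l : ℕ) : K) ^ (p - 1) = 1 := by
        have := congrArg (ZMod.castHom (dvd_refl p) K) h1
        simpa using this
      rw [h2, one_mul, sub_self]
  have hlist : ∀ L : List ι, constProj p b L (c ^ p * ∏ m, (x m : K) ^ α m) =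
      if ∀ l ∈ L, p ∣ α l then c ^ p * ∏ m, (x m : K) ^ α m else 0 := by
    intro L
    induction L with
    | nil => simp [constProj]
    | cons l L ih =>
      rw [constProj_cons, ih]
      by_cases hL : ∀ l ∈ L, p ∣ α l
      · rw [if_pos hL, hstep]
        by_cases hl : p ∣ α l
        · rw [if_pos hl, if_pos (by simpa using ⟨hl, hL⟩)]
        · rw [if_neg hl, if_neg (fun h => hl (h l (by simp)))]
      · rw [if_neg hL, map_zero, if_neg (fun h => hL fun m hm => h m (by simp [hm]))]
  rw [hlist]
  split_ifs with hα
  · refine ⟨c * ∏ m, (x m : K) ^ (α m / p), ?_⟩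
    rw [mul_pow, ← Finset.prod_pow]
    congr 1
    refine Finset.prod_congr rfl fun m _ => ?_
    rw [← pow_mul, Nat.div_mul_cancel (hα m (by simp))]
  · exact ⟨0, zero_pow (Fact.out : p.Prime).ne_zero⟩

/-- Over a perfect field, the constants of a finitely generated field extension are the `p`-th
powers. -/
theorem IsLogBasis.exists_pow_eq [Algebra.EssFiniteType k K] (h : IsLogBasis b x) {z : K}
    (hz : KaehlerDifferential.D k K z = 0) : ∃ c, c ^ p = z := by
  have := charP_of_algebra k K p
  rw [← constProj_of_D_eq_zero (p := p) (b := b) hz Finset.univ.toList]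
  have hmem : z ∈ powAdjoin (k := k) p x := h.powAdjoin_eq_top ▸ IntermediateField.mem_top
  change z ∈ Algebra.adjoin k _ at hmem
  rw [← Subalgebra.mem_toSubmodule, Algebra.adjoin_eq_span] at hmem
  clear hz
  induction hmem using Submodule.span_induction with
  | mem y hy =>
    obtain ⟨c, α, rfl⟩ : ∃ (c : K) (α : ι → ℕ), y = c ^ p * ∏ m, (x m : K) ^ α m := by
      induction hy using Submonoid.closure_induction with
      | mem y hy =>
        rcases hy with ⟨c, rfl⟩ | ⟨l, rfl⟩
        · exact ⟨c, 0, by simp⟩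
        · refine ⟨1, Pi.single l 1, ?_⟩
          rw [one_pow, one_mul, Finset.prod_eq_single l]
          · simp
          · intro m _ hm
            simp [hm]
          · simp
      | one => exact ⟨1, 0, by simp⟩
      | mul y y' _ _ hy hy' =>
        obtain ⟨c, α, rfl⟩ := hy
        obtain ⟨c', α', rfl⟩ := hy'
        refine ⟨c * c', α + α', ?_⟩
        simp only [Pi.add_apply, pow_add, Finset.prod_mul_distrib, mul_pow]
        ring
    exact h.exists_constProj_monomial c α
  | zero => exact ⟨0, by rw [map_zero, zero_pow (Fact.out : p.Prime).ne_zero]⟩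
  | add y y' _ _ hy hy' =>
    obtain ⟨c, hc⟩ := hy
    obtain ⟨c', hc'⟩ := hy'
    exact ⟨c + c', by rw [add_pow_char, hc, hc', map_add]⟩
  | smul t y _ hy =>
    obtain ⟨c, hc⟩ := hy
    have : PerfectRing k p := PerfectField.toPerfectRing p
    obtain ⟨u, hu⟩ := surjective_frobenius k p t
    refine ⟨u • c, ?_⟩
    rw [smul_pow, hc, map_smul, ← hu]
    rfl

/-- The root found in the fraction field is integral over `A`, hence lies in `A`. -/
theorem exists_pow_eq_of_D_eq_zero {k A : Type*} {p : ℕ} [Fact p.Prime] [Field k] [CharP k p]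
    [PerfectField k] [CommRing A] [IsDomain A] [IsIntegrallyClosed A] [Algebra k A]
    [Algebra.EssFiniteType k A] {ι : Type*} [Fintype ι] [LinearOrder ι]
    {b : Module.Basis ι A Ω[A⁄k]} {x : ι → Aˣ} (h : IsLogBasis b x) (a : A)
    (ha : KaehlerDifferential.D k A a = 0) : ∃ c, c ^ p = a := by
  have : Algebra.EssFiniteType A (FractionRing A) :=
    Algebra.EssFiniteType.of_isLocalization _ (nonZeroDivisors A)
  have : Algebra.EssFiniteType k (FractionRing A) := Algebra.EssFiniteType.comp k A _
  have hD : KaehlerDifferential.D k (FractionRing A) (algebraMap A _ a) = 0 := by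
    rw [← KaehlerDifferential.map_D k k A (FractionRing A), ha, map_zero]
  obtain ⟨c, hc⟩ := (h.map (K := FractionRing A)).exists_pow_eq (p := p) hD
  obtain ⟨c', rfl⟩ := IsIntegrallyClosed.exists_algebraMap_eq_of_isIntegral_pow
    (Fact.out : p.Prime).pos (show IsIntegral A (c ^ p) from hc ▸ isIntegral_algebraMap)
  refine ⟨c', IsFractionRing.injective A (FractionRing A) ?_⟩
  rw [map_pow, hc]

end Constants

/-! ### The Cartier operator on a local ring with free differentials. -/

section LocalCartier

variable {k A : Type*} {p : ℕ} [Fact p.Prime] [Field k] [CharP k p] [CommRing A] [IsDomain A]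
  [Algebra k A] [IsLocalRing A] [Module.Finite A Ω[A⁄k]] [Module.Free A Ω[A⁄k]]

theorem IsCartier.unique {ω η η' : Forms k A} (h : IsCartier p ω η) (h' : IsCartier p ω η') :
    η = η' := by
  obtain ⟨n, b, x, hb⟩ := exists_isLogBasis (k := k) (A := A)
  exact hb.isCartier_unique h h'

theorem IsCartier.mem_exteriorPower {ω η : Forms k A} (h : IsCartier p ω η) {i : ℕ}
    (hω : ω ∈ ⋀[A]^i Ω[A⁄k]) : η ∈ ⋀[A]^i Ω[A⁄k] := by
  obtain ⟨n, b, x, hb⟩ := exists_isLogBasis (k := k) (A := A)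
  exact hb.isCartier_mem h hω

theorem exists_isCartier [PerfectField k] [IsIntegrallyClosed A] [Algebra.EssFiniteType k A]
    {ω : Forms k A} (hω : extD k A ω = 0) : ∃ η, IsCartier p ω η := by
  obtain ⟨n, b, x, hb⟩ := exists_isLogBasis (k := k) (A := A)
  exact hb.exists_isCartier (exists_pow_eq_of_D_eq_zero hb) hω

end LocalCartier

/-! ### The exterior derivative and the grading. -/

section Degree

variable {k A : Type*} [CommRing k] [CommRing A] [Algebra k A]

theorem extD_mem {i : ℕ} {ω : Forms k A} (hω : ω ∈ ⋀[A]^i Ω[A⁄k]) :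
    extD k A ω ∈ ⋀[A]^(i + 1) Ω[A⁄k] := by
  induction i generalizing ω with
  | zero =>
    change ω ∈ LinearMap.range (ExteriorAlgebra.ι A) ^ 0 at hω
    change _ ∈ LinearMap.range (ExteriorAlgebra.ι A) ^ (0 + 1)
    rw [pow_zero, Submodule.mem_one] at hω
    obtain ⟨a, rfl⟩ := hω
    rw [extD_algebraMap, zero_add, pow_one]
    exact ⟨_, rfl⟩
  | succ i ih =>
    change ω ∈ LinearMap.range (ExteriorAlgebra.ι A) ^ (i + 1) at hω
    change _ ∈ LinearMap.range (ExteriorAlgebra.ι A) ^ (i + 1 + 1)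
    rw [pow_succ'] at hω
    induction hω using Submodule.mul_induction_on' with
    | mem_mul_mem x hx y hy =>
      obtain ⟨m, rfl⟩ := hx
      rw [extD_mul, sgn_ι]
      refine add_mem ?_ ?_
      · have h2 : extD k A (ExteriorAlgebra.ι A m) ∈ ⋀[A]^2 Ω[A⁄k] := by
          induction m using span_induction_forms with
          | hadd u v hu hv => rw [map_add, map_add]; exact add_mem hu hv
          | h0 => rw [map_zero, map_zero]; exact zero_mem _
          | hD a b =>
            rw [map_smul]
            change extD k A (a • dFun k b) ∈ LinearMap.range (ExteriorAlgebra.ι A) ^ 2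
            rw [extD_smul, extD_dFun, smul_zero, add_zero, pow_two]
            exact Submodule.mul_mem_mul ⟨_, rfl⟩ ⟨_, rfl⟩
        rw [add_assoc, add_comm i, pow_add]
        exact Submodule.mul_mem_mul h2 hy
      · rw [pow_succ', neg_mul]
        exact neg_mem (Submodule.mul_mem_mul ⟨_, rfl⟩ (ih hy))
    | add x _ y _ hx hy => rw [map_add]; exact add_mem hx hy

theorem decompose_extD (τ : Forms k A) :
    (∀ i, (DirectSum.decompose (fun n => ⋀[A]^n Ω[A⁄k]) (extD k A τ) (i + 1) : Forms k A) =
      extD k A (DirectSum.decompose (fun n => ⋀[A]^n Ω[A⁄k]) τ i : Forms k A)) ∧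
    (DirectSum.decompose (fun n => ⋀[A]^n Ω[A⁄k]) (extD k A τ) 0 : Forms k A) = 0 := by
  induction τ using DirectSum.Decomposition.inductionOn fun n => ⋀[A]^n Ω[A⁄k] with
  | zero => simp
  | @homogeneous j τ =>
    refine ⟨fun i => ?_, ?_⟩
    · by_cases h : j = i
      · subst h
        rw [DirectSum.decompose_of_mem_same (fun n => ⋀[A]^n Ω[A⁄k]) (extD_mem τ.2),
          DirectSum.decompose_of_mem_same (fun n => ⋀[A]^n Ω[A⁄k]) τ.2]
      · rw [DirectSum.decompose_of_mem_ne (fun n => ⋀[A]^n Ω[A⁄k]) (extD_mem τ.2)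
          (by omega), DirectSum.decompose_of_mem_ne (fun n => ⋀[A]^n Ω[A⁄k]) τ.2 h, map_zero]
    · exact DirectSum.decompose_of_mem_ne (fun n => ⋀[A]^n Ω[A⁄k]) (extD_mem τ.2) (by omega)
  | add x y hx hy =>
    refine ⟨fun i => ?_, ?_⟩
    · rw [map_add, DirectSum.decompose_add, DirectSum.add_apply, Submodule.coe_add, hx.1, hy.1,
        DirectSum.decompose_add, DirectSum.add_apply, Submodule.coe_add, map_add]
    · rw [map_add, DirectSum.decompose_add, DirectSum.add_apply, Submodule.coe_add, hx.2, hy.2,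
        add_zero]

/-- An exact form of degree `i + 1` has a primitive of degree `i`. -/
theorem exists_extD_eq_of_mem {i : ℕ} {τ : Forms k A}
    (hτ : extD k A τ ∈ ⋀[A]^(i + 1) Ω[A⁄k]) :
    ∃ τ' ∈ ⋀[A]^i Ω[A⁄k], extD k A τ' = extD k A τ :=
  ⟨DirectSum.decompose (fun n => ⋀[A]^n Ω[A⁄k]) τ i, Subtype.coe_prop _, by
    rw [← (decompose_extD τ).1, DirectSum.decompose_of_mem_same (fun n => ⋀[A]^n Ω[A⁄k]) hτ]⟩

theorem extD_eq_zero_of_mem_zero {τ : Forms k A}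
    (hτ : extD k A τ ∈ ⋀[A]^0 Ω[A⁄k]) : extD k A τ = 0 := by
  rw [← DirectSum.decompose_of_mem_same (fun n => ⋀[A]^n Ω[A⁄k]) hτ, (decompose_extD τ).2]

end Degree


/-! ### Colon primes, normality, and finiteness of Frobenius. -/

section Algebra

/-- Take an associated prime of the cyclic module generated by `b` in `M / N`. This reduces
membership in `N` to a question at one prime. -/
theorem exists_prime_colon {R M : Type*} [CommRing R] [IsNoetherianRing R] [AddCommGroup M]
    [Module R M] (N : Submodule R M) {b : M} (hb : b ∉ N) :
    ∃ (r : R) (P : PrimeSpectrum R), ∀ s : R, s • r • b ∈ N ↔ s ∈ P.asIdeal := by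
  let S : Submodule R (M ⧸ N) := Submodule.span R {N.mkQ b}
  have hnt : Nontrivial S := by
    refine ⟨⟨N.mkQ b, Submodule.mem_span_singleton_self _⟩, 0, fun h => hb ?_⟩
    have h' : N.mkQ b = 0 := congrArg Subtype.val h
    simpa using h'
  obtain ⟨I, hI⟩ := associatedPrimes.nonempty R S
  rw [AssociatedPrimes.mem_iff, isAssociatedPrime_iff] at hI
  obtain ⟨hIp, ⟨x, hx⟩, hcol⟩ := hI
  obtain ⟨r, rfl⟩ := Submodule.mem_span_singleton.mp hx
  refine ⟨r, ⟨I, hIp⟩, fun s => ?_⟩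
  change _ ↔ s ∈ I
  rw [hcol, Submodule.mem_colon_singleton, Submodule.mem_bot, Subtype.ext_iff]
  change _ ↔ s • r • N.mkQ b = 0
  rw [← map_smul, ← map_smul, Submodule.mkQ_apply, Submodule.Quotient.mk_eq_zero]

/-- A rational function on a normal noetherian scheme that is regular in codimension one is
regular. -/
theorem exists_algebraMap_eq_of_height_le_one {R K : Type*} [CommRing R] [IsDomain R]
    [IsNoetherianRing R] [IsIntegrallyClosed R] [Field K] [Algebra R K] [IsFractionRing R K]
    {φ : K} (h : ∀ q : PrimeSpectrum R, q.asIdeal.height ≤ 1 →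
      ∃ s ∉ q.asIdeal, ∃ r, s • φ = algebraMap R K r) : ∃ r, φ = algebraMap R K r := by
  by_contra hφ
  obtain ⟨r₀, P, hP⟩ := exists_prime_colon (LinearMap.range (Algebra.linearMap R K))
    (b := φ) (fun ⟨r, hr⟩ => hφ ⟨r, hr.symm⟩)
  set ψ : K := r₀ • φ with hψ
  have hψR : ∀ r, ψ ≠ algebraMap R K r := by
    intro r hr
    have : (1 : R) ∈ P.asIdeal := (hP 1).mp ⟨r, by rw [one_smul, hr]; rfl⟩
    exact P.isPrime.ne_top ((Ideal.eq_top_iff_one _).mpr this)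
  have hht : ¬ P.asIdeal.height ≤ 1 := by
    intro hle
    obtain ⟨s, hs, r, hr⟩ := h P hle
    refine hs ((hP s).mp ⟨r₀ * r, ?_⟩)
    rw [smul_comm, hr, Algebra.linearMap_apply, map_mul, Algebra.smul_def]
  -- If `ψ` maps `P` into itself, it is integral and hence lies in `R`. Otherwise `xψ = u` with `u ∉
  -- P` for some `x ∈ P`, and `P` is minimal over `x`, so Krull's theorem bounds its height by one.
  by_cases hst : ∀ x ∈ P.asIdeal, ∃ y ∈ P.asIdeal, x • ψ = algebraMap R K y
  · let N : Submodule R K := Submodule.map (Algebra.linearMap R K) P.asIdeal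
    have hN : N ≠ ⊥ := by
      intro hbot
      apply hht
      have : P.asIdeal = ⊥ := by
        rw [eq_bot_iff]
        intro x hx
        have : algebraMap R K x ∈ N := ⟨x, hx, rfl⟩
        rw [hbot, Submodule.mem_bot, map_eq_zero_iff _ (IsFractionRing.injective R K)] at this
        exact this
      rw [this, Ideal.height_bot]
      exact zero_le
    have hfg : N.FG := (IsNoetherian.noetherian P.asIdeal).map _
    have hint : IsIntegral R ψ := isIntegral_of_smul_mem_submodule N hN hfg ψ (by
      rintro _ ⟨x, hx, rfl⟩
      obtain ⟨y, hy, e⟩ := hst x hx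
      refine ⟨y, hy, ?_⟩
      rw [Algebra.linearMap_apply, Algebra.linearMap_apply, ← e, Algebra.smul_def, smul_eq_mul,
        mul_comm])
    obtain ⟨r, hr⟩ := IsIntegrallyClosed.isIntegral_iff.mp hint
    exact hψR r hr.symm
  · push Not at hst
    obtain ⟨x, hx, hxu⟩ := hst
    obtain ⟨u, hu⟩ := (hP x).mpr hx
    have hu' : u ∉ P.asIdeal := fun hmem => hxu u hmem hu.symm
    refine hht (Ideal.height_le_one_of_isPrincipal_of_mem_minimalPrimes (Ideal.span {x}) P.asIdeal
      ⟨⟨P.isPrime, (Ideal.span_singleton_le_iff_mem _).mpr hx⟩, fun Q hQ hQP y hy => ?_⟩)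
    obtain ⟨v, hv⟩ := (hP y).mpr hy
    have hyu : y * u = x * v := by
      apply IsFractionRing.injective R K
      rw [Algebra.linearMap_apply] at hu hv
      rw [map_mul, map_mul, hu, hv, Algebra.smul_def, Algebra.smul_def y]
      ring
    have hxQ : x ∈ Q := hQ.2 (Ideal.mem_span_singleton_self x)
    have : y * u ∈ Q := hyu ▸ Ideal.mul_mem_right _ _ hxQ
    exact (hQ.1.mem_or_mem this).resolve_right fun h => hu' (hQP h)

/-- Frobenius is integral because each `x` is a root of `T^p - x^p`. It is of finite type because it
is semilinear over the Frobenius of `k`, which is surjective. -/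
theorem frob_finite (k R : Type*) (p : ℕ) [Fact p.Prime] [Field k] [CharP k p] [PerfectField k]
    [CommRing R] [Nontrivial R] [Algebra k R] [Algebra.FiniteType k R] :
    (frob k R p 1).Finite := by
  have : PerfectRing k p := PerfectField.toPerfectRing p
  refine RingHom.IsIntegral.to_finite (fun x => ?_) ?_
  · refine ⟨Polynomial.X ^ p - Polynomial.C x, Polynomial.monic_X_pow_sub_C x
      (Fact.out : p.Prime).ne_zero, ?_⟩
    simp
  · have h : (frob k R p 1).comp (algebraMap k R) = (algebraMap k R).comp (frobenius k p) := by
      ext a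
      simp [frobenius_def]
    refine RingHom.FiniteType.of_comp_finiteType (f := algebraMap k R) ?_
    rw [h]
    exact (RingHom.finiteType_algebraMap.mpr inferInstance).comp
      (RingHom.FiniteType.of_surjective _ (surjective_frobenius k p))

/-- The elements `e (s • v i)` generate, where `s` runs over generators of `R` as a module over
itself through `F` and the `v i` generate `M`. -/
theorem finite_of_semilinear {R M M' : Type*} [CommRing R] [AddCommGroup M] [Module R M]
    [AddCommGroup M'] [Module R M'] [Module.Finite R M] {F : R →+* R} (hF : F.Finite) (e : M ≃+ M')
    (he : ∀ (r : R) (m : M), e (F r • m) = r • e m) : Module.Finite R M' := by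
  obtain ⟨n, v, hv⟩ := Module.Finite.exists_fin (R := R) (M := M)
  obtain ⟨S, hS⟩ := hF
  let T : Submodule R M' :=
    Submodule.span R ((fun x : R × Fin n => e (x.1 • v x.2)) '' ((S : Set R) ×ˢ Set.univ))
  have hT : ∀ (i : Fin n) (r : R), e (r • v i) ∈ T := by
    intro i r
    have hr : r ∈ @Submodule.span R R _ _ F.toAlgebra.toModule (S : Set R) := by
      rw [hS]; trivial
    induction hr using Submodule.span_induction with
    | mem x hx => exact Submodule.subset_span ⟨(x, i), ⟨hx, trivial⟩, rfl⟩
    | zero => rw [zero_smul, map_zero]; exact zero_mem _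
    | add x y _ _ hx hy => rw [add_smul, map_add]; exact add_mem hx hy
    | smul a x _ hx =>
      have : e ((F a * x) • v i) ∈ T := by
        rw [mul_smul, he]
        exact Submodule.smul_mem _ _ hx
      exact this
  have hfg : T.FG := Submodule.fg_span ((S.finite_toSet.prod Set.finite_univ).image _)
  have htop : T = ⊤ := by
    rw [eq_top_iff]
    intro m' _
    obtain ⟨m, rfl⟩ := e.surjective m'
    have hm : m ∈ Submodule.span R (Set.range v) := hv ▸ Submodule.mem_top
    induction hm using Submodule.closure_induction with
    | zero => rw [map_zero]; exact zero_mem _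
    | add x y _ _ hx hy => rw [map_add]; exact add_mem (hx trivial) (hy trivial)
    | smul_mem r x hx => obtain ⟨i, rfl⟩ := hx; exact hT i r
  exact ⟨htop ▸ hfg⟩

end Algebra

/-! ### Functoriality of the exterior derivative. -/

section Pullback

variable {k A B : Type*} [CommRing k] [CommRing A] [CommRing B] [Algebra k A] [Algebra k B]
  [Algebra A B] [IsScalarTower k A B]

theorem pullback_dFun (a : A) : pullback k A B (dFun k a) = dFun k (algebraMap A B a) := by
  rw [dFun, pullback_ι, KaehlerDifferential.map_D]; rfl

theorem pullback_algebraMap (a : A) :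
    pullback k A B (algebraMap A _ a) = algebraMap B _ (algebraMap A B a) := by
  rw [AlgHom.commutes]
  exact IsScalarTower.algebraMap_apply A B (Forms k B) a

theorem pullback_sgn (ω : Forms k A) : pullback k A B (sgn ω) = sgn (pullback k A B ω) := by
  induction ω using forms_induction with
  | hA a => rw [AlgHom.commutes, pullback_algebraMap, AlgHom.commutes]
  | hd a => rw [sgn_dFun, map_neg, pullback_dFun, sgn_dFun]
  | hmul x y hx hy => rw [map_mul, map_mul, map_mul, map_mul, hx, hy]
  | hadd x y hx hy => rw [map_add, map_add, map_add, map_add, hx, hy]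

theorem pullback_extD (ω : Forms k A) :
    pullback k A B (extD k A ω) = extD k B (pullback k A B ω) := by
  induction ω using forms_induction with
  | hA a => rw [extD_algebraMap, pullback_dFun, pullback_algebraMap, extD_algebraMap]
  | hd a => rw [extD_dFun, map_zero, pullback_dFun, extD_dFun]
  | hmul x y hx hy =>
    rw [extD_mul, map_add, map_mul, map_mul, hx, hy, map_mul, extD_mul, pullback_sgn]
  | hadd x y hx hy => rw [map_add, map_add, map_add, map_add, hx, hy]

end Pullback

/-! ### Functoriality of the Cartier operator. -/

section PullbackCartier

variable {k A B : Type*} {p : ℕ} [Fact p.Prime] [Field k] [CharP k p] [CommRing A] [Nontrivial A]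
  [CommRing B] [Nontrivial B] [Algebra k A] [Algebra k B] [Algebra A B] [IsScalarTower k A B]

theorem isCartier_algebraMap (a : A) :
    IsCartier p (algebraMap A (Forms k A) (a ^ p)) (algebraMap A _ a) := by
  have := (isCartier_one (k := k) (A := A) (p := p)).pow_smul a
  rwa [← Algebra.algebraMap_eq_smul_one, ← Algebra.algebraMap_eq_smul_one] at this

/-- On the generators `a` and `da` there are explicit lifts that pull back to lifts. Any other lift
differs by an exact form, which gives `IsCartier.pullback`. -/
theorem exists_isCartier_pullback (η : Forms k A) :
    ∃ ω, IsCartier p ω η ∧ IsCartier p (pullback k A B ω) (pullback k A B η) := by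
  induction η using forms_induction with
  | hA a =>
    refine ⟨_, isCartier_algebraMap a, ?_⟩
    rw [pullback_algebraMap, pullback_algebraMap, map_pow]
    exact isCartier_algebraMap _
  | hd a =>
    refine ⟨_, isCartier_dFun a, ?_⟩
    rw [map_smul, pullback_dFun, ← algebraMap_smul B, map_pow]
    exact isCartier_dFun _
  | hmul x y hx hy =>
    obtain ⟨x', h1, h2⟩ := hx
    obtain ⟨y', h3, h4⟩ := hy
    exact ⟨x' * y', h1.mul h3, by rw [map_mul, map_mul]; exact h2.mul h4⟩
  | hadd x y hx hy =>
    obtain ⟨x', h1, h2⟩ := hx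
    obtain ⟨y', h3, h4⟩ := hy
    exact ⟨x' + y', h1.add h3, by rw [map_add, map_add]; exact h2.add h4⟩

theorem IsCartier.pullback {ω η : Forms k A} (h : IsCartier p ω η) :
    IsCartier p (pullback k A B ω) (HigherF.pullback k A B η) := by
  obtain ⟨ω₀, h0, h1⟩ := exists_isCartier_pullback (p := p) (B := B) η
  obtain ⟨τ, hτ⟩ := h.exists_extD_eq_sub h0
  have := h1.add_extD (HigherF.pullback k A B τ)
  rw [← pullback_extD, hτ, map_sub, add_sub_cancel] at this
  exact this

theorem IsCartierIter.pullback {n : ℕ} {ω η : Forms k A} (h : IsCartierIter p n ω η) :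
    IsCartierIter p n (pullback k A B ω) (HigherF.pullback k A B η) := by
  induction n generalizing ω with
  | zero => exact congrArg _ h
  | succ n ih =>
    obtain ⟨ζ, h1, h2⟩ := h
    exact ⟨_, h1.pullback, ih h2⟩

theorem IsCartierIter.comp {m n : ℕ} {ω ζ η : Forms k A} (h : IsCartierIter p m ω ζ)
    (h' : IsCartierIter p n ζ η) : IsCartierIter p (m + n) ω η := by
  induction m generalizing ω with
  | zero => obtain rfl := h; rwa [zero_add]
  | succ m ih =>
    obtain ⟨ξ, h1, h2⟩ := h
    rw [add_right_comm]
    exact ⟨ξ, h1, ih h2⟩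

end PullbackCartier


/-! ### Reflexive forms viewed inside rational forms. -/

section ReflexiveForms

variable {k R : Type*} {p : ℕ} [Fact p.Prime] [Field k] [CharP k p] [CommRing R] [IsDomain R]
  [Algebra k R] [Algebra.FiniteType k R]

theorem free_kaehler_stalk {q : PrimeSpectrum R} (hq : q ∈ Algebra.smoothLocus k R) :
    Module.Free (Stalk q) Ω[Stalk q⁄k] := by
  have : Algebra.FormallySmooth k (Stalk q) := hq
  exact Module.free_of_flat_of_isLocalRing

theorem isIntegrallyClosed_stalk [IsIntegrallyClosed R] (q : PrimeSpectrum R) :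
    IsIntegrallyClosed (Stalk q) :=
  isIntegrallyClosed_of_isLocalization _ q.asIdeal.primeCompl
    q.asIdeal.primeCompl_le_nonZeroDivisors

theorem extD_mem_reflForms {i : ℕ} {ω : RatForms k R} (hω : ω ∈ reflForms k R i) :
    extD k _ ω ∈ reflForms k R (i + 1) := fun q hq => by
  obtain ⟨ω', h, rfl⟩ := hω q hq
  exact ⟨extD k _ ω', extD_mem h, pullback_extD ω'⟩

theorem mul_mem_reflForms {i j : ℕ} {ω ω' : RatForms k R} (hω : ω ∈ reflForms k R i)
    (hω' : ω' ∈ reflForms k R j) : ω * ω' ∈ reflForms k R (i + j) := fun q hq => by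
  obtain ⟨ω₁, h, rfl⟩ := hω q hq
  obtain ⟨ω₂, h', rfl⟩ := hω' q hq
  refine ⟨ω₁ * ω₂, ?_, map_mul _ _ _⟩
  change _ ∈ LinearMap.range (ExteriorAlgebra.ι (Stalk q)) ^ (i + j)
  rw [pow_add]
  exact Submodule.mul_mem_mul h h'

theorem algebraMap_mem_reflForms (r : R) : algebraMap R (RatForms k R) r ∈ reflForms k R 0 :=
  fun q _ => by
    refine ⟨algebraMap _ _ (algebraMap R (Stalk q) r), ?_, ?_⟩
    · change _ ∈ LinearMap.range (ExteriorAlgebra.ι (Stalk q)) ^ 0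
      rw [pow_zero, Submodule.mem_one]
      exact ⟨_, rfl⟩
    · rw [AlgHom.commutes]
      exact (IsScalarTower.algebraMap_apply R (Stalk q) (RatForms k R) r).symm

theorem dFun_mem_reflForms (r : R) :
    dFun k (algebraMap R (FractionRing R) r) ∈ reflForms k R 1 := fun q _ => by
  refine ⟨dFun k (algebraMap R (Stalk q) r), ?_, ?_⟩
  · change _ ∈ LinearMap.range (ExteriorAlgebra.ι (Stalk q)) ^ 1
    rw [pow_one]
    exact ⟨_, rfl⟩
  · rw [pullback_dFun, ← IsScalarTower.algebraMap_apply]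

theorem extD_eq_zero_of_germToRat {q : PrimeSpectrum R} (hq : q ∈ Algebra.smoothLocus k R)
    {ω : Forms k (Stalk q)} (h : extD k _ (germToRat k q ω) = 0) : extD k _ ω = 0 := by
  rw [← pullback_extD] at h
  exact germToRat_injective hq (h.trans (map_zero _).symm)

/-- At a smooth point a germ that is rationally closed is closed, so `C` can be applied in the
stalk; uniqueness of `C` on rational forms identifies the result with the given one. -/
theorem exists_isCartierIter_germ [PerfectField k] [IsIntegrallyClosed R] {q : PrimeSpectrum R}
    (hq : q ∈ Algebra.smoothLocus k R) {n i : ℕ} {ω : Forms k (Stalk q)} {η : RatForms k R}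
    (hω : ω ∈ ⋀[Stalk q]^i Ω[Stalk q⁄k]) (h : IsCartierIter p n (germToRat k q ω) η) :
    ∃ η' ∈ ⋀[Stalk q]^i Ω[Stalk q⁄k], germToRat k q η' = η ∧ IsCartierIter p n ω η' := by
  have := free_kaehler_stalk hq
  have := isIntegrallyClosed_stalk q
  induction n generalizing ω with
  | zero => exact ⟨ω, hω, h, rfl⟩
  | succ n ih =>
    obtain ⟨ζ, h1, h2⟩ := h
    obtain ⟨ζ', hζ'⟩ := exists_isCartier (p := p) (extD_eq_zero_of_germToRat hq h1.1)
    obtain rfl : germToRat k q ζ' = ζ := hζ'.pullback.unique h1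
    obtain ⟨η', h3, h4, h5⟩ := ih (hζ'.mem_exteriorPower hω) h2
    exact ⟨η', h3, h4, ζ', hζ', h5⟩

theorem IsCartierIter.mem_reflForms [PerfectField k] [IsIntegrallyClosed R] {n i : ℕ}
    {ω η : RatForms k R} (h : IsCartierIter p n ω η) (hω : ω ∈ reflForms k R i) :
    η ∈ reflForms k R i := fun q hq => by
  obtain ⟨ω', h1, rfl⟩ := hω q hq
  obtain ⟨η', h2, h3, -⟩ := exists_isCartierIter_germ hq h1 h
  exact ⟨η', h2, h3⟩

/-- Once `ω` is reflexive, the Cartier condition can be checked generically. The point `q₀` only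
witnesses that the smooth locus is nonempty. -/
theorem isReflCartier_iff [PerfectField k] [IsIntegrallyClosed R] {q₀ : PrimeSpectrum R}
    (hq₀ : q₀ ∈ Algebra.smoothLocus k R) {n i : ℕ} {ω η : RatForms k R} :
    IsReflCartier k R p n i ω η ↔ ω ∈ reflForms k R i ∧ IsCartierIter p n ω η := by
  refine ⟨fun h => ⟨h.mem_left, ?_⟩, fun ⟨hω, h⟩ q hq => ?_⟩
  · obtain ⟨ω', -, η', -, rfl, rfl, h'⟩ := h q₀ hq₀
    exact h'.pullback
  · obtain ⟨ω', h1, rfl⟩ := hω q hq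
    obtain ⟨η', h2, h3, h4⟩ := exists_isCartierIter_germ hq h1 h
    exact ⟨ω', h1, η', h2, rfl, h3, h4⟩

theorem mem_reflB_iff [PerfectField k] [IsIntegrallyClosed R] {q₀ : PrimeSpectrum R}
    (hq₀ : q₀ ∈ Algebra.smoothLocus k R) {n i : ℕ} {ω : RatForms k R} :
    FPush.of k p n _ ω ∈ reflB k R p n i ↔ ω ∈ reflForms k R i ∧ IsCartierIter p n ω 0 := by
  rw [← isReflCartier_iff hq₀]
  refine ⟨fun h q hq => ?_, fun h q hq => ?_⟩
  · obtain ⟨ω', h1, h2, h3⟩ := h q hq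
    exact ⟨ω', h1, 0, zero_mem _, h2, map_zero _, h3⟩
  · obtain ⟨ω', h1, η', h2, h3, h4, h5⟩ := h q hq
    obtain rfl := germToRat_injective hq (h4.trans (map_zero _).symm)
    exact ⟨ω', h1, congrArg _ h3, h5⟩

variable (k R) in
/-- The image in rational forms of the one-forms on `Spec R`. -/
def oneFormsImage : Submodule R (RatForms k R) :=
  LinearMap.range (((ExteriorAlgebra.ι (FractionRing R)).restrictScalars R) ∘ₗ
    KaehlerDifferential.map k k R (FractionRing R))

theorem oneFormsImage_fg : (oneFormsImage k R).FG := by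
  rw [oneFormsImage, LinearMap.range_eq_map]
  exact (Module.Finite.fg_top).map _

theorem dFun_mem_oneFormsImage (r : R) :
    dFun k (algebraMap R (FractionRing R) r) ∈ oneFormsImage k R :=
  ⟨KaehlerDifferential.D k R r, by
    rw [LinearMap.comp_apply, KaehlerDifferential.map_D]; rfl⟩

theorem oneFormsImage_le : oneFormsImage k R ≤ reflForms k R 1 := by
  rintro _ ⟨m, rfl⟩
  induction m using span_induction_forms with
  | hadd x y hx hy => rw [map_add]; exact add_mem hx hy
  | h0 => rw [map_zero]; exact zero_mem _
  | hD a b =>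
    rw [map_smul]
    refine Submodule.smul_mem _ _ ?_
    rw [LinearMap.comp_apply, KaehlerDifferential.map_D]
    exact dFun_mem_reflForms b

theorem oneFormsImage_pow_le (i : ℕ) : oneFormsImage k R ^ i ≤ reflForms k R i := by
  induction i with
  | zero =>
    rw [pow_zero]
    intro x hx
    obtain ⟨r, rfl⟩ := Submodule.mem_one.mp hx
    exact algebraMap_mem_reflForms r
  | succ i ih =>
    rw [pow_succ, Submodule.mul_le]
    exact fun x hx y hy => mul_mem_reflForms (ih hx) (oneFormsImage_le hy)

/-- Clearing denominators of a germ of a form. -/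
theorem exists_smul_germToRat_mem (q : PrimeSpectrum R) {i : ℕ} {ω : Forms k (Stalk q)}
    (hω : ω ∈ ⋀[Stalk q]^i Ω[Stalk q⁄k]) :
    ∃ s ∉ q.asIdeal, s • germToRat k q ω ∈ oneFormsImage k R ^ i := by
  have hmul : ∀ {s t : R}, s ∉ q.asIdeal → t ∉ q.asIdeal → s * t ∉ q.asIdeal :=
    fun hs ht h => (q.isPrime.mem_or_mem h).elim hs ht
  have hadd : ∀ (N : Submodule R (RatForms k R)) (x y : RatForms k R),
      (∃ s ∉ q.asIdeal, s • x ∈ N) → (∃ s ∉ q.asIdeal, s • y ∈ N) →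
        ∃ s ∉ q.asIdeal, s • (x + y) ∈ N := by
    rintro N x y ⟨s, hs, hx⟩ ⟨t, ht, hy⟩
    refine ⟨s * t, hmul hs ht, ?_⟩
    rw [smul_add]
    refine add_mem ?_ ?_
    · rw [mul_comm, mul_smul]; exact N.smul_mem t hx
    · rw [mul_smul]; exact N.smul_mem s hy
  have hfrac : ∀ a : Stalk q, ∃ s ∉ q.asIdeal, ∃ r, s • a = algebraMap R (Stalk q) r := by
    intro a
    obtain ⟨⟨r, s⟩, hrs⟩ := IsLocalization.surj q.asIdeal.primeCompl a
    exact ⟨s, s.2, r, by rw [Algebra.smul_def, mul_comm]; exact hrs⟩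
  induction i generalizing ω with
  | zero =>
    change ω ∈ LinearMap.range (ExteriorAlgebra.ι (Stalk q)) ^ 0 at hω
    rw [pow_zero, Submodule.mem_one] at hω
    obtain ⟨a, rfl⟩ := hω
    obtain ⟨s, hs, r, hr⟩ := hfrac a
    refine ⟨s, hs, ?_⟩
    rw [AlgHom.commutes, pow_zero, Submodule.mem_one]
    refine ⟨r, ?_⟩
    rw [IsScalarTower.algebraMap_apply R (Stalk q) (RatForms k R), ← hr, Algebra.smul_def s a,
      map_mul, ← IsScalarTower.algebraMap_apply, ← Algebra.smul_def]
  | succ i ih =>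
    change ω ∈ LinearMap.range (ExteriorAlgebra.ι (Stalk q)) ^ (i + 1) at hω
    rw [pow_succ'] at hω
    induction hω using Submodule.mul_induction_on' with
    | mem_mul_mem x hx y hy =>
      obtain ⟨m, rfl⟩ := hx
      obtain ⟨t, ht, hty⟩ := ih hy
      have h1 : ∃ s ∉ q.asIdeal,
          s • germToRat k q (ExteriorAlgebra.ι _ m) ∈ oneFormsImage k R := by
        induction m using span_induction_forms with
        | hadd u v hu hv => rw [map_add, map_add]; exact hadd _ _ _ hu hv
        | h0 =>
          refine ⟨1, fun h => q.isPrime.ne_top ((Ideal.eq_top_iff_one _).mpr h), ?_⟩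
          rw [map_zero, map_zero, smul_zero]
          exact zero_mem _
        | hD a c =>
          obtain ⟨s, hs, r, hr⟩ := hfrac a
          obtain ⟨s', hs', r', hr'⟩ := hfrac c
          have e1 : dFun k (algebraMap R (Stalk q) r') =
              s' • dFun k c + c • dFun k (algebraMap R (Stalk q) s') := by
            rw [← hr', Algebra.smul_def, dFun_mul, algebraMap_smul]
          -- The quotient rule for `c = r' / s'`, cleared of denominators.
          have e2 : (s' * s') • dFun k c = s' • dFun k (algebraMap R (Stalk q) r') -
              r' • dFun k (algebraMap R (Stalk q) s') := by
            rw [e1, ← algebraMap_smul (Stalk q) r', ← hr', smul_add, mul_smul, smul_assoc]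
            abel
          have e3 : (s * (s' * s')) • a • dFun k c =
              (r * s') • dFun k (algebraMap R (Stalk q) r') -
                (r * r') • dFun k (algebraMap R (Stalk q) s') := by
            rw [mul_smul, smul_comm (s' * s') a, e2, ← smul_assoc, hr, algebraMap_smul, smul_sub,
              mul_smul, mul_smul]
          refine ⟨s * (s' * s'), hmul hs (hmul hs' hs'), ?_⟩
          have e4 : ExteriorAlgebra.ι (Stalk q) (a • KaehlerDifferential.D k (Stalk q) c) =
              a • dFun k c := by rw [map_smul]; rfl
          have e5 : ∀ (t : R) (z : Forms k (Stalk q)),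
              t • germToRat k q z = germToRat k q (t • z) := fun t z => by
            rw [← algebraMap_smul (Stalk q) t z, map_smul, algebraMap_smul]
          rw [e5, e4, e3, map_sub, ← e5, ← e5, pullback_dFun, pullback_dFun,
            ← IsScalarTower.algebraMap_apply, ← IsScalarTower.algebraMap_apply]
          exact sub_mem (Submodule.smul_mem _ _ (dFun_mem_oneFormsImage r'))
            (Submodule.smul_mem _ _ (dFun_mem_oneFormsImage s'))
      obtain ⟨s, hs, hsx⟩ := h1
      refine ⟨s * t, hmul hs ht, ?_⟩
      rw [map_mul, pow_succ', mul_smul, ← mul_smul_comm, ← smul_mul_assoc]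
      exact Submodule.mul_mem_mul hsx hty
    | add x _ y _ hx hy => rw [map_add]; exact hadd _ _ _ hx hy

theorem exists_ne_zero_smul_mem_range {M : Submodule R (FractionRing R)} (hM : M.FG) :
    ∃ N : R, N ≠ 0 ∧ ∀ x ∈ M, ∃ r, N • x = algebraMap R (FractionRing R) r := by
  obtain ⟨S, rfl⟩ := hM
  obtain ⟨N, hN⟩ := IsLocalization.exist_integer_multiples_of_finset (nonZeroDivisors R) S
  refine ⟨N, nonZeroDivisors.coe_ne_zero N, fun x hx => ?_⟩
  induction hx using Submodule.span_induction with
  | mem x hx => obtain ⟨r, hr⟩ := hN x hx; exact ⟨r, hr.symm⟩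
  | zero => exact ⟨0, by simp⟩
  | add x y _ _ hx hy =>
    obtain ⟨a, ha⟩ := hx
    obtain ⟨b, hb⟩ := hy
    exact ⟨a + b, by rw [smul_add, ha, hb, map_add]⟩
  | smul r x _ hx =>
    obtain ⟨a, ha⟩ := hx
    exact ⟨r * a, by rw [smul_comm, ha, map_mul, Algebra.smul_def]⟩

/-- The module of reflexive forms is finitely generated. -/
theorem finite_reflForms [IsIntegrallyClosed R]
    (hsm : ∀ q : PrimeSpectrum R, q.asIdeal.height ≤ 1 → q ∈ Algebra.smoothLocus k R) (i : ℕ) :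
    Module.Finite R (reflForms k R i) := by
  have hnoeth : IsNoetherianRing R := Algebra.FiniteType.isNoetherianRing k R
  let b := Module.finBasis (FractionRing R) Ω[FractionRing R⁄k]
  let E := b.ExteriorAlgebra
  have key : ∀ s, ∃ N : R, N ≠ 0 ∧ ∀ ω ∈ reflForms k R i, ∃ r,
      N • E.repr ω s = algebraMap R (FractionRing R) r := by
    intro s
    let c : RatForms k R →ₗ[R] FractionRing R := (E.coord s).restrictScalars R
    -- One `N` clears the denominators of this coordinate on a finitely generated module. In
    -- codimension one every reflexive form is a local fraction of elements of that module, so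
    -- normality makes `N` work for all reflexive forms.
    obtain ⟨N, hN0, hN⟩ := exists_ne_zero_smul_mem_range
      (((oneFormsImage_fg (k := k) (R := R)).pow i).map c)
    refine ⟨N, hN0, fun ω hω => exists_algebraMap_eq_of_height_le_one fun q hq => ?_⟩
    obtain ⟨ω', h1, rfl⟩ := hω q (hsm q hq)
    obtain ⟨t, ht, htω⟩ := exists_smul_germToRat_mem q h1
    obtain ⟨r, hr⟩ := hN _ ⟨_, htω, rfl⟩
    refine ⟨t, ht, r, ?_⟩
    rw [← hr, map_smul, smul_comm]
    rfl
  choose N hN0 hN using key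
  have hle : reflForms k R i ≤ Submodule.span R
      (Set.range fun s => (algebraMap R (FractionRing R) (N s))⁻¹ • E s) := by
    intro ω hω
    rw [← E.sum_repr ω]
    refine Submodule.sum_mem _ fun s _ => ?_
    obtain ⟨r, hr⟩ := hN s ω hω
    have hne : algebraMap R (FractionRing R) (N s) ≠ 0 :=
      (map_ne_zero_iff _ (IsFractionRing.injective R _)).mpr (hN0 s)
    have : E.repr ω s • E s = r • (algebraMap R (FractionRing R) (N s))⁻¹ • E s := by
      have e : E.repr ω s =
          algebraMap R (FractionRing R) r * (algebraMap R (FractionRing R) (N s))⁻¹ := by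
        rw [← hr, Algebra.smul_def, mul_right_comm, mul_inv_cancel₀ hne, one_mul]
      rw [← algebraMap_smul (FractionRing R) r, smul_smul, ← e]
    rw [this]
    exact Submodule.smul_mem _ _ (Submodule.subset_span ⟨s, rfl⟩)
  have : IsNoetherian R (Submodule.span R
      (Set.range fun s => (algebraMap R (FractionRing R) (N s))⁻¹ • E s)) :=
    isNoetherian_span_of_finite R (Set.finite_range _)
  have := isNoetherian_of_le hle
  infer_instance

end ReflexiveForms


/-! ### The exact sequences relating `B₁`, `Z`, `Ω` and `dΩ`. -/

section Sequences

universe u v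

variable {k : Type v} {R : Type u} {p : ℕ} [Fact p.Prime] [Field k] [CharP k p] [CommRing R]
  [IsDomain R] [Algebra k R] [Algebra.FiniteType k R]

theorem FPush.symm_smul (n : ℕ) (r : R) (x : FPush k p n (RatForms k R)) :
    (FPush.of k p n _).symm (r • x) = r ^ p ^ n • (FPush.of k p n _).symm x := rfl

theorem FPush.symm_smul_one (r : R) (x : FPush k p 1 (RatForms k R)) :
    (FPush.of k p 1 _).symm (r • x) = r ^ p • (FPush.of k p 1 _).symm x := by
  rw [FPush.symm_smul, pow_one]

theorem extD_pow_smul (r : R) (ω : RatForms k R) :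
    extD k _ (r ^ p • ω) = r ^ p • extD k _ ω := by
  rw [← algebraMap_smul (FractionRing R), extD_smul, map_pow, dFun_pow_p, zero_mul, zero_add,
    ← map_pow, algebraMap_smul]

variable (k R p) in
/-- The closed reflexive forms, as a submodule of `F_* Ω`. -/
def reflZ (i : ℕ) : Submodule R (FPush k p 1 (RatForms k R)) where
  carrier := {x | (FPush.of k p 1 _).symm x ∈ reflForms k R i ∧
    extD k _ ((FPush.of k p 1 _).symm x) = 0}
  add_mem' hx hy := ⟨add_mem hx.1 hy.1, by rw [map_add, map_add, hx.2, hy.2, add_zero]⟩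
  zero_mem' := ⟨zero_mem _, by rw [map_zero, map_zero]⟩
  smul_mem' r x hx := by
    refine ⟨Submodule.smul_mem _ (r ^ p ^ 1) hx.1, ?_⟩
    rw [FPush.symm_smul_one, extD_pow_smul, hx.2, smul_zero]

theorem reflZ_le (i : ℕ) : reflZ k R p i ≤ FPush.submodule k p 1 (reflForms k R i) :=
  fun _ hx => hx.1

variable (k R p) in
/-- The exterior derivative as a linear map `F_* Ω^[i] → F_* Ω`. -/
def reflD (i : ℕ) : FPush.submodule k p 1 (reflForms k R i) →ₗ[R] FPush k p 1 (RatForms k R) where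
  toFun x := FPush.of k p 1 _ (extD k _ ((FPush.of k p 1 _).symm x.1))
  map_add' x y := by rw [Submodule.coe_add, map_add, map_add, map_add]
  map_smul' r x := by
    rw [RingHom.id_apply, FPush.smul_of, pow_one, ← extD_pow_smul, Submodule.coe_smul,
      FPush.symm_smul_one]

theorem reflD_apply (i : ℕ) (x : FPush.submodule k p 1 (reflForms k R i)) :
    reflD k R p i x = FPush.of k p 1 _ (extD k _ ((FPush.of k p 1 _).symm x.1)) := rfl

theorem exact_inclusion_reflD (i : ℕ) :
    Function.Exact (Submodule.inclusion (reflZ_le (k := k) (R := R) (p := p) i))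
      (reflD k R p i).rangeRestrict := by
  intro x
  rw [← LinearMap.mem_ker, LinearMap.ker_rangeRestrict, LinearMap.mem_ker, reflD_apply]
  constructor
  · intro h
    exact ⟨⟨x.1, x.2, h⟩, rfl⟩
  · rintro ⟨z, rfl⟩
    exact z.2.2

variable [PerfectField k] [IsIntegrallyClosed R]

theorem exists_isCartier_reflZ {i : ℕ} (z : reflZ k R p i) : ∃ η : reflForms k R i,
    IsCartier p ((FPush.of k p 1 _).symm z.1) (η : RatForms k R) := by
  obtain ⟨η, hη⟩ := exists_isCartier (p := p) z.2.2
  have h1 : IsCartierIter p 1 ((FPush.of k p 1 _).symm z.1) η := ⟨η, hη, rfl⟩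
  exact ⟨⟨η, h1.mem_reflForms z.2.1⟩, hη⟩

variable (k R p) in
/-- The Cartier operator on closed reflexive forms. -/
def reflC (i : ℕ) : reflZ k R p i →ₗ[R] reflForms k R i where
  toFun z := (exists_isCartier_reflZ z).choose
  map_add' y z := Subtype.ext ((exists_isCartier_reflZ (y + z)).choose_spec.unique
    ((exists_isCartier_reflZ y).choose_spec.add (exists_isCartier_reflZ z).choose_spec))
  map_smul' r z := Subtype.ext ((exists_isCartier_reflZ (r • z)).choose_spec.unique (by
    have := (exists_isCartier_reflZ z).choose_spec.pow_smul (algebraMap R (FractionRing R) r)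
    rw [← map_pow, algebraMap_smul, algebraMap_smul] at this
    rw [Submodule.coe_smul, FPush.symm_smul_one]
    exact this))

theorem reflC_spec {i : ℕ} (z : reflZ k R p i) :
    IsCartier p ((FPush.of k p 1 _).symm z.1) (reflC k R p i z : RatForms k R) :=
  (exists_isCartier_reflZ z).choose_spec

variable {q₀ : PrimeSpectrum R}

theorem mem_reflB_iff' {n i : ℕ} {x : FPush k p n (RatForms k R)}
    (hq₀ : q₀ ∈ Algebra.smoothLocus k R) :
    x ∈ reflB k R p n i ↔ (FPush.of k p n _).symm x ∈ reflForms k R i ∧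
      IsCartierIter p n ((FPush.of k p n _).symm x) 0 :=
  mem_reflB_iff (ω := (FPush.of k p n _).symm x) hq₀

theorem reflB_one_le (hq₀ : q₀ ∈ Algebra.smoothLocus k R) (i : ℕ) :
    reflB k R p 1 i ≤ reflZ k R p i := fun x hx => by
  obtain ⟨h1, ζ, h2, rfl⟩ := (mem_reflB_iff' hq₀).mp hx
  exact ⟨h1, h2.1⟩

theorem exact_inclusion_reflC (hq₀ : q₀ ∈ Algebra.smoothLocus k R) (i : ℕ) :
    Function.Exact (Submodule.inclusion (reflB_one_le (p := p) hq₀ i)) (reflC k R p i) := by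
  intro z
  have hz := reflC_spec z
  constructor
  · intro h
    rw [h] at hz
    exact ⟨⟨z.1, (mem_reflB_iff' hq₀).mpr ⟨z.2.1, 0, hz, rfl⟩⟩, rfl⟩
  · rintro ⟨y, rfl⟩
    obtain ⟨-, ζ, h2, rfl⟩ := (mem_reflB_iff' hq₀).mp y.2
    exact Subtype.ext (hz.unique h2)

theorem reflC_surjective (hq₀ : q₀ ∈ Algebra.smoothLocus k R) {i : ℕ}
    (hC : CartierSurjective k R p i) : Function.Surjective (reflC k R p i) := by
  intro η
  obtain ⟨ω, hω, h⟩ := hC η η.2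
  obtain ⟨-, ζ, h2, rfl⟩ := (isReflCartier_iff hq₀).mp h
  let z : reflZ k R p i := ⟨FPush.of k p 1 _ ω, hω, h2.1⟩
  exact ⟨z, Subtype.ext ((reflC_spec z).unique h2)⟩

/-- The map `F_* Ω^[i] → F^(n + 1)_* Ω^[i] / B_(n + 1) Ω^[i]` induced by `Cₙ⁻¹`. -/
def CartierSurjective.pushInverse {i : ℕ} (hC : CartierSurjective k R p i)
    (hq₀ : q₀ ∈ Algebra.smoothLocus k R) (n : ℕ) :
    FPush.submodule k p 1 (reflForms k R i) →ₗ[R] ReflQuot k R p (n + 1) i :=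
  -- Two lifts under `Cₙ` differ by a form with `Cₙ = 0`, which then also has `C_(n+1) = 0`.
  have hdiff : ∀ {ω₁ ω₂ η : RatForms k R} (h₁ : IsReflCartier k R p n i ω₁ η)
      (h₂ : IsReflCartier k R p n i ω₂ η),
      (Submodule.Quotient.mk ⟨FPush.of k p (n + 1) _ ω₁, h₁.mem_left⟩ : ReflQuot k R p (n + 1) i) =
        Submodule.Quotient.mk ⟨FPush.of k p (n + 1) _ ω₂, h₂.mem_left⟩ := by
    intro ω₁ ω₂ η h₁ h₂
    refine (Submodule.Quotient.eq _).mpr ?_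
    have h := (mem_reflB_iff hq₀).mp (h₁.sub_mem h₂)
    exact (mem_reflB_iff (ω := ω₁ - ω₂) hq₀).mpr ⟨h.1, h.2.comp (IsCartierIter.zero 1)⟩
  { toFun := fun x => Submodule.Quotient.mk
      ⟨FPush.of k p (n + 1) _ (hC.iter n x.2).choose, (hC.iter n x.2).choose_spec.mem_left⟩
    map_add' := fun x y => hdiff (hC.iter n (x + y).2).choose_spec
      ((hC.iter n x.2).choose_spec.add (hC.iter n y.2).choose_spec)
    map_smul' := fun r x => by
      have h := (hC.iter n x.2).choose_spec.pow_smul (r ^ p)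
      rw [← pow_mul, ← pow_succ'] at h
      exact hdiff (η := r ^ p • (FPush.of k p 1 _).symm x.1)
        (FPush.symm_smul_one r x.1 ▸ (hC.iter n (r • x).2).choose_spec) h }

/-- If `z` is closed, a lift of `z` under `Cₙ` is a lift of `C z` under `C_(n+1)`. -/
theorem CartierSurjective.pushInverse_comp {i : ℕ} (hC : CartierSurjective k R p i)
    (hq₀ : q₀ ∈ Algebra.smoothLocus k R) (n : ℕ) :
    hC.pushInverse hq₀ n ∘ₗ Submodule.inclusion (reflZ_le i) =
      hC.inverse (n + 1) ∘ₗ reflC k R p i := by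
  ext z
  have h := (hC.iter n (Submodule.inclusion (reflZ_le i) z).2).choose_spec
  obtain ⟨h1, h2⟩ := (isReflCartier_iff hq₀).mp h
  have h3 : IsReflCartier k R p (n + 1) i _ (reflC k R p i z : RatForms k R) :=
    (isReflCartier_iff hq₀).mpr ⟨h1, h2.comp (n := 1) ⟨_, reflC_spec z, rfl⟩⟩
  exact (hC.inverse_apply (n + 1) (reflC k R p i z) h3).symm

variable {𝔪 : Ideal R}

/-- On `H^j` both `C` and `C_(n+1)⁻¹` are injective, the former because `H^j(B₁) = 0`. Their
composite factors through the inclusion of `Z`. -/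
theorem lcMap_inclusion_reflZ_injective (hq₀ : q₀ ∈ Algebra.smoothLocus k R) {i j n : ℕ}
    (hC : CartierSurjective k R p i) (hB : Subsingleton (LC 𝔪 j (reflB k R p 1 i)))
    (hinv : Function.Injective (lcMap 𝔪 j (hC.inverse (n + 1)))) :
    Function.Injective
      (lcMap 𝔪 j (Submodule.inclusion (reflZ_le (k := k) (R := R) (p := p) i))) := by
  have h1 : Function.Injective (lcMap 𝔪 j (reflC k R p i)) :=
    lcMap_injective_of_subsingleton_left (Submodule.inclusion_injective _)
      (exact_inclusion_reflC hq₀ i) (reflC_surjective hq₀ hC) j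
  have h2 := hinv.comp h1
  have h3 : ⇑(lcMap 𝔪 j (hC.inverse (n + 1))) ∘ ⇑(lcMap 𝔪 j (reflC k R p i)) =
      ⇑(lcMap 𝔪 j (hC.pushInverse hq₀ n)) ∘
        ⇑(lcMap 𝔪 j (Submodule.inclusion (reflZ_le (k := k) (R := R) (p := p) i))) := by
    funext y
    simp only [Function.comp_apply, lcMap_comp_apply, hC.pushInverse_comp hq₀ n]
  rw [h3] at h2
  exact h2.of_comp

end Sequences


/-! ### Vanishing for exact forms and for all `Bₙ`. -/

section Vanishing

universe u v

variable {k : Type v} {R : Type u} {p : ℕ} [Fact p.Prime] [Field k] [CharP k p] [CommRing R]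
  [IsDomain R] [Algebra k R] [Algebra.FiniteType k R]

variable (k p) in
/-- The identity map `N → Fⁿ_* N`. -/
def FPush.submoduleEquiv (n : ℕ) (N : Submodule R (RatForms k R)) :
    N ≃+ FPush.submodule k p n N where
  toFun x := ⟨FPush.of k p n _ x.1, x.2⟩
  invFun x := ⟨(FPush.of k p n _).symm x.1, x.2⟩
  left_inv _ := rfl
  right_inv _ := rfl
  map_add' _ _ := rfl

theorem FPush.submoduleEquiv_smul (n : ℕ) (N : Submodule R (RatForms k R)) (r : R) (x : N) :
    FPush.submoduleEquiv k p n N (r ^ p ^ n • x) = r • FPush.submoduleEquiv k p n N x := rfl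

theorem withBot_le_of_add_natCast_le {a b : WithBot ℕ∞} {n : ℕ} (h : a + n ≤ b + n) : a ≤ b := by
  induction n with
  | zero => simpa using h
  | succ n ih =>
    rw [Nat.cast_succ, ← add_assoc, ← add_assoc] at h
    exact ih (withBot_le_of_add_one_le h)

variable {𝔪 : Ideal R}

/-- Injectivity in degree `t` itself is required, since `H^(t-1)` of the image maps to `H^t(Z)`. -/
theorem lcVanish_range_reflD [IsNoetherianRing R] {i t : ℕ} [Module.Finite R (reflForms k R i)]
    (hM : LCVanish 𝔪 t (reflForms k R i))
    (hZ : ∀ j ≤ t, Function.Injective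
      (lcMap 𝔪 j (Submodule.inclusion (reflZ_le (k := k) (R := R) (p := p) i)))) :
    LCVanish 𝔪 t (LinearMap.range (reflD k R p i)) := fun j hj => by
  have := hM.of_pow_semilinear (FPush.submoduleEquiv k p 1 _)
    (FPush.submoduleEquiv_smul 1 _) j hj
  exact lc_subsingleton_right (Submodule.inclusion_injective _) (exact_inclusion_reflD i)
    (LinearMap.surjective_rangeRestrict _) j (hZ (j + 1) hj)

variable [PerfectField k]

theorem finite_push_reflForms {i : ℕ} [Module.Finite R (reflForms k R i)] :
    Module.Finite R (FPush.submodule k p 1 (reflForms k R i)) :=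
  finite_of_semilinear (frob_finite k R p) (FPush.submoduleEquiv k p 1 _)
    (FPush.submoduleEquiv_smul 1 _)

variable [IsIntegrallyClosed R] {q₀ : PrimeSpectrum R}

theorem finite_reflB_one [IsNoetherianRing R] (hq₀ : q₀ ∈ Algebra.smoothLocus k R) {i : ℕ}
    [Module.Finite R (reflForms k R i)] : Module.Finite R (reflB k R p 1 i) := by
  have := finite_push_reflForms (k := k) (R := R) (p := p) (i := i)
  exact Module.Finite.of_injective (Submodule.inclusion ((reflB_one_le (p := p) hq₀ i).trans
    (reflZ_le i))) (Submodule.inclusion_injective _)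

theorem reflB_one_zero (hq₀ : q₀ ∈ Algebra.smoothLocus k R) : reflB k R p 1 0 = ⊥ := by
  rw [eq_bot_iff]
  intro x hx
  obtain ⟨ω, h1, h2, h3⟩ := hx q₀ hq₀
  obtain ⟨τ, rfl⟩ := isCartierIter_one_zero.mp h3
  rw [Submodule.mem_bot, ← h2, extD_eq_zero_of_mem_zero h1, map_zero, map_zero]

theorem range_reflD_le (hq₀ : q₀ ∈ Algebra.smoothLocus k R) (i : ℕ) :
    LinearMap.range (reflD k R p i) ≤ reflB k R p 1 (i + 1) := by
  rintro _ ⟨x, rfl⟩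
  rw [reflD_apply, mem_reflB_iff hq₀]
  exact ⟨extD_mem_reflForms x.2, isCartierIter_one_zero.mpr ⟨_, rfl⟩⟩

theorem FPush.smul_eq_zero_of_ne_zero {n : ℕ} {r : R} (hr : r ≠ 0)
    {x : FPush k p n (RatForms k R)} (h : r • x = 0) : x = 0 := by
  have h' : r ^ p ^ n • (FPush.of k p n _).symm x = 0 := h
  rw [← algebraMap_smul (FractionRing R), smul_eq_zero] at h'
  exact h'.resolve_left ((map_ne_zero_iff _ (IsFractionRing.injective R _)).mpr (pow_ne_zero _ hr))

/-- Reflexive forms that are locally exact on the smooth locus are exact. -/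
theorem range_reflD_eq [IsNoetherianRing R] (hq₀ : q₀ ∈ Algebra.smoothLocus k R) {d m i : ℕ}
    (hd : ringKrullDim R = d)
    (hsing : ∀ q ∉ Algebra.smoothLocus k R, ((m + 2 : ℕ) : ℕ∞) ≤ q.asIdeal.height) (hi : i < m)
    [Module.Finite R (reflForms k R i)]
    (hv : ∀ (𝔪 : Ideal R) [𝔪.IsMaximal], LCVanish 𝔪 (d - i) (LinearMap.range (reflD k R p i))) :
    LinearMap.range (reflD k R p i) = reflB k R p 1 (i + 1) := by
  refine le_antisymm (range_reflD_le hq₀ i) fun b₀ hb₀ => ?_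
  by_contra hb
  obtain ⟨r₀, P, hP⟩ := exists_prime_colon _ hb
  -- At a smooth point the form has a local primitive. Multiplying by `s ^ p` makes the primitive
  -- global, and `d` commutes with this multiplication, so `s` would lie in the colon ideal `P`.
  have hPns : P ∉ Algebra.smoothLocus k R := by
    intro hsm
    obtain ⟨ω, h1, h2, h3⟩ := (Submodule.smul_mem _ r₀ hb₀ : r₀ • b₀ ∈ reflB k R p 1 (i + 1)) P hsm
    obtain ⟨τ', rfl⟩ := isCartierIter_one_zero.mp h3
    obtain ⟨τ, h4, h5⟩ := exists_extD_eq_of_mem h1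
    obtain ⟨s, hs, hsτ⟩ := exists_smul_germToRat_mem P h4
    refine hs ((hP s).mp ?_)
    have hmem : s ^ p • germToRat k P τ ∈ reflForms k R i := by
      have := Submodule.smul_mem _ (s ^ (p - 1)) (oneFormsImage_pow_le i hsτ)
      rwa [smul_smul, ← pow_succ, Nat.sub_add_cancel (Fact.out : p.Prime).one_le] at this
    refine ⟨⟨FPush.of k p 1 _ (s ^ p • germToRat k P τ), hmem⟩, ?_⟩
    rw [reflD_apply, ← h2, FPush.smul_of, pow_one]
    change FPush.of k p 1 _ (extD k _ (s ^ p • germToRat k P τ)) = _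
    rw [extD_pow_smul, ← pullback_extD, h5]
  have hht := hsing P hPns
  have hdim := ringKrullDim_quotient_add_height_le P hht
  rw [hd] at hdim
  have h0 : (0 : WithBot ℕ∞) ≤ ringKrullDim (R ⧸ P.asIdeal) := ringKrullDim_nonneg_of_nontrivial
  have hmd : m + 2 ≤ d := by
    have : ((m + 2 : ℕ) : WithBot ℕ∞) ≤ d := by
      refine le_trans ?_ hdim
      simpa using add_le_add_left h0 ((m + 2 : ℕ) : WithBot ℕ∞)
    exact_mod_cast this
  have hle : ringKrullDim (R ⧸ P.asIdeal) ≤ ((d - (m + 2) : ℕ) : WithBot ℕ∞) := by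
    have e : (d : WithBot ℕ∞) = ((d - (m + 2) : ℕ) : WithBot ℕ∞) + ((m + 2 : ℕ) : WithBot ℕ∞) := by
      rw [← Nat.cast_add, Nat.sub_add_cancel hmd]
    rw [e] at hdim
    exact withBot_le_of_add_natCast_le hdim
  have := finite_push_reflForms (k := k) (R := R) (p := p) (i := i)
  -- The numerical condition is `1 + (d - (m + 2)) < d - i`. The remaining difference is killed by
  -- `P ≠ 0`, hence vanishes because rational forms are torsion-free.
  obtain ⟨b₁, hb₁, h1⟩ := exists_sub_smul_eq_zero (LinearMap.range (reflD k R p i))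
    (fun 𝔪 _ => hv 𝔪) P.asIdeal _ hle (by omega) (r₀ • b₀) (fun r hr => (hP r).mpr hr)
  obtain ⟨r, hr, hr0⟩ : ∃ r ∈ P.asIdeal, r ≠ 0 := by
    by_contra hall
    push Not at hall
    have hbot : P.asIdeal = ⊥ := by
      rw [eq_bot_iff]
      exact fun r hr => hall r hr
    rw [hbot, Ideal.height_bot] at hht
    exact absurd hht (by simp)
  have hz := FPush.smul_eq_zero_of_ne_zero hr0 (h1 r hr)
  have h2 : (1 : R) ∈ P.asIdeal := (hP 1).mp (by rw [one_smul, sub_eq_zero.mp hz]; exact hb₁)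
  exact P.isPrime.ne_top ((Ideal.eq_top_iff_one _).mpr h2)

theorem exists_isCartier_reflB (hq₀ : q₀ ∈ Algebra.smoothLocus k R) {n i : ℕ}
    (x : reflB k R p (n + 1) i) : ∃ y : reflB k R p n i,
      IsCartier p ((FPush.of k p (n + 1) _).symm x.1) ((FPush.of k p n _).symm y.1) := by
  obtain ⟨h1, ζ, h2, h3⟩ := (mem_reflB_iff' hq₀).mp x.2
  have h4 : IsCartierIter p 1 ((FPush.of k p (n + 1) _).symm x.1) ζ := ⟨ζ, h2, rfl⟩
  exact ⟨⟨FPush.of k p n _ ζ, (mem_reflB_iff hq₀).mpr ⟨h4.mem_reflForms h1, h3⟩⟩, h2⟩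

/-- The Cartier operator `B_(n + 1) Ω^[i] → Bₙ Ω^[i]`. -/
def reflBC (hq₀ : q₀ ∈ Algebra.smoothLocus k R) (n i : ℕ) :
    reflB k R p (n + 1) i →ₗ[R] reflB k R p n i where
  toFun x := (exists_isCartier_reflB hq₀ x).choose
  map_add' x y := Subtype.ext ((exists_isCartier_reflB hq₀ (x + y)).choose_spec.unique
    ((exists_isCartier_reflB hq₀ x).choose_spec.add (exists_isCartier_reflB hq₀ y).choose_spec))
  map_smul' r x := Subtype.ext ((exists_isCartier_reflB hq₀ (r • x)).choose_spec.unique (by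
    have := (exists_isCartier_reflB hq₀ x).choose_spec.pow_smul
      (algebraMap R (FractionRing R) r ^ p ^ n)
    rw [← pow_mul, ← pow_succ, ← map_pow, ← map_pow, algebraMap_smul, algebraMap_smul] at this
    exact this))

theorem reflBC_spec (hq₀ : q₀ ∈ Algebra.smoothLocus k R) {n i : ℕ} (x : reflB k R p (n + 1) i) :
    IsCartier p ((FPush.of k p (n + 1) _).symm x.1)
      ((FPush.of k p n _).symm (reflBC hq₀ n i x).1) :=
  (exists_isCartier_reflB hq₀ x).choose_spec

theorem reflBC_surjective (hq₀ : q₀ ∈ Algebra.smoothLocus k R) {n i : ℕ}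
    (hC : CartierSurjective k R p i) : Function.Surjective (reflBC (p := p) hq₀ n i) := by
  intro y
  obtain ⟨h1, h2⟩ := (mem_reflB_iff' hq₀).mp y.2
  obtain ⟨ω, hω, h⟩ := hC _ h1
  obtain ⟨-, ζ, h3, rfl⟩ := (isReflCartier_iff hq₀).mp h
  let x : reflB k R p (n + 1) i :=
    ⟨FPush.of k p (n + 1) _ ω, (mem_reflB_iff hq₀).mpr ⟨hω, _, h3, h2⟩⟩
  exact ⟨x, Subtype.ext ((reflBC_spec hq₀ x).unique h3)⟩

/-- The kernel of `C : B_(n + 1) Ω^[i] → Bₙ Ω^[i]` is `Fⁿ_* B₁ Ω^[i]`. -/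
def kerReflBCEquiv (hq₀ : q₀ ∈ Algebra.smoothLocus k R) (n i : ℕ) :
    reflB k R p 1 i ≃+ LinearMap.ker (reflBC (p := p) hq₀ n i) where
  toFun x := ⟨⟨FPush.of k p (n + 1) _ ((FPush.of k p 1 _).symm x.1), by
      obtain ⟨h1, ζ, h2, rfl⟩ := (mem_reflB_iff' hq₀).mp x.2
      exact (mem_reflB_iff hq₀).mpr ⟨h1, 0, h2, IsCartierIter.zero n⟩⟩, by
    obtain ⟨h1, ζ, h2, rfl⟩ := (mem_reflB_iff' hq₀).mp x.2
    exact Subtype.ext ((reflBC_spec hq₀ _).unique h2)⟩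
  invFun x := ⟨FPush.of k p 1 _ ((FPush.of k p (n + 1) _).symm x.1.1), by
    have h := reflBC_spec hq₀ x.1
    rw [LinearMap.mem_ker.mp x.2] at h
    exact (mem_reflB_iff hq₀).mpr ⟨((mem_reflB_iff' hq₀).mp x.1.2).1, 0, h, rfl⟩⟩
  left_inv _ := rfl
  right_inv _ := rfl
  map_add' _ _ := rfl

/-- Induction along `0 → Fⁿ_* B₁ → B_(n+1) → Bₙ → 0`, exact on the right because `C` is surjective
on reflexive forms. -/
theorem lcVanish_reflB [IsNoetherianRing R] (hq₀ : q₀ ∈ Algebra.smoothLocus k R) {t i : ℕ}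
    [Module.Finite R (reflForms k R i)] (hC : CartierSurjective k R p i)
    (hB : LCVanish 𝔪 t (reflB k R p 1 i)) (n : ℕ) : LCVanish 𝔪 t (reflB k R p (n + 1) i) := by
  induction n with
  | zero => exact hB
  | succ n ih =>
    intro j hj
    have := finite_reflB_one (p := p) hq₀ (i := i)
    have := ih j hj
    have hker : LCVanish 𝔪 t (LinearMap.ker (reflBC (p := p) hq₀ (n + 1) i)) :=
      -- Scalars already act on `B₁` through `p`-th powers and must act on the kernel through `p ^
      -- (n + 2)`-th powers.
      hB.of_pow_semilinear (q := p ^ (n + 1)) (kerReflBCEquiv hq₀ (n + 1) i) fun r x => by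
        refine Subtype.ext (Subtype.ext ?_)
        change (r ^ p ^ (n + 1)) ^ p ^ 1 • (FPush.of k p 1 _).symm x.1 =
          r ^ p ^ (n + 1 + 1) • (FPush.of k p 1 _).symm x.1
        rw [← pow_mul, ← pow_add]
    have := hker j hj
    exact lc_subsingleton_middle (Submodule.injective_subtype _)
      (LinearMap.exact_subtype_ker_map (reflBC (p := p) hq₀ (n + 1) i))
      (reflBC_surjective hq₀ hC) j

end Vanishing


/-! ### The induction on the degree of forms. -/

section Main

universe u v

variable {k : Type v} {R : Type u} {p : ℕ} [Fact p.Prime] [Field k] [CharP k p] [CommRing R]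
  [IsDomain R] [Algebra k R] [Algebra.FiniteType k R]

theorem isUnit_coeIdeal_span_singleton {c : R} (hc : c ≠ 0) :
    IsUnit ((Ideal.span {c} : Ideal R) : FractionalIdeal (nonZeroDivisors R) (FractionRing R)) := by
  have hc' : algebraMap R (FractionRing R) c ≠ 0 :=
    (map_ne_zero_iff _ (IsFractionRing.injective R _)).mpr hc
  rw [FractionalIdeal.coeIdeal_span_singleton]
  refine IsUnit.of_mul_eq_one (FractionalIdeal.spanSingleton _ (algebraMap R _ c)⁻¹) ?_
  rw [FractionalIdeal.spanSingleton_mul_spanSingleton, mul_inv_cancel₀ hc',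
    FractionalIdeal.spanSingleton_one]

theorem smul_inv_smul_ratForms {c : R} (hc : c ≠ 0) (ω : RatForms k R) :
    c • (algebraMap R (FractionRing R) c)⁻¹ • ω = ω := by
  rw [← algebraMap_smul (FractionRing R), smul_inv_smul₀]
  exact (map_ne_zero_iff _ (IsFractionRing.injective R _)).mpr hc

variable (k p) in
/-- Division by `c`, as a map `Fⁿ_* Ω^[i] → Fⁿ_* Ω^[i](D)` where `D` is the divisor of `c`. -/
def divTwist {c : R} (hc : c ≠ 0) (n i : ℕ) : FPush.submodule k p n (reflForms k R i) →ₗ[R]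
    FPush.submodule k p n (reflFormsTwist k R (Ideal.span {c}) i) where
  toFun x := ⟨FPush.of k p n _ ((algebraMap R (FractionRing R) c)⁻¹ • (FPush.of k p n _).symm x.1),
    fun a ha => by
      obtain ⟨b, rfl⟩ := Ideal.mem_span_singleton'.mp ha
      rw [AddEquiv.symm_apply_apply, mul_smul, smul_inv_smul_ratForms hc]
      exact Submodule.smul_mem _ _ x.2⟩
  map_add' x y := Subtype.ext (by simp)
  map_smul' r x := Subtype.ext (by
    change FPush.of k p n _ (_ • (FPush.of k p n _).symm (r • x.1)) = r • FPush.of k p n _ _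
    rw [FPush.symm_smul, FPush.smul_of, smul_comm])

variable (k p) in
/-- Multiplication by `c` on the group underlying `Fⁿ_* Ω^[i]`. -/
def mulPush (c : R) (n i : ℕ) : FPush.submodule k p n (reflForms k R i) →ₗ[R]
    FPush.submodule k p n (reflForms k R i) where
  toFun x := FPush.submoduleEquiv k p n _ (c • (FPush.submoduleEquiv k p n _).symm x)
  map_add' x y := by rw [map_add, smul_add, map_add]
  map_smul' r x := by
    rw [RingHom.id_apply, ← FPush.submoduleEquiv_smul, smul_comm]
    rfl

/-- If `t ∘ f` is injective on local cohomology, `π` is surjective and `t ∘ π` factors through a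
map that vanishes on local cohomology, then the local cohomology of the source of `f` is zero. -/
theorem lc_subsingleton_of_factor {I : Ideal R} {j : ℕ} {A Q T F G : Type u}
    [AddCommGroup A] [Module R A] [AddCommGroup Q] [Module R Q] [AddCommGroup T] [Module R T]
    [AddCommGroup F] [Module R F] [AddCommGroup G] [Module R G] {f : A →ₗ[R] Q} {t : Q →ₗ[R] T}
    {π : F →ₗ[R] Q} {γ : F →ₗ[R] G} {u : G →ₗ[R] T} (hinj : Function.Injective (lcMap I j (t ∘ₗ f)))
    (hsurj : Function.Surjective (lcMap I j π)) (h : t ∘ₗ π = u ∘ₗ γ) (hγ : lcMap I j γ = 0) :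
    Subsingleton (LC I j A) := by
  refine subsingleton_of_forall_eq 0 fun y => (map_eq_zero_iff _ hinj).mp ?_
  obtain ⟨z, hz⟩ := hsurj (lcMap I j f y)
  rw [← lcMap_comp_apply, ← hz, lcMap_comp_apply, h, lcMap_comp, hγ, LinearMap.comp_zero,
    LinearMap.zero_apply]

/-- The identity `x = c⁻¹ (c x)`: passing to `Ω^[i](D)` factors through multiplication by `c`, which
dies on local cohomology. -/
theorem reflQuotTwistMap_comp_mkQ {c : R} (hc : c ≠ 0) (n i : ℕ) :
    reflQuotTwistMap k R p (Ideal.span {c}) n i ∘ₗ Submodule.mkQ _ =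
      (Submodule.mkQ _ ∘ₗ divTwist k p hc n i) ∘ₗ mulPush k p c n i := by
  ext x
  refine congrArg Submodule.Quotient.mk (Subtype.ext ?_)
  change x.1 = FPush.of k p n _ ((algebraMap R (FractionRing R) c)⁻¹ •
    c • (FPush.of k p n _).symm x.1)
  rw [smul_comm, smul_inv_smul_ratForms hc, AddEquiv.apply_symm_apply]

/-- This is the case `D = 0` of pre-`m`-`F`-rationality. The bound includes `i + j = d`, which the
passage to `B₁ Ω^[i+1]` requires. -/
theorem IsPreFRational.exists_inverse_injective {m : ℕ} (hX : IsPreFRational k R p m)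
    {d i : ℕ} (hd : ringKrullDim R = d) (hi : i ≤ m) (hC : CartierSurjective k R p i)
    (𝔪 : Ideal R) [𝔪.IsMaximal] :
    ∃ n, ∀ j, i + j ≤ d → Function.Injective (lcMap 𝔪 j (hC.inverse (n + 1))) := by
  obtain ⟨_, h⟩ := hX
  obtain ⟨n, -, h⟩ := h 𝔪 ⊤ (by rw [FractionalIdeal.coeIdeal_top]; exact isUnit_one)
  refine ⟨n, fun j hj => ?_⟩
  have h1 : Function.Injective (lcMap 𝔪 j (reflQuotTwistMap k R p ⊤ (n + 1) i ∘ₗ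
    hC.inverse (n + 1))) := h i hi j (n + 1) n.le_succ (by rw [hd]; exact_mod_cast hj)
  rw [lcMap_comp] at h1
  exact Function.Injective.of_comp (f := lcMap 𝔪 j (reflQuotTwistMap k R p ⊤ (n + 1) i)) h1

variable [PerfectField k] [IsIntegrallyClosed R] {q₀ : PrimeSpectrum R} {𝔪 : Ideal R}

theorem reflB_le_push (hq₀ : q₀ ∈ Algebra.smoothLocus k R) (n i : ℕ) :
    reflB k R p n i ≤ FPush.submodule k p n (reflForms k R i) :=
  fun _ hx => ((mem_reflB_iff' hq₀).mp hx).1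

theorem lcMap_mkQ_surjective (hq₀ : q₀ ∈ Algebra.smoothLocus k R) {n i j : ℕ}
    (hB : Subsingleton (LC 𝔪 (j + 1) (reflB k R p n i))) :
    Function.Surjective (lcMap 𝔪 j ((reflB k R p n i).submoduleOf
      (FPush.submodule k p n (reflForms k R i))).mkQ) := by
  have := (lc_subsingleton_congr 𝔪 (j + 1)
    (Submodule.submoduleOfEquivOfLe (reflB_le_push (p := p) hq₀ n i))).mpr hB
  exact lcMap_surjective_of_subsingleton (Submodule.injective_subtype _)
    (LinearMap.exact_subtype_mkQ _) (Submodule.mkQ_surjective _) j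

/-- If the local cohomology of `B₁ Ω^[i]` vanishes in degrees at most `d - i`, then that of
`Ω^[i]` vanishes in degrees less than `d - i`. -/
theorem IsPreFRational.lcVanish_reflForms [IsNoetherianRing R] {m : ℕ}
    (hX : IsPreFRational k R p m) (hq₀ : q₀ ∈ Algebra.smoothLocus k R) {d i : ℕ}
    (hd : ringKrullDim R = d) (hi : i ≤ m) [Module.Finite R (reflForms k R i)] [𝔪.IsMaximal]
    (hB : LCVanish 𝔪 (d + 1 - i) (reflB k R p 1 i)) : LCVanish 𝔪 (d - i) (reflForms k R i) := by
  intro j hj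
  obtain ⟨c, hc, hγ⟩ := exists_lcMap_eq_zero (k := k) hd 𝔪 (M := reflForms k R i)
  obtain ⟨hC, h⟩ := hX
  obtain ⟨n₀, hn₀, h⟩ := h 𝔪 (Ideal.span {c}) (isUnit_coeIdeal_span_singleton hc)
  obtain ⟨n, rfl⟩ := Nat.exists_eq_add_one_of_ne_zero hn₀.ne'
  have hinj : Function.Injective (lcMap 𝔪 j (reflQuotTwistMap k R p (Ideal.span {c}) (n + 1) i ∘ₗ
    (hC i hi).inverse (n + 1))) := h i hi j (n + 1) le_rfl (by rw [hd]; norm_cast; omega)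
  -- Surjectivity in degree `j` uses vanishing for `Bₙ` in degree `j + 1 ≤ d - i`, whence the bound
  -- `d + 1 - i` in the hypothesis.
  have hsurj := lcMap_mkQ_surjective hq₀
    (lcVanish_reflB hq₀ (hC i hi) hB n (j + 1) (by omega))
  have hzero : lcMap 𝔪 j (mulPush k p c (n + 1) i) = 0 :=
    hγ _ (FPush.submoduleEquiv k p (n + 1) _) _ (FPush.submoduleEquiv_smul (n + 1) _) _
      (fun _ => rfl) j (by omega)
  exact lc_subsingleton_of_factor hinj hsurj (reflQuotTwistMap_comp_mkQ hc (n + 1) i) hzero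

theorem lcVanish_bot {t : ℕ} {M : Type u} [AddCommGroup M] [Module R M] :
    LCVanish 𝔪 t (⊥ : Submodule R M) := fun j _ => by
  refine subsingleton_of_forall_eq 0 fun y => ?_
  have h := congrArg (· y) (lcMap_id (A := (⊥ : Submodule R M)) 𝔪 j)
  rw [Subsingleton.elim LinearMap.id (0 : (⊥ : Submodule R M) →ₗ[R] _), lcMap_zero] at h
  exact h.symm

/-- The local cohomology of `B₁ Ω^[i]` vanishes in degrees at most `d - i`. -/
theorem IsPreFRational.lcVanish_reflB_one [IsNoetherianRing R] {m : ℕ}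
    (hX : IsPreFRational k R p m) (hq₀ : q₀ ∈ Algebra.smoothLocus k R) {d : ℕ}
    (hd : ringKrullDim R = d)
    (hsing : ∀ q ∉ Algebra.smoothLocus k R, ((m + 2 : ℕ) : ℕ∞) ≤ q.asIdeal.height)
    (hfin : ∀ i, Module.Finite R (reflForms k R i)) {i : ℕ} (hi : i ≤ m) :
    ∀ (𝔪 : Ideal R) [𝔪.IsMaximal], LCVanish 𝔪 (d + 1 - i) (reflB k R p 1 i) := by
  induction i with
  | zero =>
    intro 𝔪 _
    rw [reflB_one_zero hq₀]
    exact lcVanish_bot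
  | succ i ih =>
    have ih := ih (by omega)
    have hC := hX.choose i (by omega)
    have hD : ∀ (𝔪 : Ideal R) [𝔪.IsMaximal],
        LCVanish 𝔪 (d - i) (LinearMap.range (reflD k R p i)) := fun 𝔪 _ => by
      -- For `i > d` the truncated difference `d - i` is zero and nothing is claimed.
      rcases le_or_gt i d with hid | hid
      · obtain ⟨n, hn⟩ := hX.exists_inverse_injective hd (by omega) hC 𝔪
        exact lcVanish_range_reflD (hX.lcVanish_reflForms hq₀ hd (by omega) (ih 𝔪)) fun j hj =>
          lcMap_inclusion_reflZ_injective hq₀ hC (ih 𝔪 j (by omega)) (hn j (by omega))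
      · intro j hj
        omega
    intro 𝔪 _
    -- The bounds match because `d + 1 - (i + 1) = d - i`.
    rw [← range_reflD_eq hq₀ hd hsing hi hD, Nat.add_sub_add_right]
    exact hD 𝔪

theorem le_height_of_notMem_smoothLocus {m : ℕ} (hm : (m : ℕ∞) + 2 ≤ codimSing k R)
    {q : PrimeSpectrum R} (hq : q ∉ Algebra.smoothLocus k R) :
    ((m + 2 : ℕ) : ℕ∞) ≤ q.asIdeal.height := by
  rw [Nat.cast_add, Nat.cast_ofNat]
  exact hm.trans (iInf₂_le q hq)

theorem mem_smoothLocus_of_height_le_one {m : ℕ} (hm : (m : ℕ∞) + 2 ≤ codimSing k R)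
    {q : PrimeSpectrum R} (hq : q.asIdeal.height ≤ 1) : q ∈ Algebra.smoothLocus k R := by
  by_contra h
  have h1 := (le_height_of_notMem_smoothLocus hm h).trans hq
  have h2 : m + 2 ≤ 1 := by exact_mod_cast h1
  omega

end Main

end HigherF

end

theorem theoremB {k : Type*} {R : Type*} (p : ℕ) [Fact p.Prime] [Field k] [CharP k p]
    [PerfectField k] [CommRing R] [IsDomain R] [IsIntegrallyClosed R] [Algebra k R]
    [Algebra.FiniteType k R] (d m : ℕ) (hd : ringKrullDim R = d)
    (hm : (m : ℕ∞) + 2 ≤ HigherF.codimSing k R) (hX : HigherF.IsPreFRational k R p m)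
    (𝔪 : Ideal R) [𝔪.IsMaximal] (i j : ℕ) (hi : i ≤ m) (hij : i + j < d) :
    Subsingleton ((localCohomology 𝔪 j).obj (ModuleCat.of R (HigherF.reflForms k R i))) := by
  have := Algebra.FiniteType.isNoetherianRing k R
  have hsm := fun (q : PrimeSpectrum R) => HigherF.mem_smoothLocus_of_height_le_one (q := q) hm
  -- The generic point has height zero, so it is smooth and can serve as the auxiliary smooth point.
  have hq₀ := hsm ⊥ (by simp)
  have hfin := HigherF.finite_reflForms (k := k) (R := R) hsm
  have := hfin i
  exact hX.lcVanish_reflForms hq₀ hd hi (hX.lcVanish_reflB_one hq₀ hd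
    (fun _ => HigherF.le_height_of_notMem_smoothLocus hm) hfin hi 𝔪) j (by omega)
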